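/- Let $\sigma>0$, let $\mathcal H$ be a Hilbert space and let $\mathcal B_0,\mathcal B_1$ be a compatible couple of Banach spaces (both continuously embedded in one Hausdorff topological vector space), all over $\mathbb R$ or all over $\mathbb C$. Duals $X^*$ are taken with the sesquilinear pairing. For each $t\in\mathbb R$ let $U(t):\mathcal H\to\mathcal B_0^*$ be a bounded linear operator, with adjoint $U^*(t):\mathcal B_0\to\mathcal H$, $\langle U^*(t)g,f\rangle_{\mathcal H}=(U(t)f)(g)$, such that $s\mapsto U^*(s)g$ is strongly measurable for every $g\in\mathcal B_0$. A functional $u\in\mathcal B_0^*$ is said to lie in $Y^*$, where $Y$ is another space of the scale, if it coincides on $\mathcal B_0\cap Y$ with a functional in $Y^*$; $\|u\|_{Y^*}$ is the least norm of such a functional, and $\|u\|_{Y^*}=\infty$ if there is none. Assume that there are constants $A,D$ with $$\|U(t)f\|_{\mathcal B_0^*}\le A\|f\|_{\mathcal H}\quad(t\in\mathbb R,\ f\in\mathcal H),\qquad \|U(t)U^*(s)g\|_{\mathcal B_1^*}\le D|t-s|^{-\sigma}\|g\|_{\mathcal B_1}\quad(t\ne s,\ g\in\mathcal B_0\cap\mathcal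 B_1).$$ For $0<\theta<1$ let $\mathcal B_\theta=(\mathcal B_0,\mathcal B_1)_{\theta,2}$ be the real interpolation space, with norm $\big(\int_0^\infty(\tau^{-\theta}K(\tau,v))^2\frac{d\tau}{\tau}\big)^{1/2}$, $K(\tau,v)=\inf_{v=a+b}(\|a\|_{\mathcal B_0}+\tau\|b\|_{\mathcal B_1})$; for $\theta=0$ and $\theta=1$, $\mathcal B_\theta$ means $\mathcal B_0$ and $\mathcal B_1$ themselves. Let $\theta,\tilde\theta\in[0,1]$ and suppose that one of the following holds: - $\sigma<1$; - $\sigma=1$ and $\theta,\tilde\theta<1$; - $\sigma>1$ and $\frac{\sigma-1}{\sigma}(1-\theta)\le 1-\tilde\theta$, $\ \frac{\sigma-1}{\sigma}(1-\tilde\theta)\le 1-\theta$. Let $q,\tilde q\in[1,\infty]$, with $\tilde q'$ the conjugate exponent of $\tilde q$, satisfy $$\sigma\theta=\frac1q<\frac1{\tilde q'}=1-\sigma\Big(\frac{\tilde\theta}2-\frac\theta2\Big),\qquad \theta\le\tilde\theta.$$ Then there is a finite constant $C$, independent of $F$, such that $$\Big\|\int_{s<t}U(t)U^*(s)F(s)\,ds\Big\|_{L^{q,\infty}_t\mathcal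 B_\theta^*}\le C\,\|F\|_{L^{\tilde q'}_t\mathcal B_{\tilde\theta}}$$ for all $F\in L^{\tilde q'}(\mathbb R;\mathcal B_{\tilde\theta})$ with values almost everywhere in $\mathcal B_0\cap\mathcal B_{\tilde\theta}$ and $F\in L^1((-\infty,t);\mathcal B_0)$ for every $t\in\mathbb R$ (so that the integral converges absolutely in $\mathcal B_0^*$). Here $\|u\|_{L^{q,\infty}_t\mathcal B_\theta^*}=\sup_{\lambda>0}\lambda\,|\{t:\|u(t)\|_{\mathcal B_\theta^*}>\lambda\}|^{1/q}$ if $q<\infty$ (with outer Lebesgue measure if the set is not measurable), and $L^{\infty,\infty}=L^\infty$. Moreover, if $\tilde\theta<1$, or if $\tilde\theta=1$ and $\mathcal B_0\cap\mathcal B_1$ is dense in $\mathcal B_1$, then this operator extends, with the same $C$, to a bounded linear operator $T$ from all of $L^{\tilde q'}(\mathbb R;\mathcal B_{\tilde\theta})$ to $L^{q,\infty}(\mathbb R;\mathcal B_\theta^*)$: each $TF$ is a weak-$*$ measurable $\mathcal B_\theta^*$-valued function, $F\mapsto TF$ is linear up to null sets, $\|TF\|_{L^{q,\infty}_t\mathcal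 B_\theta^*}\le C\|F\|_{L^{\tilde q'}_t\mathcal B_{\tilde\theta}}$, and for $F$ as in the first part $(TF)(t)$ coincides with $\int_{s<t}U(t)U^*(s)F(s)\,ds$ on $\mathcal B_0\cap\mathcal B_\theta$ for almost every $t$. -/

import Mathlib

open MeasureTheory Set Filter Topology
open scoped ENNReal NNReal

noncomputable section

/-- A compatible couple of normed spaces: `B₀` and `B₁` are continuously embedded in one
Hausdorff topological vector space `V`. -/
structure BanachCouple (𝕜 B₀ B₁ V : Type*) [RCLike 𝕜]
    [NormedAddCommGroup B₀] [NormedSpace 𝕜 B₀] [NormedAddCommGroup B₁] [NormedSpace 𝕜 B₁]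
    [AddCommGroup V] [Module 𝕜 V] [TopologicalSpace V] where
  ι₀ : B₀ →L[𝕜] V
  ι₁ : B₁ →L[𝕜] V
  injective₀ : Function.Injective ι₀
  injective₁ : Function.Injective ι₁

/-- The measure `dτ / τ` on `(0, ∞)`. -/
def mulHaar : Measure ℝ :=
  (volume.restrict (Ioi (0 : ℝ))).withDensity fun τ => ENNReal.ofReal τ⁻¹

namespace BanachCouple

variable {𝕜 B₀ B₁ V : Type*} [RCLike 𝕜]
  [NormedAddCommGroup B₀] [NormedSpace 𝕜 B₀] [NormedAddCommGroup B₁] [NormedSpace 𝕜 B₁]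
  [AddCommGroup V] [Module 𝕜 V] [TopologicalSpace V]

/-- Peetre's functional `K(τ, v) = inf { ‖a‖ + τ ‖b‖ : v = a + b, a ∈ B₀, b ∈ B₁ }`,
equal to `∞` when `v` is not in `B₀ + B₁`. -/
def kFun (E : BanachCouple 𝕜 B₀ B₁ V) (τ : ℝ) (v : V) : ℝ≥0∞ :=
  ⨅ (a : B₀) (b : B₁) (_ : E.ι₀ a + E.ι₁ b = v), ‖a‖ₑ + ENNReal.ofReal τ * ‖b‖ₑ

/-- The norm of `B₀`, extended by `∞` to `V`. -/
def norm₀ (E : BanachCouple 𝕜 B₀ B₁ V) (v : V) : ℝ≥0∞ := ⨅ (a : B₀) (_ : E.ι₀ a = v), ‖a‖ₑ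

/-- The norm of `B₁`, extended by `∞` to `V`. -/
def norm₁ (E : BanachCouple 𝕜 B₀ B₁ V) (v : V) : ℝ≥0∞ := ⨅ (b : B₁) (_ : E.ι₁ b = v), ‖b‖ₑ

/-- The norm of the real interpolation space `(B₀, B₁)_{θ,2}`, extended by `∞` to `V`:
`(∫₀^∞ (τ^{-θ} K(τ, v))² dτ/τ)^{1/2}` for `0 < θ < 1`; by the usual convention the spaces with
`θ = 0` and `θ = 1` are `B₀` and `B₁` themselves. -/
def interpENorm (E : BanachCouple 𝕜 B₀ B₁ V) (θ : ℝ) (v : V) : ℝ≥0∞ :=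
  if θ = 0 then E.norm₀ v
  else if θ = 1 then E.norm₁ v
  else (∫⁻ τ, (ENNReal.ofReal (τ ^ (-θ)) * E.kFun τ v) ^ (2 : ℝ) ∂mulHaar) ^ (1 / (2 : ℝ))

section Lemmas

variable (E : BanachCouple 𝕜 B₀ B₁ V)

lemma kFun_le (τ : ℝ) {v : V} (a : B₀) (b : B₁) (h : E.ι₀ a + E.ι₁ b = v) :
    E.kFun τ v ≤ ‖a‖ₑ + ENNReal.ofReal τ * ‖b‖ₑ :=
  iInf_le_of_le a <| iInf_le_of_le b <| iInf_le_of_le h le_rfl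

lemma norm₀_le {v : V} (a : B₀) (h : E.ι₀ a = v) : E.norm₀ v ≤ ‖a‖ₑ :=
  iInf_le_of_le a <| iInf_le_of_le h le_rfl

lemma norm₁_le {v : V} (b : B₁) (h : E.ι₁ b = v) : E.norm₁ v ≤ ‖b‖ₑ :=
  iInf_le_of_le b <| iInf_le_of_le h le_rfl

lemma kFun_add_le (τ : ℝ) (v w : V) : E.kFun τ (v + w) ≤ E.kFun τ v + E.kFun τ w := by
  conv_rhs => unfold kFun
  simp only [ENNReal.iInf_add, ENNReal.add_iInf]
  refine le_iInf fun a => le_iInf fun b => le_iInf fun h => le_iInf fun a' => le_iInf fun b' =>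
    le_iInf fun h' => ?_
  refine (E.kFun_le τ (a' + a) (b' + b) ?_).trans ?_
  · rw [← h, ← h', map_add, map_add]; abel
  · calc ‖a' + a‖ₑ + ENNReal.ofReal τ * ‖b' + b‖ₑ
        ≤ (‖a'‖ₑ + ‖a‖ₑ) + ENNReal.ofReal τ * (‖b'‖ₑ + ‖b‖ₑ) := by
          gcongr <;> exact enorm_add_le _ _
      _ = _ := by ring

lemma norm₀_add_le (v w : V) : E.norm₀ (v + w) ≤ E.norm₀ v + E.norm₀ w := by
  conv_rhs => unfold norm₀
  simp only [ENNReal.iInf_add, ENNReal.add_iInf]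
  refine le_iInf fun a => le_iInf fun h => le_iInf fun a' => le_iInf fun h' => ?_
  exact (E.norm₀_le (a' + a) (by rw [map_add, h, h'])).trans (enorm_add_le _ _)

lemma norm₁_add_le (v w : V) : E.norm₁ (v + w) ≤ E.norm₁ v + E.norm₁ w := by
  conv_rhs => unfold norm₁
  simp only [ENNReal.iInf_add, ENNReal.add_iInf]
  refine le_iInf fun a => le_iInf fun h => le_iInf fun a' => le_iInf fun h' => ?_
  exact (E.norm₁_le (a' + a) (by rw [map_add, h, h'])).trans (enorm_add_le _ _)

lemma kFun_zero (τ : ℝ) : E.kFun τ 0 = 0 := by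
  refine le_antisymm ?_ bot_le
  exact (E.kFun_le τ 0 0 (by simp)).trans (by simp)

lemma norm₀_zero : E.norm₀ 0 = 0 :=
  le_antisymm ((E.norm₀_le 0 (map_zero _)).trans (by simp)) bot_le

lemma norm₁_zero : E.norm₁ 0 = 0 :=
  le_antisymm ((E.norm₁_le 0 (map_zero _)).trans (by simp)) bot_le

lemma kFun_smul_le (τ : ℝ) (c : 𝕜) (v : V) : E.kFun τ (c • v) ≤ ‖c‖ₑ * E.kFun τ v := by
  rcases eq_or_ne c 0 with rfl | hc
  · simp [kFun_zero]
  have h0 : ‖c‖ₑ ≠ 0 := by simpa using hc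
  rw [← ENNReal.div_le_iff' h0 enorm_ne_top]
  refine le_iInf fun a => le_iInf fun b => le_iInf fun h => ?_
  rw [ENNReal.div_le_iff' h0 enorm_ne_top]
  refine (E.kFun_le τ (c • a) (c • b) ?_).trans ?_
  · rw [← h, map_smul, map_smul, smul_add]
  · rw [enorm_smul, enorm_smul]; exact le_of_eq (by ring)

lemma norm₀_smul_le (c : 𝕜) (v : V) : E.norm₀ (c • v) ≤ ‖c‖ₑ * E.norm₀ v := by
  rcases eq_or_ne c 0 with rfl | hc
  · simp [norm₀_zero]
  have h0 : ‖c‖ₑ ≠ 0 := by simpa using hc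
  rw [← ENNReal.div_le_iff' h0 enorm_ne_top]
  refine le_iInf fun a => le_iInf fun h => ?_
  rw [ENNReal.div_le_iff' h0 enorm_ne_top, ← enorm_smul]
  exact E.norm₀_le (c • a) (by rw [← h, map_smul])

lemma norm₁_smul_le (c : 𝕜) (v : V) : E.norm₁ (c • v) ≤ ‖c‖ₑ * E.norm₁ v := by
  rcases eq_or_ne c 0 with rfl | hc
  · simp [norm₁_zero]
  have h0 : ‖c‖ₑ ≠ 0 := by simpa using hc
  rw [← ENNReal.div_le_iff' h0 enorm_ne_top]
  refine le_iInf fun a => le_iInf fun h => ?_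
  rw [ENNReal.div_le_iff' h0 enorm_ne_top, ← enorm_smul]
  exact E.norm₁_le (c • a) (by rw [← h, map_smul])

lemma kFun_mono (v : V) : Monotone fun τ => E.kFun τ v := by
  intro τ τ' h
  refine iInf_mono fun a => iInf_mono fun b => iInf_mono fun _ => ?_
  gcongr

lemma measurable_weighted_kFun (θ : ℝ) (v : V) :
    Measurable fun τ : ℝ => ENNReal.ofReal (τ ^ (-θ)) * E.kFun τ v :=
  (by fun_prop : Measurable fun τ : ℝ => ENNReal.ofReal (τ ^ (-θ))).mul (E.kFun_mono v).measurable

lemma interpENorm_zero (θ : ℝ) : E.interpENorm θ 0 = 0 := by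
  unfold interpENorm
  split_ifs
  · exact E.norm₀_zero
  · exact E.norm₁_zero
  · simp [kFun_zero]

lemma interpENorm_add_le (θ : ℝ) (v w : V) :
    E.interpENorm θ (v + w) ≤ E.interpENorm θ v + E.interpENorm θ w := by
  unfold interpENorm
  split_ifs
  · exact E.norm₀_add_le v w
  · exact E.norm₁_add_le v w
  · refine le_trans ?_ (ENNReal.lintegral_Lp_add_le
      (E.measurable_weighted_kFun θ v).aemeasurable
      (E.measurable_weighted_kFun θ w).aemeasurable one_le_two)
    gcongr with τ
    simp only [Pi.add_apply]
    rw [← mul_add]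
    gcongr
    exact E.kFun_add_le τ v w

lemma interpENorm_smul_le (θ : ℝ) (c : 𝕜) (v : V) :
    E.interpENorm θ (c • v) ≤ ‖c‖ₑ * E.interpENorm θ v := by
  unfold interpENorm
  split_ifs
  · exact E.norm₀_smul_le c v
  · exact E.norm₁_smul_le c v
  · have h : ∀ x : ℝ≥0∞, ‖c‖ₑ * x ^ (1 / (2 : ℝ)) = (‖c‖ₑ ^ (2 : ℝ) * x) ^ (1 / (2 : ℝ)) := by
      intro x
      rw [ENNReal.mul_rpow_of_nonneg _ _ (by norm_num), ← ENNReal.rpow_mul]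
      norm_num
    rw [h, ← lintegral_const_mul' _ _ (by simp)]
    gcongr with τ
    rw [← ENNReal.mul_rpow_of_nonneg _ _ (by norm_num), mul_left_comm]
    gcongr
    exact E.kFun_smul_le τ c v

lemma eq_zero_of_kFun [IsTopologicalAddGroup V] [T2Space V] {τ : ℝ} (hτ : 0 < τ) {v : V}
    (h : E.kFun τ v = 0) : v = 0 := by
  have key : ∀ n : ℕ, ∃ (a : B₀) (b : B₁), E.ι₀ a + E.ι₁ b = v ∧
      ‖a‖ₑ + ENNReal.ofReal τ * ‖b‖ₑ < ((n : ℝ≥0∞) + 1)⁻¹ := by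
    intro n
    have : E.kFun τ v < ((n : ℝ≥0∞) + 1)⁻¹ := by
      rw [h]; exact ENNReal.inv_pos.2 (by finiteness)
    unfold kFun at this
    simp only [iInf_lt_iff] at this
    obtain ⟨a, b, h1, h2⟩ := this
    exact ⟨a, b, h1, h2⟩
  choose a b hab hlt using key
  have hlim : Tendsto (fun n : ℕ => ((n : ℝ≥0∞) + 1)⁻¹) atTop (𝓝 0) := by
    have := (tendsto_add_atTop_iff_nat 1).2 ENNReal.tendsto_inv_nat_nhds_zero
    simpa using this
  have h0 : ENNReal.ofReal τ ≠ 0 := by simpa using hτ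
  have ha : Tendsto a atTop (𝓝 0) := by
    rw [tendsto_zero_iff_enorm_tendsto_zero]
    exact tendsto_of_tendsto_of_tendsto_of_le_of_le tendsto_const_nhds hlim (fun _ => bot_le)
      fun n => le_self_add.trans (hlt n).le
  have hb : Tendsto b atTop (𝓝 0) := by
    rw [tendsto_zero_iff_enorm_tendsto_zero]
    have hlim' : Tendsto (fun n : ℕ => (ENNReal.ofReal τ)⁻¹ * ((n : ℝ≥0∞) + 1)⁻¹) atTop
        (𝓝 0) := by
      simpa using ENNReal.Tendsto.const_mul hlim (Or.inr (ENNReal.inv_ne_top.2 h0))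
    refine tendsto_of_tendsto_of_tendsto_of_le_of_le tendsto_const_nhds hlim' (fun _ => bot_le)
      fun n => ?_
    rw [mul_comm, ← div_eq_mul_inv]
    rw [ENNReal.le_div_iff_mul_le (Or.inl h0) (Or.inl ENNReal.ofReal_ne_top), mul_comm]
    exact le_add_self.trans (hlt n).le
  have hsum : Tendsto (fun n => E.ι₀ (a n) + E.ι₁ (b n)) atTop (𝓝 (E.ι₀ 0 + E.ι₁ 0)) :=
    ((E.ι₀.continuous.tendsto 0).comp ha).add ((E.ι₁.continuous.tendsto 0).comp hb)
  simp only [hab, map_zero, add_zero] at hsum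
  exact tendsto_nhds_unique tendsto_const_nhds hsum

lemma kFun_one_le_norm₀ (v : V) : E.kFun 1 v ≤ E.norm₀ v := by
  refine le_iInf fun a => le_iInf fun h => ?_
  exact (E.kFun_le 1 a 0 (by simpa using h)).trans (by simp)

lemma kFun_one_le_norm₁ (v : V) : E.kFun 1 v ≤ E.norm₁ v := by
  refine le_iInf fun b => le_iInf fun h => ?_
  exact (E.kFun_le 1 0 b (by simpa using h)).trans (by simp)

lemma eq_zero_of_interpENorm [IsTopologicalAddGroup V] [T2Space V] {θ : ℝ} {v : V}
    (h : E.interpENorm θ v = 0) : v = 0 := by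
  unfold interpENorm at h
  split_ifs at h
  · exact E.eq_zero_of_kFun one_pos (le_antisymm ((E.kFun_one_le_norm₀ v).trans h.le) bot_le)
  · exact E.eq_zero_of_kFun one_pos (le_antisymm ((E.kFun_one_le_norm₁ v).trans h.le) bot_le)
  · rw [ENNReal.rpow_eq_zero_iff_of_pos (by norm_num),
      lintegral_eq_zero_iff ((E.measurable_weighted_kFun θ v).pow_const _), mulHaar,
      EventuallyEq, ae_withDensity_iff (by fun_prop)] at h
    have hne : (ae (volume.restrict (Ioi (0 : ℝ)))).NeBot := by
      rw [ae_neBot]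
      intro h0
      have := congrArg (fun μ : Measure ℝ => μ univ) h0
      simp at this
    obtain ⟨τ, h1, h2⟩ := (h.and (ae_restrict_mem measurableSet_Ioi)).exists
    have hτ : 0 < τ := h2
    have h3 := h1 (by simpa using hτ)
    simp only [Pi.zero_apply] at h3
    rw [ENNReal.rpow_eq_zero_iff_of_pos (by norm_num), mul_eq_zero] at h3
    refine E.eq_zero_of_kFun hτ (h3.resolve_left ?_)
    simpa using Real.rpow_pos_of_pos hτ _

end Lemmas

/-- The vectors of finite `(B₀, B₁)_{θ,2}`-norm. -/
def interpSubmodule (E : BanachCouple 𝕜 B₀ B₁ V) (θ : ℝ) : Submodule 𝕜 V where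
  carrier := {v | E.interpENorm θ v < ∞}
  add_mem' {v w} hv hw :=
    (E.interpENorm_add_le θ v w).trans_lt (ENNReal.add_lt_top.2 ⟨hv, hw⟩)
  zero_mem' := by simp [interpENorm_zero]
  smul_mem' c v hv :=
    (E.interpENorm_smul_le θ c v).trans_lt (ENNReal.mul_lt_top enorm_lt_top hv)

/-- The real interpolation space `B_θ = (B₀, B₁)_{θ,2}`, a normed space in its own norm
(not with the topology that it would inherit from `V`). -/
def Interp (E : BanachCouple 𝕜 B₀ B₁ V) (θ : ℝ) : Type _ := ↥(E.interpSubmodule θ)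

instance (E : BanachCouple 𝕜 B₀ B₁ V) (θ : ℝ) : AddCommGroup (E.Interp θ) :=
  inferInstanceAs (AddCommGroup ↥(E.interpSubmodule θ))

instance (E : BanachCouple 𝕜 B₀ B₁ V) (θ : ℝ) : Module 𝕜 (E.Interp θ) :=
  inferInstanceAs (Module 𝕜 ↥(E.interpSubmodule θ))

/-- The inclusion of `B_θ` in the ambient space. -/
def incl (E : BanachCouple 𝕜 B₀ B₁ V) (θ : ℝ) : E.Interp θ →ₗ[𝕜] V :=
  (E.interpSubmodule θ).subtype

instance [IsTopologicalAddGroup V] [T2Space V] (E : BanachCouple 𝕜 B₀ B₁ V) (θ : ℝ) :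
    NormedAddCommGroup (E.Interp θ) :=
  AddGroupNorm.toNormedAddCommGroup
    { toFun := fun x => (E.interpENorm θ (E.incl θ x)).toReal
      map_zero' := by simp [interpENorm_zero]
      add_le' := fun x y => by
        have hx : E.interpENorm θ (E.incl θ x) ≠ ∞ := x.2.ne
        have hy : E.interpENorm θ (E.incl θ y) ≠ ∞ := y.2.ne
        rw [map_add, ← ENNReal.toReal_add hx hy]
        exact ENNReal.toReal_mono (ENNReal.add_ne_top.2 ⟨hx, hy⟩)
          (E.interpENorm_add_le θ _ _)
      neg' := fun x => by
        have h : ∀ v : V, E.interpENorm θ (-v) ≤ E.interpENorm θ v := fun v => by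
          simpa using E.interpENorm_smul_le θ (-1 : 𝕜) v
        rw [map_neg]
        congr 1
        exact le_antisymm (h _) (by simpa using h (-(E.incl θ x)))
      eq_zero_of_map_eq_zero' := fun x hx => by
        rcases (ENNReal.toReal_eq_zero_iff _).1 hx with h | h
        · exact Subtype.ext (E.eq_zero_of_interpENorm h)
        · exact absurd h x.2.ne }

instance [IsTopologicalAddGroup V] [T2Space V] (E : BanachCouple 𝕜 B₀ B₁ V) (θ : ℝ) :
    NormedSpace 𝕜 (E.Interp θ) where
  norm_smul_le c x := by
    have h := ENNReal.toReal_mono (ENNReal.mul_ne_top enorm_ne_top x.2.ne)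
      (E.interpENorm_smul_le θ c (E.incl θ x))
    rw [ENNReal.toReal_mul, toReal_enorm, ← map_smul] at h
    exact h

end BanachCouple

/-- The dual `X^*` of a normed space, in its conjugate-linear version: for `𝕜 = ℂ` the pairing
of `X^*` with `X` is sesquilinear, as is the `L²` pairing (for `𝕜 = ℝ` this is the usual dual). -/
abbrev ConjDual (𝕜 X : Type*) [RCLike 𝕜] [NormedAddCommGroup X] [NormedSpace 𝕜 X] : Type _ :=
  X →L⋆[𝕜] 𝕜

/-- The adjoint `A^* : X → H` of an operator `A : H → X^*`, i.e. `⟪A^* g, f⟫ = (A f)(g)`. -/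
def preAdjoint {𝕜 H X : Type*} [RCLike 𝕜] [NormedAddCommGroup H] [InnerProductSpace 𝕜 H]
    [CompleteSpace H] [NormedAddCommGroup X] [NormedSpace 𝕜 X]
    (A : H →L[𝕜] ConjDual 𝕜 X) : X →L[𝕜] H :=
  ((InnerProductSpace.toDual 𝕜 H).symm.toContinuousLinearEquiv :
    StrongDual 𝕜 H →L⋆[𝕜] H).comp A.flip

lemma inner_preAdjoint {𝕜 H X : Type*} [RCLike 𝕜] [NormedAddCommGroup H]
    [InnerProductSpace 𝕜 H] [CompleteSpace H] [NormedAddCommGroup X] [NormedSpace 𝕜 X]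
    (A : H →L[𝕜] ConjDual 𝕜 X) (g : X) (f : H) : inner 𝕜 (preAdjoint A g) f = A f g := by
  simp [preAdjoint]

/-- For `X` and `Y` embedded in `V` by `i` and `j`: the functionals `u ∈ X^*` and `w ∈ Y^*`
coincide on `X ∩ Y`. -/
def DualAgree {𝕜 X Y V : Type*} [RCLike 𝕜] [NormedAddCommGroup X] [NormedSpace 𝕜 X]
    [NormedAddCommGroup Y] [NormedSpace 𝕜 Y] (i : X → V) (j : Y → V)
    (u : ConjDual 𝕜 X) (w : ConjDual 𝕜 Y) : Prop :=
  ∀ (x : X) (y : Y), i x = j y → u x = w y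

/-- The norm in `Y^*` of a functional `u ∈ X^*`, for `X` and `Y` embedded in `V` by `i` and `j`:
the (least) norm of a functional in `Y^*` that coincides with `u` on `X ∩ Y`, and `∞` if there is
no such functional, that is, if `u` is not in `Y^*`. -/
def dualENorm {𝕜 X Y V : Type*} [RCLike 𝕜] [NormedAddCommGroup X] [NormedSpace 𝕜 X]
    [NormedAddCommGroup Y] [NormedSpace 𝕜 Y] (i : X → V) (j : Y → V)
    (u : ConjDual 𝕜 X) : ℝ≥0∞ :=
  ⨅ (w : ConjDual 𝕜 Y) (_ : DualAgree i j u w), ‖w‖ₑ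

/-- The quasi-norm of the weak Lebesgue space `L^{q,∞}(ℝ)` for a function with values in
`[0, ∞]`: `sup_{r > 0} r |{t : N t > r}|^{1/q}` for `q < ∞`, and `L^{∞,∞} = L^∞`. -/
def weakLpNorm (q : ℝ≥0∞) (N : ℝ → ℝ≥0∞) : ℝ≥0∞ :=
  if q = ∞ then essSup N volume
  else ⨆ r : ℝ≥0, (r : ℝ≥0∞) * volume {t | (r : ℝ≥0∞) < N t} ^ (1 / q.toReal)

/-- The retarded integral `∫_{s<t} U(t) U^*(s) F(s) ds`, a Bochner integral in `X^*`. -/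
def retarded {𝕜 H X : Type*} [RCLike 𝕜] [NormedAddCommGroup H] [InnerProductSpace 𝕜 H]
    [CompleteSpace H] [NormedAddCommGroup X] [NormedSpace 𝕜 X]
    (U : ℝ → H →L[𝕜] ConjDual 𝕜 X) (F : ℝ → X) (t : ℝ) : ConjDual 𝕜 X :=
  ∫ s in Iio t, U t (preAdjoint (U s) (F s))

end

/-!
Write `L s = U^*(s)`, so that `(U t h) y = ⟪L t y, h⟫`, and `κ = 1 / q̃'`, `α = σ θ = 1 / q`.
The retarded operator is cut into the parts that come from the dyadic windows
`t - 2 ^ (j + 1) < s ≤ t - 2 ^ j`. On a window at distance `δ` from the diagonal,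
`|⟪L t y, ∫_W L s (F s) ds⟫| ≤ C δ ^ (-α) ‖F‖_{L^{q̃'}(W; B_θ')} ‖y‖_{B_θ}`
(`IsDispersive.exists_enorm_inner_integral_local_le`), and the sum over the windows of the right-hand
sides is a function of `t` in weak `L^q`, since `α < κ` (`exists_volume_tsum_dyadicWindow_le`).

The local estimate interpolates between two extreme cases: `θ = θ' = 1`, which is the dispersive
estimate, and `θ = 0`, which is the energy estimate for `y` together with the dual homogeneous
Strichartz estimate `‖∫ L s (F s) ds‖ ≤ C ‖F‖_{L^p B_b}`, `2 / p = 2 - σ b`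
(`IsDispersive.exists_strichartz`); here `θ' = θ + (1 - θ) b`, and the conditions on `σ`, `θ`, `θ'`
say that this estimate holds for `b`. The interpolation is done by hand
(`IsDispersive.exists_enorm_inner_integral_le_of_le_one`): the values of `F` are decomposed by the
fundamental lemma of real interpolation along a geometric progression whose starting point depends
on the norm of the value, and the resulting functionals of `y` are summed by duality
(`exists_sum_functional_le`). The Strichartz estimate is obtained by the `T T^*` argument, from the
Hardy–Littlewood–Sobolev inequality if `σ b < 1`, and at the endpoint `σ b = 1`, `σ > 1`, from the
almost orthogonality of functions that live at different scales
(`IsDispersive.exists_enorm_inner_atom_le`).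

By the Hahn–Banach theorem, bounds on `B₀ ∩ B_θ` give functionals in `B_θ^*` of the right norm
(`exists_dualAgree`), which is the estimate for the integral. Under the density hypothesis
`B₀ ∩ B_θ` is dense in `B_θ` (for `θ = 1` one has `θ' = 1` as well), so these functionals are unique
and depend linearly on `F`; the part of the operator that comes from one window therefore extends by
density to `L^{q̃'} B_θ'` for every single `t` (`exists_window_operator`). The extensions are summed
over the windows at the points `t` where the sum of their bounds is finite, which is almost
everywhere by the weak-type bound (`exists_retarded_extension`).
-/

/-! ### Elementary inequalities for extended nonnegative reals -/

lemma ENNReal.sum_mul_le_sqrt_mul_sqrt {ι : Type*} (S : Finset ι) (f g : ι → ℝ≥0∞) :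
    ∑ i ∈ S, f i * g i ≤ (∑ i ∈ S, f i ^ 2) ^ (1 / 2 : ℝ) * (∑ i ∈ S, g i ^ 2) ^ (1 / 2 : ℝ) := by
  simpa [ENNReal.rpow_two] using
    ENNReal.inner_le_Lp_mul_Lq S f g (Real.HolderConjugate.two_two)

lemma lintegral_Ioi_rpow {a s : ℝ} (ha : 0 < a) (hs : 0 < s) :
    ∫⁻ τ in Ioi a, ENNReal.ofReal (τ ^ (-s - 1)) = ENNReal.ofReal (a ^ (-s) / s) := by
  rw [← ofReal_integral_eq_lintegral_ofReal, integral_Ioi_rpow_of_lt (by linarith) ha]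
  · congr 1
    rw [sub_add_cancel, neg_div_neg_eq]
  · exact integrableOn_Ioi_rpow_of_lt (by linarith) ha
  · refine (ae_restrict_iff' measurableSet_Ioi).2 (ae_of_all _ fun τ hτ => ?_)
    exact Real.rpow_nonneg (ha.trans hτ).le _

lemma lintegral_Ioc_rpow {a s : ℝ} (ha : 0 < a) (hs : 0 < s) :
    ∫⁻ τ in Ioc 0 a, ENNReal.ofReal (τ ^ (s - 1)) = ENNReal.ofReal (a ^ s / s) := by
  rw [← ofReal_integral_eq_lintegral_ofReal, ← intervalIntegral.integral_of_le ha.le,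
    integral_rpow (Or.inl (by linarith))]
  · congr 1
    rw [sub_add_cancel, Real.zero_rpow hs.ne', sub_zero]
  · have := intervalIntegral.intervalIntegrable_rpow' (a := 0) (b := a) (r := s - 1) (by linarith)
    exact (intervalIntegrable_iff_integrableOn_Ioc_of_le ha.le).1 this
  · refine (ae_restrict_iff' measurableSet_Ioc).2 (ae_of_all _ fun τ hτ => ?_)
    exact Real.rpow_nonneg hτ.1.le _

namespace BanachCouple

variable {𝕜 B₀ B₁ V : Type*} [RCLike 𝕜]
  [NormedAddCommGroup B₀] [NormedSpace 𝕜 B₀] [NormedAddCommGroup B₁] [NormedSpace 𝕜 B₁]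
  [AddCommGroup V] [Module 𝕜 V] [TopologicalSpace V] (E : BanachCouple 𝕜 B₀ B₁ V)

/-! ### The norms of the real interpolation scale -/

lemma norm₀_ι₀ (x : B₀) : E.norm₀ (E.ι₀ x) = ‖x‖ₑ :=
  le_antisymm (E.norm₀_le x rfl) <| le_iInf fun a => le_iInf fun h => by rw [E.injective₀ h]

lemma norm₁_ι₁ (y : B₁) : E.norm₁ (E.ι₁ y) = ‖y‖ₑ :=
  le_antisymm (E.norm₁_le y rfl) <| le_iInf fun a => le_iInf fun h => by rw [E.injective₁ h]

lemma interpENorm_at_zero (v : V) : E.interpENorm 0 v = E.norm₀ v := by simp [interpENorm]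

lemma interpENorm_at_one (v : V) : E.interpENorm 1 v = E.norm₁ v := by simp [interpENorm]

lemma kFun_le_norm₀ (τ : ℝ) (v : V) : E.kFun τ v ≤ E.norm₀ v :=
  le_iInf fun a => le_iInf fun h => (E.kFun_le τ a 0 (by simpa using h)).trans (by simp)

lemma kFun_le_norm₁ {τ : ℝ} (hτ : 0 < τ) (v : V) :
    E.kFun τ v ≤ ENNReal.ofReal τ * E.norm₁ v := by
  have h0 : ENNReal.ofReal τ ≠ 0 := by simpa using hτ
  rw [← ENNReal.div_le_iff' h0 ENNReal.ofReal_ne_top]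
  refine le_iInf fun b => le_iInf fun h => ?_
  rw [ENNReal.div_le_iff' h0 ENNReal.ofReal_ne_top]
  exact (E.kFun_le τ 0 b (by simpa using h)).trans (by simp)

lemma interpENorm_sq {θ : ℝ} (h0 : 0 < θ) (h1 : θ < 1) (v : V) :
    E.interpENorm θ v ^ 2 =
      ∫⁻ τ in Ioi 0, ENNReal.ofReal (τ ^ (-(2 * θ) - 1)) * E.kFun τ v ^ 2 := by
  have hm := (E.kFun_mono v).measurable
  rw [interpENorm, if_neg h0.ne', if_neg h1.ne, ← ENNReal.rpow_two, ← ENNReal.rpow_mul,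
    show 1 / (2 : ℝ) * 2 = 1 by norm_num, ENNReal.rpow_one, mulHaar,
    lintegral_withDensity_eq_lintegral_mul _ (by fun_prop)
      ((E.measurable_weighted_kFun θ v).pow_const _)]
  refine setLIntegral_congr_fun measurableSet_Ioi fun τ (hτ : 0 < τ) => ?_
  simp only [Pi.mul_apply]
  rw [ENNReal.rpow_two, mul_pow, ← mul_assoc, ← ENNReal.ofReal_pow (Real.rpow_nonneg hτ.le _),
    ← ENNReal.ofReal_mul (by positivity)]
  congr 2
  rw [← Real.rpow_natCast, ← Real.rpow_mul hτ.le, ← Real.rpow_neg_one, ← Real.rpow_add hτ]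
  congr 1
  push_cast
  ring

/-- Sampling the `K`-functional along a geometric progression of ratio `R` costs at most a
constant, uniformly in the starting point `a` of the progression. -/
lemma tsum_kFun_sq_le {θ : ℝ} (h0 : 0 < θ) (h1 : θ < 1) {R a : ℝ} (hR : 1 < R) (ha : 0 < a)
    (v : V) :
    ∑' k : ℤ, ENNReal.ofReal ((a * R ^ k) ^ (-(2 * θ))) * E.kFun (a * R ^ k) v ^ 2 ≤
      ENNReal.ofReal (R ^ (2 * θ) / (1 - R⁻¹)) * E.interpENorm θ v ^ 2 := by
  have hR0 : 0 < R := one_pos.trans hR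
  have hR1 : 0 < 1 - R⁻¹ := sub_pos.2 (inv_lt_one_of_one_lt₀ hR)
  have hpos : ∀ k : ℤ, 0 < a * R ^ k := fun k => by positivity
  have hmono : Monotone fun k : ℤ => a * R ^ k := fun i j h =>
    mul_le_mul_of_nonneg_left (zpow_le_zpow_right₀ hR.le h) ha.le
  have hsucc : ∀ k : ℤ, a * R ^ (k + 1) = R * (a * R ^ k) := fun k => by
    rw [zpow_add_one₀ hR0.ne']; ring
  have hdisj : Pairwise (Function.onFun Disjoint
      fun k : ℤ => Ico (a * R ^ k) (a * R ^ (k + 1))) := by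
    simpa using hmono.pairwise_disjoint_on_Ico_succ
  calc _ ≤ ∑' k : ℤ, ENNReal.ofReal (R ^ (2 * θ) / (1 - R⁻¹)) *
        ∫⁻ τ in Ico (a * R ^ k) (a * R ^ (k + 1)),
          ENNReal.ofReal (τ ^ (-(2 * θ) - 1)) * E.kFun τ v ^ 2 := by
        refine ENNReal.tsum_le_tsum fun k => ?_
        have hlow : ENNReal.ofReal ((a * R ^ (k + 1)) ^ (-(2 * θ) - 1)) *
            E.kFun (a * R ^ k) v ^ 2 * ENNReal.ofReal (a * R ^ (k + 1) - a * R ^ k) ≤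
            ∫⁻ τ in Ico (a * R ^ k) (a * R ^ (k + 1)),
              ENNReal.ofReal (τ ^ (-(2 * θ) - 1)) * E.kFun τ v ^ 2 := by
          rw [← Real.volume_Ico, ← setLIntegral_const]
          refine setLIntegral_mono' measurableSet_Ico fun τ hτ => ?_
          gcongr ENNReal.ofReal ?_ * ?_ ^ 2
          · exact Real.rpow_le_rpow_of_nonpos ((hpos k).trans_le hτ.1) hτ.2.le (by linarith)
          · exact E.kFun_mono v hτ.1
        refine le_trans (le_of_eq ?_) (mul_le_mul_right hlow _)
        have hx := hpos k
        rw [hsucc]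
        generalize a * R ^ k = x at hx
        rw [mul_right_comm, ← mul_assoc, ← ENNReal.ofReal_mul (by positivity),
          ← ENNReal.ofReal_mul (by positivity)]
        congr 2
        rw [Real.mul_rpow hR0.le hx.le, Real.rpow_sub hR0, Real.rpow_sub hx, Real.rpow_neg hR0.le,
          Real.rpow_one, Real.rpow_one]
        have := (Real.rpow_pos_of_pos hR0 (2 * θ)).ne'
        field_simp
        rw [div_self (sub_pos.2 hR).ne']
    _ = ENNReal.ofReal (R ^ (2 * θ) / (1 - R⁻¹)) *
        ∫⁻ τ in ⋃ k : ℤ, Ico (a * R ^ k) (a * R ^ (k + 1)),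
          ENNReal.ofReal (τ ^ (-(2 * θ) - 1)) * E.kFun τ v ^ 2 := by
        rw [ENNReal.tsum_mul_left, lintegral_iUnion (fun _ => measurableSet_Ico) hdisj]
    _ ≤ _ := by
        rw [E.interpENorm_sq h0 h1]
        gcongr
        exact iUnion_subset fun k τ hτ => (hpos k).trans_le hτ.1

/-- A vector whose `B₀`-norm is at most `c` and whose `B₁`-norm is at most `c / τ` has norm at most
a constant times `τ ^ (-b) c` in the interpolation space of exponent `b`. -/
lemma exists_interpENorm_le {b : ℝ} (hb : b ∈ Icc (0 : ℝ) 1) :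
    ∃ C : ℝ≥0, ∀ (τ : ℝ) (c : ℝ≥0∞) (v : V), 0 < τ → E.norm₀ v ≤ c →
      ENNReal.ofReal τ * E.norm₁ v ≤ c → E.interpENorm b v ≤ C * ENNReal.ofReal (τ ^ (-b)) * c := by
  rcases hb.1.eq_or_lt with rfl | h0
  · refine ⟨1, fun τ c v _ h _ => ?_⟩
    simpa [interpENorm_at_zero] using h
  rcases hb.2.eq_or_lt with rfl | h1
  · refine ⟨1, fun τ c v hτ _ h => ?_⟩
    rw [interpENorm_at_one, ENNReal.coe_one, one_mul, Real.rpow_neg_one,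
      ENNReal.ofReal_inv_of_pos hτ, mul_comm, ← div_eq_mul_inv,
      ENNReal.le_div_iff_mul_le (by simp [hτ]) (by simp), mul_comm]
    exact h
  have hs : 0 < 1 / (2 * (1 - b)) + 1 / (2 * b) := by
    have : 0 < 1 - b := by linarith
    positivity
  refine ⟨Real.toNNReal (Real.sqrt (1 / (2 * (1 - b)) + 1 / (2 * b))), fun τ c v hτ hv0 hv1 => ?_⟩
  rw [← (ENNReal.pow_right_strictMono two_ne_zero).le_iff_le]
  rw [E.interpENorm_sq h0 h1, ← Ioc_union_Ioi_eq_Ioi hτ.le]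
  refine (lintegral_union_le _ _ _).trans ?_
  have hlow : ∫⁻ x in Ioc 0 τ, ENNReal.ofReal (x ^ (-(2 * b) - 1)) * E.kFun x v ^ 2 ≤
      ENNReal.ofReal (τ ^ (-(2 * b)) / (2 * (1 - b))) * c ^ 2 := by
    calc _ ≤ ∫⁻ x in Ioc 0 τ, ENNReal.ofReal (x ^ (2 * (1 - b) - 1)) *
          (ENNReal.ofReal (τ ^ (-2 : ℝ)) * c ^ 2) := by
          refine setLIntegral_mono' measurableSet_Ioc fun x hx => ?_
          have hK : E.kFun x v ≤ ENNReal.ofReal (x / τ) * c := by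
            calc E.kFun x v ≤ ENNReal.ofReal x * E.norm₁ v := E.kFun_le_norm₁ hx.1 v
              _ = ENNReal.ofReal (x / τ) * (ENNReal.ofReal τ * E.norm₁ v) := by
                rw [← mul_assoc, ← ENNReal.ofReal_mul (div_nonneg hx.1.le hτ.le),
                  div_mul_cancel₀ _ hτ.ne']
              _ ≤ _ := by gcongr
          calc _ ≤ ENNReal.ofReal (x ^ (-(2 * b) - 1)) * (ENNReal.ofReal (x / τ) * c) ^ 2 := by
                gcongr
            _ = _ := by
                have := hx.1
                rw [mul_pow, ← mul_assoc, ← mul_assoc, ← ENNReal.ofReal_pow (by positivity),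
                  ← ENNReal.ofReal_mul (by positivity), ← ENNReal.ofReal_mul (by positivity)]
                congr 2
                rw [show 2 * (1 - b) - 1 = (-(2 * b) - 1) + 2 by ring, Real.rpow_add this,
                  Real.rpow_neg hτ.le, Real.rpow_two, Real.rpow_two]
                field_simp
      _ = ENNReal.ofReal (τ ^ (2 * (1 - b)) / (2 * (1 - b))) *
          (ENNReal.ofReal (τ ^ (-2 : ℝ)) * c ^ 2) := by
          rw [lintegral_mul_const _ (by fun_prop), lintegral_Ioc_rpow hτ (by linarith)]
      _ = _ := by
          rw [← mul_assoc, ← ENNReal.ofReal_mul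
            (div_nonneg (Real.rpow_nonneg hτ.le _) (by linarith)), div_mul_eq_mul_div,
            ← Real.rpow_add hτ]
          ring_nf
  have hhigh : ∫⁻ x in Ioi τ, ENNReal.ofReal (x ^ (-(2 * b) - 1)) * E.kFun x v ^ 2 ≤
      ENNReal.ofReal (τ ^ (-(2 * b)) / (2 * b)) * c ^ 2 := by
    calc _ ≤ ∫⁻ x in Ioi τ, ENNReal.ofReal (x ^ (-(2 * b) - 1)) * c ^ 2 := by
          refine setLIntegral_mono' measurableSet_Ioi fun x hx => ?_
          gcongr
          exact (E.kFun_le_norm₀ x v).trans hv0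
      _ = _ := by
          rw [lintegral_mul_const _ (by fun_prop), lintegral_Ioi_rpow hτ (by linarith)]
  refine (add_le_add hlow hhigh).trans (le_of_eq ?_)
  have h2 : 0 < 1 - b := by linarith
  rw [← add_mul, ← ENNReal.ofReal_add (by positivity) (by positivity), mul_pow, mul_pow,
    ← ENNReal.ofReal_pow (by positivity)]
  congr 1
  change _ = ENNReal.ofReal _ ^ 2 * _
  rw [← ENNReal.ofReal_pow (by positivity), ← ENNReal.ofReal_mul (by positivity),
    Real.sq_sqrt hs.le, ← Real.rpow_natCast (τ ^ (-b)), ← Real.rpow_mul hτ.le]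
  congr 1
  rw [show -b * ((2 : ℕ) : ℝ) = -(2 * b) by push_cast; ring]
  ring

end BanachCouple

namespace BanachCouple

variable {𝕜 B₀ B₁ V : Type*} [RCLike 𝕜]
  [NormedAddCommGroup B₀] [NormedSpace 𝕜 B₀] [NormedAddCommGroup B₁] [NormedSpace 𝕜 B₁]
  [AddCommGroup V] [Module 𝕜 V] [TopologicalSpace V] (E : BanachCouple 𝕜 B₀ B₁ V)

/-! ### Decompositions in the real interpolation scale -/

lemma exists_kFun_le {θ : ℝ} (h0 : 0 < θ) (h1 : θ < 1) :
    ∃ C : ℝ≥0, ∀ (τ : ℝ) (v : V), 0 < τ →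
      E.kFun τ v ≤ C * ENNReal.ofReal (τ ^ θ) * E.interpENorm θ v := by
  refine ⟨Real.toNNReal (Real.sqrt (2 ^ (2 * θ) / (1 - 2⁻¹))), fun τ v hτ => ?_⟩
  have h := (ENNReal.le_tsum (0 : ℤ)).trans (E.tsum_kFun_sq_le h0 h1 one_lt_two hτ v)
  rw [zpow_zero, mul_one] at h
  rw [← (ENNReal.pow_right_strictMono two_ne_zero).le_iff_le]
  change _ ≤ (ENNReal.ofReal _ * _ * _) ^ 2
  rw [mul_pow, mul_pow, ← ENNReal.ofReal_pow (by positivity), ← ENNReal.ofReal_pow (by positivity),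
    Real.sq_sqrt (by norm_num; positivity), mul_right_comm]
  calc E.kFun τ v ^ 2 = ENNReal.ofReal (τ ^ (-(2 * θ))) * E.kFun τ v ^ 2 *
        ENNReal.ofReal ((τ ^ θ) ^ 2) := by
        rw [mul_right_comm, ← ENNReal.ofReal_mul (by positivity), ← Real.rpow_natCast (τ ^ θ),
          ← Real.rpow_mul hτ.le, ← Real.rpow_add hτ]
        norm_num
        rw [show -(2 * θ) + θ * 2 = 0 by ring, Real.rpow_zero, ENNReal.ofReal_one, one_mul]
    _ ≤ _ := by gcongr

lemma exists_near_optimal [IsTopologicalAddGroup V] [T2Space V] {v : V} {τ : ℝ} (hτ : 0 < τ)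
    (hv : E.kFun τ v ≠ ∞) :
    ∃ (u : B₀) (w : B₁), E.ι₀ u + E.ι₁ w = v ∧ ‖u‖ₑ ≤ 2 * E.kFun τ v ∧
      ENNReal.ofReal τ * ‖w‖ₑ ≤ 2 * E.kFun τ v := by
  by_cases h0 : E.kFun τ v = 0
  · exact ⟨0, 0, by simp [E.eq_zero_of_kFun hτ h0], by simp, by simp⟩
  · have : E.kFun τ v < 2 * E.kFun τ v := by
      conv_lhs => rw [← one_mul (E.kFun τ v)]
      exact ENNReal.mul_lt_mul_left h0 hv (by norm_num)
    conv_lhs at this => unfold kFun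
    simp only [iInf_lt_iff] at this
    obtain ⟨u, w, h, hlt⟩ := this
    exact ⟨u, w, h, le_self_add.trans hlt.le, le_add_self.trans hlt.le⟩

/-- The fundamental lemma of real interpolation, for an element `x` of `B₀`: up to an error that
is small in `B₀`, `x` is a finite sum of elements `y k` of `B₀ ∩ B₁`, whose norms are balanced at
the points `a * R ^ k` of a given geometric progression, and square summable with the right
weights. -/
lemma exists_decomposition [IsTopologicalAddGroup V] [T2Space V] {η : ℝ} (h0 : 0 < η) (h1 : η < 1)
    {R : ℝ} (hR : 1 < R) :
    ∃ C : ℝ≥0, ∀ (a ε : ℝ) (x : B₀), 0 < a → 0 < ε → E.interpENorm η (E.ι₀ x) ≠ ∞ →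
      ∃ (S : Finset ℤ) (y : ℤ → B₀) (c : ℤ → ℝ≥0∞),
        (∀ k ∉ S, y k = 0 ∧ c k = 0) ∧
        (∀ k, ‖y k‖ₑ ≤ ENNReal.ofReal ((a * R ^ k) ^ η) * c k ∧
          E.norm₁ (E.ι₀ (y k)) ≤ ENNReal.ofReal ((a * R ^ k) ^ (η - 1)) * c k) ∧
        ∑ k ∈ S, c k ^ 2 ≤ C * E.interpENorm η (E.ι₀ x) ^ 2 ∧
        ‖x - ∑ k ∈ S, y k‖ ≤ ε := by
  have hR0 : 0 < R := one_pos.trans hR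
  obtain ⟨C₂, hC₂⟩ := E.exists_kFun_le h0 h1
  have hR1 : 0 < 1 - R⁻¹ := sub_pos.2 (inv_lt_one_of_one_lt₀ hR)
  set D : ℝ := 4 * R ^ η with hD
  refine ⟨Real.toNNReal (D ^ 2 * (R ^ (2 * η) / (1 - R⁻¹)) + 1), fun a ε x ha hε hN => ?_⟩
  by_cases hx : x = 0
  · exact ⟨∅, 0, 0, by simp, by simp [norm₁_zero], by simp, by simp [hx, hε.le]⟩
  set N := E.interpENorm η (E.ι₀ x) with hNdef
  have hN0 : N ≠ 0 := fun h => hx (E.injective₀ (by simpa using E.eq_zero_of_interpENorm h))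
  have hpos : ∀ k : ℤ, 0 < a * R ^ k := fun k => by positivity
  have hKx : ∀ τ, E.kFun τ (E.ι₀ x) ≤ ‖x‖ₑ := fun τ => by
    rw [← E.norm₀_ι₀]; exact E.kFun_le_norm₀ τ _
  have hK : ∀ τ, E.kFun τ (E.ι₀ x) ≠ ∞ := fun τ => ne_top_of_le_ne_top enorm_ne_top (hKx τ)
  choose u w huw hu hw using fun k : ℤ => E.exists_near_optimal (hpos k) (hK (a * R ^ k))
  have hmono : Monotone fun k : ℤ => a * R ^ k := fun i j h =>
    mul_le_mul_of_nonneg_left (zpow_le_zpow_right₀ hR.le h) ha.le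
  have hsucc : ∀ k : ℤ, a * R ^ (k + 1) = R * (a * R ^ k) := fun k => by
    rw [zpow_add_one₀ hR0.ne']; ring
  have hw' : ∀ k, ‖w k‖ₑ ≤ 2 * (ENNReal.ofReal (a * R ^ k)⁻¹ * E.kFun (a * R ^ k) (E.ι₀ x)) := by
    intro k
    rw [mul_left_comm, ENNReal.ofReal_inv_of_pos (hpos k), mul_comm, ← div_eq_mul_inv,
      ENNReal.le_div_iff_mul_le (by simp [hpos k]) (by simp), mul_comm]
    exact hw k
  have hι : ∀ k, E.ι₀ (x - u k) = E.ι₁ (w k) := fun k => by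
    rw [map_sub, ← huw k]; abel
  have htop : Tendsto (fun n : ℕ => a * R ^ n) atTop atTop :=
    (tendsto_pow_atTop_atTop_of_one_lt hR).const_mul_atTop ha
  -- the upper end of the range of `k`, where the remainder `x - u n` is negligible in `B₁`
  obtain ⟨n, hn⟩ : ∃ n : ℕ, ENNReal.ofReal (5 * (a * R ^ (n : ℤ)) ^ (-η)) * ‖x‖ₑ ≤ N := by
    have h : Tendsto (fun n : ℕ => ENNReal.ofReal (5 * (a * R ^ n) ^ (-η)) * ‖x‖ₑ) atTop
        (𝓝 0) := by
      have h2 := ((tendsto_rpow_neg_atTop h0).comp htop).const_mul 5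
      have h3 := ENNReal.Tendsto.mul_const (ENNReal.tendsto_ofReal h2) (b := ‖x‖ₑ)
        (Or.inr enorm_ne_top)
      simpa using h3
    obtain ⟨n, hn⟩ := (h.eventually (gt_mem_nhds hN0.bot_lt)).exists
    exact ⟨n, by simpa using hn.le⟩
  -- the lower end, where `u (-m)` is negligible in `B₀`
  obtain ⟨m, hm⟩ : ∃ m : ℕ, ‖u (-(m : ℤ))‖ ≤ ε := by
    have hi : Tendsto (fun m : ℕ => a * R ^ (-(m : ℤ))) atTop (𝓝 0) := by
      have := (tendsto_pow_atTop_nhds_zero_of_lt_one (inv_nonneg.2 hR0.le)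
        (inv_lt_one_of_one_lt₀ hR)).const_mul a
      simpa using this
    have h : Tendsto (fun m : ℕ => 2 * (C₂ * ENNReal.ofReal ((a * R ^ (-(m : ℤ))) ^ η) * N)) atTop
        (𝓝 0) := by
      have h2 := hi.rpow_const (p := η) (Or.inr h0.le)
      rw [Real.zero_rpow h0.ne'] at h2
      have h3 := ENNReal.Tendsto.const_mul (a := 2) (ENNReal.Tendsto.mul_const
        (ENNReal.Tendsto.const_mul (a := (C₂ : ℝ≥0∞)) (ENNReal.tendsto_ofReal h2)
          (Or.inr ENNReal.coe_ne_top)) (b := N) (Or.inr hN)) (Or.inr (by norm_num))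
      simpa using h3
    obtain ⟨m, hm⟩ := (h.eventually (gt_mem_nhds (ENNReal.ofReal_pos.2 hε))).exists
    refine ⟨m, ?_⟩
    rw [← ENNReal.ofReal_le_ofReal_iff hε.le, ofReal_norm]
    refine (hu _).trans (le_trans ?_ hm.le)
    gcongr
    exact hC₂ _ _ (hpos _)
  have hnm : -(m : ℤ) ≤ n := by omega
  let S : Finset ℤ := Finset.Icc (-(m : ℤ)) n
  let z : ℤ → B₀ := fun k => if k ≤ n then u k else x
  let y : ℤ → B₀ := fun k => if k ∈ S then z (k + 1) - z k else 0
  let c : ℤ → ℝ≥0∞ := fun k => if k ∈ S then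
    (if k < n then ENNReal.ofReal (D * (a * R ^ (k + 1)) ^ (-η)) *
      E.kFun (a * R ^ (k + 1)) (E.ι₀ x)
    else ENNReal.ofReal (5 * (a * R ^ k) ^ (-η)) * ‖x‖ₑ) else 0
  refine ⟨S, y, c, fun k hk => by simp [y, c, hk], fun k => ?_, ?_, ?_⟩
  · by_cases hkS : k ∈ S
    swap
    · simp [y, c, hkS, norm₁_zero]
    have hkn : k ≤ n := (Finset.mem_Icc.1 hkS).2
    have hx := hpos k
    rcases hkn.lt_or_eq with hlt | rfl
    · have hyk : y k = u (k + 1) - u k := by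
        simp only [y, z, if_pos hkS, if_pos hkn, if_pos (Int.add_one_le_iff.2 hlt)]
      have hck : c k = ENNReal.ofReal (D * (a * R ^ (k + 1)) ^ (-η)) *
          E.kFun (a * R ^ (k + 1)) (E.ι₀ x) := by simp only [c, if_pos hkS, if_pos hlt]
      have hKk : E.kFun (a * R ^ k) (E.ι₀ x) ≤ E.kFun (a * R ^ (k + 1)) (E.ι₀ x) :=
        E.kFun_mono _ (hmono (by omega))
      have hDk : D * (a * R ^ (k + 1)) ^ (-η) = 4 * (a * R ^ k) ^ (-η) := by
        rw [hsucc, Real.mul_rpow hR0.le hx.le, hD, Real.rpow_neg hR0.le]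
        have := (Real.rpow_pos_of_pos hR0 η).ne'
        field_simp
      rw [hyk, hck, hDk, ← mul_assoc, ← mul_assoc, ← ENNReal.ofReal_mul (by positivity),
        ← ENNReal.ofReal_mul (by positivity)]
      constructor
      · have h4 : (a * R ^ k) ^ η * (4 * (a * R ^ k) ^ (-η)) = 4 := by
          rw [mul_left_comm, ← Real.rpow_add hx, add_neg_cancel, Real.rpow_zero, mul_one]
        rw [h4]
        refine enorm_sub_le.trans ((add_le_add (hu _) (hu _)).trans ?_)
        calc _ ≤ 2 * E.kFun (a * R ^ (k + 1)) (E.ι₀ x) + 2 * E.kFun (a * R ^ (k + 1)) (E.ι₀ x) := by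
              gcongr
          _ = _ := by rw [← add_mul]; norm_num
      · have h4 : (a * R ^ k) ^ (η - 1) * (4 * (a * R ^ k) ^ (-η)) = 4 * (a * R ^ k)⁻¹ := by
          rw [mul_left_comm, ← Real.rpow_add hx, ← Real.rpow_neg_one]
          ring_nf
        have he : E.ι₀ (u (k + 1) - u k) = E.ι₁ (w k - w (k + 1)) := by
          rw [map_sub E.ι₁, ← hι, ← hι, ← map_sub]; congr 1; abel
        rw [h4, he, norm₁_ι₁]
        refine enorm_sub_le.trans ((add_le_add (hw' _) (hw' _)).trans ?_)
        calc _ ≤ 2 * (ENNReal.ofReal (a * R ^ k)⁻¹ * E.kFun (a * R ^ (k + 1)) (E.ι₀ x)) +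
              2 * (ENNReal.ofReal (a * R ^ k)⁻¹ * E.kFun (a * R ^ (k + 1)) (E.ι₀ x)) := by
              gcongr
              · exact hR.le
              · exact Int.le_add_one le_rfl
          _ = _ := by
              rw [← add_mul, ENNReal.ofReal_mul (by norm_num), ← mul_assoc]; norm_num
    · have hyk : y n = x - u n := by
        simp only [y, z, if_pos hkS, if_pos le_rfl]
        rw [if_neg (by omega)]
      have hck : c n = ENNReal.ofReal (5 * (a * R ^ (n : ℤ)) ^ (-η)) * ‖x‖ₑ := by
        simp only [c, if_pos hkS, lt_irrefl, if_false]
      rw [hyk, hck, ← mul_assoc, ← mul_assoc, ← ENNReal.ofReal_mul (by positivity),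
        ← ENNReal.ofReal_mul (by positivity)]
      constructor
      · have h4 : (a * R ^ (n : ℤ)) ^ η * (5 * (a * R ^ (n : ℤ)) ^ (-η)) = 5 := by
          rw [mul_left_comm, ← Real.rpow_add hx, add_neg_cancel, Real.rpow_zero, mul_one]
        rw [h4]
        refine enorm_sub_le.trans ((add_le_add le_rfl (hu _)).trans ?_)
        calc _ ≤ 1 * ‖x‖ₑ + 2 * ‖x‖ₑ := by rw [one_mul]; gcongr; exact hKx _
          _ = 3 * ‖x‖ₑ := by rw [← add_mul]; norm_num
          _ ≤ _ := by gcongr; norm_num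
      · have h4 : (a * R ^ (n : ℤ)) ^ (η - 1) * (5 * (a * R ^ (n : ℤ)) ^ (-η)) =
            5 * (a * R ^ (n : ℤ))⁻¹ := by
          rw [mul_left_comm, ← Real.rpow_add hx, ← Real.rpow_neg_one]
          ring_nf
        rw [h4, hι, norm₁_ι₁]
        refine (hw' _).trans ?_
        rw [ENNReal.ofReal_mul (by norm_num), ← mul_assoc]
        gcongr
        · norm_num
        · exact hKx _
  · have hterm : ∀ k ∈ S, c k ^ 2 ≤ ENNReal.ofReal (D ^ 2) *
        (ENNReal.ofReal ((a * R ^ (k + 1)) ^ (-(2 * η))) *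
          E.kFun (a * R ^ (k + 1)) (E.ι₀ x) ^ 2) + if k = n then N ^ 2 else 0 := by
      intro k hkS
      rcases (Finset.mem_Icc.1 hkS).2.lt_or_eq with hlt | rfl
      · have hck : c k = ENNReal.ofReal (D * (a * R ^ (k + 1)) ^ (-η)) *
          E.kFun (a * R ^ (k + 1)) (E.ι₀ x) := by simp only [c, if_pos hkS, if_pos hlt]
        have hx := hpos (k + 1)
        rw [hck, if_neg hlt.ne, add_zero, mul_pow, ← ENNReal.ofReal_pow (by positivity), mul_pow,
          ← Real.rpow_natCast ((a * R ^ (k + 1)) ^ (-η)), ← Real.rpow_mul hx.le,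
          ENNReal.ofReal_mul (by positivity), mul_assoc]
        apply le_of_eq
        congr 4
        push_cast
        ring
      · have hck : c n = ENNReal.ofReal (5 * (a * R ^ (n : ℤ)) ^ (-η)) * ‖x‖ₑ := by
          simp only [c, if_pos hkS, lt_irrefl, if_false]
        rw [if_pos rfl, hck]
        exact le_add_left (by gcongr)
    refine (Finset.sum_le_sum hterm).trans ?_
    rw [Finset.sum_add_distrib, ← Finset.mul_sum, Finset.sum_ite_eq', if_pos
      (Finset.mem_Icc.2 ⟨hnm, le_rfl⟩)]
    change _ ≤ ENNReal.ofReal _ * _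
    rw [ENNReal.ofReal_add (by positivity) zero_le_one, add_mul, ENNReal.ofReal_one, one_mul,
      ENNReal.ofReal_mul (by positivity), mul_assoc]
    gcongr
    refine (ENNReal.sum_le_tsum _).trans ?_
    exact ((Equiv.addRight (1 : ℤ)).tsum_eq (fun k : ℤ => ENNReal.ofReal
      ((a * R ^ k) ^ (-(2 * η))) * E.kFun (a * R ^ k) (E.ι₀ x) ^ 2)).trans_le
      (E.tsum_kFun_sq_le h0 h1 hR ha _)
  · have htel : ∀ j : ℕ, ∑ k ∈ Finset.Ico (-(m : ℤ)) (-(m : ℤ) + j), (z (k + 1) - z k) =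
        z (-(m : ℤ) + j) - z (-(m : ℤ)) := by
      intro j
      induction j with
      | zero => simp
      | succ j ih =>
        have : Finset.Ico (-(m : ℤ)) (-(m : ℤ) + (j + 1 : ℕ)) =
            insert (-(m : ℤ) + j) (Finset.Ico (-(m : ℤ)) (-(m : ℤ) + j)) := by
          ext k; simp
        rw [this, Finset.sum_insert (by simp), ih]
        push_cast
        rw [add_assoc]
        abel
    have hSum : ∑ k ∈ S, y k = x - u (-(m : ℤ)) := by
      have h5 : S = Finset.Ico (-(m : ℤ)) (-(m : ℤ) + (n + m + 1 : ℕ)) := by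
        ext k; simp [S]; omega
      have h6 : ∑ k ∈ S, y k = ∑ k ∈ S, (z (k + 1) - z k) :=
        Finset.sum_congr rfl fun k hk => by simp only [y, if_pos hk]
      rw [h6, h5, htel]
      simp only [z]
      rw [if_neg (by push_cast; omega), if_pos hnm]
    rw [hSum]
    simpa using hm

end BanachCouple

namespace BanachCouple

variable {𝕜 B₀ B₁ V : Type*} [RCLike 𝕜]
  [NormedAddCommGroup B₀] [NormedSpace 𝕜 B₀] [NormedAddCommGroup B₁] [NormedSpace 𝕜 B₁]
  [AddCommGroup V] [Module 𝕜 V] [TopologicalSpace V] (E : BanachCouple 𝕜 B₀ B₁ V)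

/-- The decomposition of `exists_decomposition`, balanced between the interpolation space of
exponent `b` and `B₁`: the space of exponent `θ + (1 - θ) b` lies at the fraction `θ` of the way
from the former to the latter. The case `b = 1`, where the two coincide, is included. -/
lemma exists_balanced_decomposition [IsTopologicalAddGroup V] [T2Space V] {θ b : ℝ} (h0 : 0 < θ)
    (h1 : θ < 1) (hb : b ∈ Icc (0 : ℝ) 1) :
    ∃ C : ℝ≥0, ∀ (a ε : ℝ) (x : B₀), 0 < a → 0 < ε →
      E.interpENorm (θ + (1 - θ) * b) (E.ι₀ x) ≠ ∞ →
      ∃ (S : Finset ℤ) (y : ℤ → B₀) (c : ℤ → ℝ≥0∞),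
        (∀ k ∉ S, y k = 0 ∧ c k = 0) ∧
        (∀ k, E.interpENorm b (E.ι₀ (y k)) ≤ ENNReal.ofReal ((a * 2 ^ k) ^ θ) * c k ∧
          E.norm₁ (E.ι₀ (y k)) ≤ ENNReal.ofReal ((a * 2 ^ k) ^ (θ - 1)) * c k) ∧
        ∑ k ∈ S, c k ^ 2 ≤ C * E.interpENorm (θ + (1 - θ) * b) (E.ι₀ x) ^ 2 ∧
        ‖x - ∑ k ∈ S, y k‖ ≤ ε := by
  rcases hb.2.eq_or_lt with rfl | hb1
  · refine ⟨4, fun a ε x ha hε hN => ?_⟩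
    rw [show θ + (1 - θ) * 1 = 1 by ring] at hN ⊢
    rw [interpENorm_at_one] at hN ⊢
    obtain ⟨n, hn⟩ := exists_mem_Ico_zpow (inv_pos.2 ha) (one_lt_two (α := ℝ))
    have hle : a * 2 ^ n ≤ 1 := by
      have := mul_le_mul_of_nonneg_left hn.1 ha.le
      rwa [mul_inv_cancel₀ ha.ne'] at this
    have hge : 1 / 2 ≤ a * 2 ^ n := by
      have := mul_lt_mul_of_pos_left hn.2 ha
      rw [mul_inv_cancel₀ ha.ne', zpow_add_one₀ two_ne_zero] at this
      linarith
    have hpos : 0 < a * 2 ^ n := by positivity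
    refine ⟨{n}, fun k => if k = n then x else 0,
      fun k => if k = n then 2 * E.norm₁ (E.ι₀ x) else 0, fun k hk => ?_, fun k => ?_, ?_, ?_⟩
    · simp_all
    · by_cases hk : k = n
      · subst hk
        simp only [if_true, interpENorm_at_one]
        rw [← mul_assoc, ← mul_assoc]
        have h2 : (1 / 2 : ℝ) ≤ (a * 2 ^ k) ^ θ :=
          hge.trans (Real.self_le_rpow_of_le_one hpos.le hle h1.le)
        have h3 : (1 / 2 : ℝ) ≤ (a * 2 ^ k) ^ (θ - 1) :=
          le_trans (by norm_num) (Real.one_le_rpow_of_pos_of_le_one_of_nonpos hpos hle (by linarith))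
        have h4 : ∀ r : ℝ, 1 / 2 ≤ r →
            E.norm₁ (E.ι₀ x) ≤ ENNReal.ofReal r * 2 * E.norm₁ (E.ι₀ x) := by
          intro r hr
          conv_lhs => rw [← one_mul (E.norm₁ (E.ι₀ x))]
          gcongr
          rw [show (2 : ℝ≥0∞) = ENNReal.ofReal 2 by norm_num, ← ENNReal.ofReal_mul (by linarith),
            ENNReal.one_le_ofReal]
          linarith
        exact ⟨h4 _ h2, h4 _ h3⟩
      · simp [hk, interpENorm_zero, norm₁_zero]
    · simp only [Finset.sum_singleton, if_true, mul_pow]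
      norm_num
    · simpa using hε.le
  · have hb' : 0 < 1 - b := by linarith
    have hη0 : 0 < θ + (1 - θ) * b := by nlinarith [hb.1]
    have hη1 : θ + (1 - θ) * b < 1 := by nlinarith
    have hR : 1 < (2 : ℝ) ^ (1 / (1 - b)) := Real.one_lt_rpow one_lt_two (by positivity)
    obtain ⟨C, hC⟩ := E.exists_decomposition hη0 hη1 hR
    obtain ⟨C', hC'⟩ := E.exists_interpENorm_le hb
    refine ⟨(C' + 1) ^ 2 * C, fun a ε x ha hε hN => ?_⟩
    obtain ⟨S, y, c, hS, hyc, hsum, hx⟩ := hC (a ^ (1 / (1 - b))) ε x (by positivity) hε hN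
    refine ⟨S, y, fun k => (C' + 1) * c k, fun k hk => ?_, fun k => ?_, ?_, hx⟩
    · simp [hS k hk]
    · have hx : 0 < a * 2 ^ k := by positivity
      have hτ : a ^ (1 / (1 - b)) * ((2 : ℝ) ^ (1 / (1 - b))) ^ k = (a * 2 ^ k) ^ (1 / (1 - b)) := by
        rw [Real.mul_rpow ha.le (by positivity), ← Real.rpow_intCast, ← Real.rpow_mul two_pos.le,
          ← Real.rpow_intCast, ← Real.rpow_mul two_pos.le, mul_comm (1 / (1 - b))]
      obtain ⟨hy0, hy1⟩ := hyc k
      rw [hτ] at hy0 hy1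
      generalize a * 2 ^ k = t at hx hy0 hy1
      have ht : 0 < t ^ (1 / (1 - b)) := by positivity
      have e1 : (t ^ (1 / (1 - b))) ^ (-b) * (t ^ (1 / (1 - b))) ^ (θ + (1 - θ) * b) = t ^ θ := by
        rw [← Real.rpow_add ht, ← Real.rpow_mul hx.le]
        congr 1
        field_simp
        ring
      have e2 : (t ^ (1 / (1 - b))) ^ (θ + (1 - θ) * b - 1) = t ^ (θ - 1) := by
        rw [← Real.rpow_mul hx.le]
        congr 1
        field_simp
        ring
      constructor
      · refine (hC' _ _ _ ht ((E.norm₀_ι₀ _).trans_le hy0) ?_).trans ?_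
        · refine (mul_le_mul_right hy1 _).trans (le_of_eq ?_)
          rw [← mul_assoc, ← ENNReal.ofReal_mul ht.le]
          congr 2
          conv_lhs => enter [1]; rw [← Real.rpow_one (t ^ (1 / (1 - b)))]
          rw [← Real.rpow_add ht]
          congr 1
          ring
        · rw [← mul_assoc, mul_assoc (C' : ℝ≥0∞), ← ENNReal.ofReal_mul (by positivity), e1,
            mul_comm (C' : ℝ≥0∞), mul_assoc]
          exact mul_le_mul_right (mul_le_mul_left (le_self_add (b := (1 : ℝ≥0∞))) (c k)) _
      · rw [e2] at hy1
        refine hy1.trans ?_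
        gcongr
        exact le_mul_of_one_le_left bot_le le_add_self
    · simp only [mul_pow]
      rw [← Finset.mul_sum, ENNReal.coe_mul, ENNReal.coe_pow, ENNReal.coe_add, ENNReal.coe_one,
        mul_assoc]
      gcongr

/-- Duality between the two descriptions of the real interpolation space: a family of functionals
whose norms on `B₀` and `B₁` are balanced at the powers of `2`, with square summable weights `e`,
is summable on the interpolation space. -/
lemma exists_sum_functional_le [IsTopologicalAddGroup V] [T2Space V] {θ : ℝ} (h0 : 0 < θ)
    (h1 : θ < 1) :
    ∃ C : ℝ≥0, ∀ (S : Finset ℤ) (l : ℤ → B₀ → ℝ≥0∞) (e : ℤ → ℝ≥0∞) (M₀ M₁ : ℝ) (g : B₀),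
      0 < M₀ → 0 < M₁ → (∀ k g h, l k (g + h) ≤ l k g + l k h) →
      (∀ k ∈ S, ∀ g, l k g ≤ ENNReal.ofReal (M₀ * (2 ^ k) ^ θ) * e k * ‖g‖ₑ) →
      (∀ k ∈ S, ∀ g, l k g ≤ ENNReal.ofReal (M₁ * (2 ^ k) ^ (θ - 1)) * e k * E.norm₁ (E.ι₀ g)) →
      ∑ k ∈ S, l k g ≤ C * ENNReal.ofReal (M₀ ^ (1 - θ) * M₁ ^ θ) *
        (∑ k ∈ S, e k ^ 2) ^ (1 / 2 : ℝ) * E.interpENorm θ (E.ι₀ g) := by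
  refine ⟨4 * Real.toNNReal (2 ^ (2 * θ) / (1 - 2⁻¹)) ^ (1 / 2 : ℝ),
    fun S l e M₀ M₁ g hM₀ hM₁ hadd hl₀ hl₁ => ?_⟩
  set K : ℤ → ℝ≥0∞ := fun k => ENNReal.ofReal ((M₁ / M₀ * 2 ^ k) ^ (-θ)) *
    E.kFun (M₁ / M₀ * 2 ^ k) (E.ι₀ g) with hK
  have hterm : ∀ k ∈ S, l k g ≤
      4 * ENNReal.ofReal (M₀ ^ (1 - θ) * M₁ ^ θ) * (e k * K (-k)) := by
    intro k hk
    have hτ : 0 < M₁ / M₀ * 2 ^ (-k) := by positivity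
    obtain ⟨u, w, huw, hu, hw⟩ := E.exists_near_optimal hτ (v := E.ι₀ g)
      (ne_top_of_le_ne_top enorm_ne_top ((E.kFun_le_norm₀ _ _).trans_eq (E.norm₀_ι₀ g)))
    have hι : E.ι₀ (g - u) = E.ι₁ w := by rw [map_sub, ← huw]; abel
    have hpow : (0 : ℝ) < 2 ^ k := by positivity
    have e1 : M₁ * ((2 : ℝ) ^ k) ^ (θ - 1) = M₀ * (2 ^ k) ^ θ * (M₁ / M₀ * 2 ^ (-k)) := by
      rw [Real.rpow_sub_one hpow.ne', zpow_neg]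
      field_simp
    have e2 : M₀ * ((2 : ℝ) ^ k) ^ θ = M₀ ^ (1 - θ) * M₁ ^ θ * (M₁ / M₀ * 2 ^ (-k)) ^ (-θ) := by
      rw [Real.mul_rpow (by positivity) (by positivity), Real.rpow_neg (by positivity),
        zpow_neg, Real.inv_rpow (by positivity), Real.rpow_neg (by positivity), inv_inv,
        Real.div_rpow hM₁.le hM₀.le, Real.rpow_sub hM₀, Real.rpow_one]
      field_simp
    calc l k g ≤ l k u + l k (g - u) := by simpa using hadd k u (g - u)
      _ ≤ ENNReal.ofReal (M₀ * (2 ^ k) ^ θ) * e k * ‖u‖ₑ +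
          ENNReal.ofReal (M₁ * (2 ^ k) ^ (θ - 1)) * e k * ‖w‖ₑ := by
          refine add_le_add (hl₀ k hk u) ((hl₁ k hk _).trans_eq ?_)
          rw [hι, norm₁_ι₁]
      _ = ENNReal.ofReal (M₀ * (2 ^ k) ^ θ) * e k *
          (‖u‖ₑ + ENNReal.ofReal (M₁ / M₀ * 2 ^ (-k)) * ‖w‖ₑ) := by
          rw [e1, ENNReal.ofReal_mul (p := M₀ * (2 ^ k) ^ θ) (by positivity)]; ring
      _ ≤ ENNReal.ofReal (M₀ * (2 ^ k) ^ θ) * e k *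
          (2 * E.kFun (M₁ / M₀ * 2 ^ (-k)) (E.ι₀ g) + 2 * E.kFun (M₁ / M₀ * 2 ^ (-k)) (E.ι₀ g)) := by
          gcongr
      _ = _ := by
          rw [e2, ENNReal.ofReal_mul (by positivity), hK]
          ring
  refine (Finset.sum_le_sum hterm).trans ?_
  rw [← Finset.mul_sum, ENNReal.coe_mul]
  have hsq : ∑ k ∈ S, K (-k) ^ 2 ≤
      ENNReal.ofReal (2 ^ (2 * θ) / (1 - 2⁻¹)) * E.interpENorm θ (E.ι₀ g) ^ 2 := by
    refine (ENNReal.sum_le_tsum _).trans (((Equiv.neg ℤ).tsum_eq fun k => K k ^ 2).trans_le ?_)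
    refine le_trans (le_of_eq ?_) (E.tsum_kFun_sq_le h0 h1 one_lt_two (div_pos hM₁ hM₀) (E.ι₀ g))
    congr 1
    ext k
    have hτ : 0 < M₁ / M₀ * 2 ^ k := by positivity
    rw [hK, mul_pow, ← ENNReal.ofReal_pow (by positivity),
      ← Real.rpow_natCast ((M₁ / M₀ * 2 ^ k) ^ (-θ)), ← Real.rpow_mul hτ.le]
    congr 4
    push_cast
    ring
  have hsqrt : (∑ k ∈ S, K (-k) ^ 2) ^ (1 / 2 : ℝ) ≤
      ENNReal.ofReal (2 ^ (2 * θ) / (1 - 2⁻¹)) ^ (1 / 2 : ℝ) * E.interpENorm θ (E.ι₀ g) := by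
    refine (ENNReal.rpow_le_rpow hsq (by norm_num)).trans (le_of_eq ?_)
    rw [ENNReal.mul_rpow_of_nonneg _ _ (by norm_num), ← ENNReal.rpow_two, ← ENNReal.rpow_mul]
    norm_num
  calc _ ≤ 4 * ENNReal.ofReal (M₀ ^ (1 - θ) * M₁ ^ θ) * ((∑ k ∈ S, e k ^ 2) ^ (1 / 2 : ℝ) *
        (ENNReal.ofReal (2 ^ (2 * θ) / (1 - 2⁻¹)) ^ (1 / 2 : ℝ) *
          E.interpENorm θ (E.ι₀ g))) := by
        gcongr
        exact (ENNReal.sum_mul_le_sqrt_mul_sqrt S e fun k => K (-k)).trans (by gcongr)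
    _ = _ := by
        rw [ENNReal.coe_rpow_of_nonneg _ (by norm_num)]
        change _ = 4 * ENNReal.ofReal _ ^ (1 / 2 : ℝ) * _ * _ * _
        ring

/-- `B₀ ∩ B_θ` is dense in the real interpolation space `B_θ`. -/
lemma exists_interpENorm_sub_le [IsTopologicalAddGroup V] [T2Space V] {θ : ℝ} (h0 : 0 < θ)
    (h1 : θ < 1) {v : V} (hv : E.interpENorm θ v ≠ ∞) {ε : ℝ≥0∞} (hε : ε ≠ 0) :
    ∃ x : B₀, E.interpENorm θ (v - E.ι₀ x) ≤ ε := by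
  have h1' : 0 < 1 - θ := by linarith
  obtain ⟨C, hC⟩ := E.exists_kFun_le h0 h1
  have hm := (E.kFun_mono v).measurable
  set f : ℝ → ℝ≥0∞ := fun τ => ENNReal.ofReal (τ ^ (-(2 * θ) - 1)) * E.kFun τ v ^ 2 with hf
  have hfm : Measurable f := by fun_prop
  have hfin : ∫⁻ τ in Ioi 0, f τ ≠ ∞ := by
    rw [← E.interpENorm_sq h0 h1]; exact ENNReal.pow_ne_top hv
  set c : ℝ := 4 * (2 * θ) / (2 * (1 - θ)) with hc
  have hc0 : 0 ≤ c := by positivity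
  have key : ∀ T : ℝ, 0 < T → ∃ x : B₀, E.interpENorm θ (v - E.ι₀ x) ^ 2 ≤
      (ENNReal.ofReal c + 9) * ∫⁻ τ in Ioi T, f τ := by
    intro T hT
    have hKT : E.kFun T v ≠ ∞ := ne_top_of_le_ne_top
      (ENNReal.mul_ne_top (ENNReal.mul_ne_top ENNReal.coe_ne_top ENNReal.ofReal_ne_top) hv)
      (hC T v hT)
    obtain ⟨u, w, huw, hu, hw⟩ := E.exists_near_optimal hT hKT
    refine ⟨u, ?_⟩
    have hι : v - E.ι₀ u = E.ι₁ w := by rw [← huw]; abel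
    rw [E.interpENorm_sq h0 h1, ← Ioc_union_Ioi_eq_Ioi hT.le]
    refine (lintegral_union_le _ _ _).trans ?_
    rw [add_mul]
    refine add_le_add ?_ ?_
    · calc _ ≤ ∫⁻ x in Ioc 0 T, ENNReal.ofReal (x ^ (2 * (1 - θ) - 1)) *
            (ENNReal.ofReal (T ^ (-2 : ℝ)) * (2 * E.kFun T v) ^ 2) := by
            refine setLIntegral_mono' measurableSet_Ioc fun x hx => ?_
            have hK : E.kFun x (v - E.ι₀ u) ≤ ENNReal.ofReal (x / T) * (2 * E.kFun T v) := by
              calc E.kFun x (v - E.ι₀ u) ≤ ENNReal.ofReal x * E.norm₁ (v - E.ι₀ u) :=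
                    E.kFun_le_norm₁ hx.1 _
                _ = ENNReal.ofReal (x / T) * (ENNReal.ofReal T * ‖w‖ₑ) := by
                  rw [← mul_assoc, ← ENNReal.ofReal_mul (div_nonneg hx.1.le hT.le),
                    div_mul_cancel₀ _ hT.ne', hι, norm₁_ι₁]
                _ ≤ _ := by gcongr
            calc _ ≤ ENNReal.ofReal (x ^ (-(2 * θ) - 1)) *
                  (ENNReal.ofReal (x / T) * (2 * E.kFun T v)) ^ 2 := by gcongr
              _ = _ := by
                  have := hx.1
                  rw [mul_pow (ENNReal.ofReal _), ← mul_assoc, ← mul_assoc,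
                    ← ENNReal.ofReal_pow (by positivity),
                    ← ENNReal.ofReal_mul (by positivity), ← ENNReal.ofReal_mul (by positivity)]
                  congr 2
                  rw [show 2 * (1 - θ) - 1 = (-(2 * θ) - 1) + 2 by ring, Real.rpow_add this,
                    Real.rpow_neg hT.le, Real.rpow_two, Real.rpow_two]
                  field_simp
        _ = ENNReal.ofReal c * (ENNReal.ofReal (T ^ (-(2 * θ)) / (2 * θ)) * E.kFun T v ^ 2) := by
            rw [lintegral_mul_const _ (by fun_prop), lintegral_Ioc_rpow hT (by linarith), mul_pow,
              show (2 : ℝ≥0∞) ^ 2 = ENNReal.ofReal 4 by norm_num, ← mul_assoc, ← mul_assoc,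
              ← mul_assoc, ← ENNReal.ofReal_mul (by positivity), ← ENNReal.ofReal_mul
              (by positivity), ← ENNReal.ofReal_mul (by positivity)]
            congr 2
            rw [div_mul_eq_mul_div, ← Real.rpow_add hT, hc]
            ring_nf
            field_simp
        _ = ENNReal.ofReal c * ∫⁻ x in Ioi T, ENNReal.ofReal (x ^ (-(2 * θ) - 1)) *
            E.kFun T v ^ 2 := by
            rw [lintegral_mul_const _ (by fun_prop), lintegral_Ioi_rpow hT (by linarith)]
        _ ≤ _ := by
            gcongr ENNReal.ofReal c * ?_
            refine setLIntegral_mono' measurableSet_Ioi fun x hx => ?_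
            simp only [hf]
            gcongr
            exact E.kFun_mono v (le_of_lt hx)
    · rw [← lintegral_const_mul _ hfm]
      refine setLIntegral_mono' measurableSet_Ioi fun x hx => ?_
      have hK : E.kFun x (v - E.ι₀ u) ≤ 3 * E.kFun x v := by
        calc E.kFun x (v - E.ι₀ u) ≤ E.kFun x v + E.kFun x (-E.ι₀ u) := by
              rw [sub_eq_add_neg]; exact E.kFun_add_le _ _ _
          _ ≤ 1 * E.kFun x v + 2 * E.kFun x v := by
              rw [one_mul]
              gcongr
              rw [← map_neg]
              refine (E.kFun_le_norm₀ _ _).trans ?_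
              rw [norm₀_ι₀, enorm_neg]
              refine hu.trans ?_
              gcongr
              exact E.kFun_mono v (le_of_lt hx)
          _ = _ := by rw [← add_mul]; norm_num
      calc _ ≤ ENNReal.ofReal (x ^ (-(2 * θ) - 1)) * (3 * E.kFun x v) ^ 2 := by gcongr
        _ = _ := by simp only [hf]; rw [mul_pow]; ring_nf
  have hlim : Tendsto (fun n : ℕ => ∫⁻ τ in Ioi ((n : ℝ) + 1), f τ) atTop (𝓝 0) := by
    have h2 : Tendsto (fun n : ℕ => ∫⁻ τ in Ioi 0, (Ioi ((n : ℝ) + 1)).indicator f τ) atTop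
        (𝓝 (∫⁻ τ in Ioi (0 : ℝ), 0)) := by
      refine tendsto_lintegral_of_dominated_convergence f
        (fun n => hfm.indicator measurableSet_Ioi)
        (fun n => ae_of_all _ fun τ => indicator_le_self _ _ _) hfin (ae_of_all _ fun τ => ?_)
      obtain ⟨N, hN⟩ := exists_nat_gt τ
      refine tendsto_const_nhds.congr' ?_
      filter_upwards [eventually_ge_atTop N] with n hn
      rw [indicator_of_notMem]
      have : (N : ℝ) ≤ n := by exact_mod_cast hn
      simp only [mem_Ioi, not_lt]
      linarith
    rw [lintegral_zero] at h2
    refine h2.congr fun n => ?_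
    rw [lintegral_indicator measurableSet_Ioi, Measure.restrict_restrict measurableSet_Ioi,
      inter_eq_left.2]
    exact Ioi_subset_Ioi (by positivity)
  have hlim2 := ENNReal.Tendsto.const_mul (a := ENNReal.ofReal c + 9) hlim
    (Or.inr (by finiteness))
  rw [mul_zero] at hlim2
  obtain ⟨n, hn⟩ := (hlim2.eventually (gt_mem_nhds (ENNReal.pow_pos hε.bot_lt 2))).exists
  obtain ⟨x, hx⟩ := key (n + 1) (by positivity)
  exact ⟨x, (ENNReal.pow_right_strictMono two_ne_zero).le_iff_le.1 (hx.trans hn.le)⟩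

end BanachCouple

/-! ### Convolution inequalities on the line -/

lemma ENNReal.le_of_forall_add_ofReal_mul {X Y Z : ℝ≥0∞} (hZ : Z ≠ ∞)
    (h : ∀ ε : ℝ, 0 < ε → X ≤ Y + ENNReal.ofReal ε * Z) : X ≤ Y := by
  have hlim : Tendsto (fun n : ℕ => Y + ENNReal.ofReal (1 / ((n : ℝ) + 1)) * Z) atTop (𝓝 Y) := by
    have h1 := ENNReal.Tendsto.mul_const (b := Z)
      (ENNReal.tendsto_ofReal tendsto_one_div_add_atTop_nhds_zero_nat) (Or.inr hZ)
    simpa using h1.const_add Y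
  exact ge_of_tendsto' hlim fun n => h _ (by positivity)

lemma lintegral_comp_abs_sub_le {φ : ℝ → ℝ≥0∞} (t : ℝ) :
    ∫⁻ s, φ |t - s| ≤ 2 * ∫⁻ τ in Ici 0, φ τ := by
  rw [lintegral_sub_left_eq_self (μ := volume) (fun s => φ |s|) t, two_mul,
    ← lintegral_add_compl (fun s => φ |s|) (measurableSet_Ici (a := (0 : ℝ)))]
  refine add_le_add (le_of_eq ?_) ?_
  · exact setLIntegral_congr_fun measurableSet_Ici fun s (hs : 0 ≤ s) => by
      simp only [abs_of_nonneg hs]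
  · have hneg : ∫⁻ s in (Ici (0 : ℝ))ᶜ, φ |s| = ∫⁻ s in Ioi 0, φ s := by
      rw [compl_Ici, ← lintegral_indicator measurableSet_Iio,
        ← lintegral_indicator measurableSet_Ioi,
        ← lintegral_neg_eq_self (μ := volume) ((Ioi (0 : ℝ)).indicator fun s => φ s)]
      refine lintegral_congr fun s => ?_
      by_cases hs : s < 0
      · rw [indicator_of_mem (show s ∈ Iio (0 : ℝ) from hs),
          indicator_of_mem (show -s ∈ Ioi (0 : ℝ) by simpa using hs), abs_of_neg hs]
      · rw [indicator_of_notMem (show s ∉ Iio (0 : ℝ) from hs),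
          indicator_of_notMem (show -s ∉ Ioi (0 : ℝ) by simpa using hs)]
    rw [hneg]
    exact lintegral_mono_set Ioi_subset_Ici_self

lemma lintegral_lintegral_abs_sub_le {φ w : ℝ → ℝ≥0∞} (hφ : Measurable φ) (hw : Measurable w)
    (W : Set ℝ) :
    ∫⁻ t in W, ∫⁻ s in W, φ |t - s| * w s ≤ 2 * (∫⁻ τ in Ici 0, φ τ) * ∫⁻ s in W, w s := by
  rw [lintegral_lintegral_swap (by
    apply Measurable.aemeasurable
    unfold Function.uncurry
    fun_prop), ← lintegral_const_mul _ hw]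
  refine lintegral_mono fun s => ?_
  rw [lintegral_mul_const _ (by fun_prop)]
  gcongr
  refine (setLIntegral_le_lintegral _ _).trans ?_
  simp_rw [abs_sub_comm _ s]
  exact lintegral_comp_abs_sub_le s

/-- Schur's test for a convolution kernel. -/
lemma lintegral_lintegral_convolution_le {φ u v : ℝ → ℝ≥0∞} (hφ : Measurable φ)
    (hu : Measurable u) (hv : Measurable v) (W : Set ℝ) :
    ∫⁻ t in W, ∫⁻ s in W, φ |t - s| * (u t * v s) ≤
      2 * (∫⁻ τ in Ici 0, φ τ) *
        ((∫⁻ s in W, u s ^ 2) ^ (1 / 2 : ℝ) * (∫⁻ s in W, v s ^ 2) ^ (1 / 2 : ℝ)) := by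
  set μ := volume.restrict W
  have hsq : ∀ x : ℝ≥0∞, (x ^ (1 / 2 : ℝ)) ^ 2 = x := fun x => by
    rw [← ENNReal.rpow_two, ← ENNReal.rpow_mul]; norm_num
  have hsq' : ∀ x : ℝ≥0∞, x ^ (1 / 2 : ℝ) * x ^ (1 / 2 : ℝ) = x := fun x => by
    rw [← sq, hsq]
  have hφ' : Measurable fun z : ℝ × ℝ => φ |z.1 - z.2| := by fun_prop
  have h1 := ENNReal.lintegral_mul_le_Lp_mul_Lq (μ.prod μ) Real.HolderConjugate.two_two
    (f := fun z => φ |z.1 - z.2| ^ (1 / 2 : ℝ) * u z.1)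
    (g := fun z => φ |z.1 - z.2| ^ (1 / 2 : ℝ) * v z.2)
    (by fun_prop) (by fun_prop)
  simp only [Pi.mul_apply, ENNReal.rpow_two, mul_pow, hsq] at h1
  have h2 : ∫⁻ z, φ |z.1 - z.2| ^ (1 / 2 : ℝ) * u z.1 * (φ |z.1 - z.2| ^ (1 / 2 : ℝ) * v z.2)
      ∂μ.prod μ = ∫⁻ t in W, ∫⁻ s in W, φ |t - s| * (u t * v s) := by
    rw [← lintegral_prod (fun z : ℝ × ℝ => φ |z.1 - z.2| * (u z.1 * v z.2)) (by fun_prop)]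
    refine lintegral_congr fun z => ?_
    rw [mul_mul_mul_comm, hsq']
  have h3 : ∫⁻ z, φ |z.1 - z.2| * v z.2 ^ 2 ∂μ.prod μ ≤
      2 * (∫⁻ τ in Ici 0, φ τ) * ∫⁻ s in W, v s ^ 2 := by
    rw [lintegral_prod _ (by fun_prop)]
    exact lintegral_lintegral_abs_sub_le hφ (by fun_prop) W
  have h4 : ∫⁻ z, φ |z.1 - z.2| * u z.1 ^ 2 ∂μ.prod μ ≤
      2 * (∫⁻ τ in Ici 0, φ τ) * ∫⁻ s in W, u s ^ 2 := by
    rw [lintegral_prod_symm _ (by fun_prop)]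
    simp only
    simp_rw [abs_sub_comm]
    exact lintegral_lintegral_abs_sub_le hφ (by fun_prop) W
  rw [← h2]
  refine h1.trans ((mul_le_mul' (ENNReal.rpow_le_rpow h4 (by norm_num))
    (ENNReal.rpow_le_rpow h3 (by norm_num))).trans_eq ?_)
  generalize 2 * ∫⁻ τ in Ici 0, φ τ = K
  rw [ENNReal.mul_rpow_of_nonneg _ _ (by norm_num), ENNReal.mul_rpow_of_nonneg _ _ (by norm_num),
    mul_mul_mul_comm, hsq']

/-- The Hardy–Littlewood–Sobolev inequality on the line, for the quadratic form. By symmetry only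
the pairs `(t, s)` with `f s ≤ f t` matter, and for these the inner integral is bounded pointwise:
near `t` by the bound `f s ≤ f t`, and away from `t` by Hölder's inequality. -/
lemma exists_hardyLittlewoodSobolev {γ : ℝ} (h0 : 0 < γ) (h1 : γ < 1) :
    ∃ C : ℝ≥0, ∀ (W : Set ℝ) (f : ℝ → ℝ≥0∞), Measurable f → (∀ s, f s ≠ ∞) →
      ∫⁻ t in W, ∫⁻ s in W, ENNReal.ofReal (|t - s| ^ (-γ)) * (f t * f s) ≤
        C * (∫⁻ s in W, f s ^ (2 / (2 - γ))) ^ (2 - γ) := by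
  set p : ℝ := 2 / (2 - γ) with hp
  have h2γ : 0 < 2 - γ := by linarith
  have h1γ : 0 < 1 - γ := by linarith
  have hp0 : 0 < p := by positivity
  have hpp : p * (2 - γ) = 2 := by rw [hp]; field_simp
  set c : ℝ := 2 / (1 - γ) + 2 ^ (γ / 2) with hc
  have hc0 : 0 < c := by positivity
  refine ⟨Real.toNNReal (2 * c), fun W f hf hfin => ?_⟩
  change _ ≤ ENNReal.ofReal (2 * c) * _
  set Φ := ∫⁻ s in W, f s ^ p with hΦ
  by_cases hΦ0 : Φ = 0
  · rw [hΦ, lintegral_eq_zero_iff (by fun_prop)] at hΦ0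
    have : ∀ᵐ t ∂(volume.restrict W), ∫⁻ s in W, ENNReal.ofReal (|t - s| ^ (-γ)) * (f t * f s)
        = 0 := by
      filter_upwards [hΦ0] with t ht
      have : f t = 0 := by simpa [hp0, hp0.not_gt] using ht
      simp [this]
    rw [lintegral_congr_ae this]
    simp
  by_cases hΦt : Φ = ∞
  · rw [hΦt, ENNReal.top_rpow_of_pos h2γ, ENNReal.mul_top (by simpa using hc0)]
    exact le_top
  set P := Φ.toReal with hP
  have hP0 : 0 < P := ENNReal.toReal_pos hΦ0 hΦt
  have hPΦ : ENNReal.ofReal P = Φ := ENNReal.ofReal_toReal hΦt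
  -- the pointwise bound
  have key : ∀ t, ∫⁻ s in W, (if f s ≤ f t then ENNReal.ofReal (|t - s| ^ (-γ)) * (f t * f s)
      else 0) ≤ ENNReal.ofReal c * f t ^ p * Φ ^ (1 - γ) := by
    intro t
    by_cases hft : f t = 0
    · simp [hft]
    set v := (f t).toReal with hv
    have hv0 : 0 < v := ENNReal.toReal_pos hft (hfin t)
    have hvf : ENNReal.ofReal v = f t := ENNReal.ofReal_toReal (hfin t)
    set R : ℝ := P / v ^ p with hR
    have hR0 : 0 < R := by positivity
    have hnear : ∫⁻ s in W, (if |t - s| ≤ R then ENNReal.ofReal (|t - s| ^ (-γ)) else 0) ≤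
        2 * ENNReal.ofReal (R ^ (1 - γ) / (1 - γ)) := by
      refine (setLIntegral_le_lintegral _ _).trans ((lintegral_comp_abs_sub_le
        (φ := fun τ => if τ ≤ R then ENNReal.ofReal (τ ^ (-γ)) else 0) t).trans ?_)
      gcongr
      rw [← lintegral_Ioc_rpow hR0 h1γ, ← setLIntegral_congr Ioi_ae_eq_Ici, ←
        lintegral_indicator measurableSet_Ioi, ← lintegral_indicator measurableSet_Ioc]
      refine lintegral_mono fun τ => ?_
      by_cases h : τ ∈ Ioc 0 R
      · rw [indicator_of_mem h, indicator_of_mem (show τ ∈ Ioi (0 : ℝ) from h.1), if_pos h.2,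
          show 1 - γ - 1 = -γ by ring]
      · by_cases h' : τ ∈ Ioi (0 : ℝ)
        · rw [indicator_of_notMem h, indicator_of_mem h', if_neg fun hh => h ⟨h', hh⟩]
        · rw [indicator_of_notMem h']; exact bot_le
    have hfar : ∫⁻ s in W, (if |t - s| ≤ R then 0 else ENNReal.ofReal (|t - s| ^ (-γ))) * f s ≤
        ENNReal.ofReal (2 / R) ^ (γ / 2) * Φ ^ (1 / p) := by
      have hconj : (2 / γ).HolderConjugate p := by
        rw [Real.holderConjugate_iff, hp]
        constructor
        · rw [lt_div_iff₀ h0]; linarith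
        · field_simp; ring
      have h := ENNReal.lintegral_mul_le_Lp_mul_Lq (volume.restrict W) hconj
        (f := fun s => if |t - s| ≤ R then 0 else ENNReal.ofReal (|t - s| ^ (-γ))) (g := f)
        (Measurable.aemeasurable (Measurable.ite (measurableSet_le (by fun_prop) (by fun_prop))
          (by fun_prop) (by fun_prop))) hf.aemeasurable
      refine h.trans ?_
      rw [one_div_div]
      gcongr
      refine (setLIntegral_le_lintegral _ _).trans ((lintegral_comp_abs_sub_le
        (φ := fun τ => (if τ ≤ R then 0 else ENNReal.ofReal (τ ^ (-γ))) ^ (2 / γ)) t).trans ?_)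
      have e : ENNReal.ofReal (2 / R) = 2 * ENNReal.ofReal (R ^ (-1 : ℝ) / 1) := by
        rw [div_one, Real.rpow_neg_one, div_eq_mul_inv, ENNReal.ofReal_mul two_pos.le]
        norm_num
      rw [e, ← lintegral_Ioi_rpow hR0 one_pos, ← setLIntegral_congr Ioi_ae_eq_Ici, ←
        lintegral_indicator measurableSet_Ioi, ← lintegral_indicator measurableSet_Ioi]
      gcongr with τ
      by_cases h : τ ∈ Ioi R
      · have hτ : 0 < τ := hR0.trans h
        rw [indicator_of_mem h, indicator_of_mem (show τ ∈ Ioi (0 : ℝ) from hτ),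
          if_neg (not_le.2 h), ENNReal.ofReal_rpow_of_pos (by positivity), ← Real.rpow_mul hτ.le]
        apply le_of_eq
        congr 2
        field_simp
        norm_num
      · by_cases h' : τ ∈ Ioi (0 : ℝ)
        · rw [indicator_of_notMem h, indicator_of_mem h', if_pos (not_lt.1 h),
            ENNReal.zero_rpow_of_pos (by positivity)]
        · rw [indicator_of_notMem h']; exact bot_le
    calc ∫⁻ s in W, (if f s ≤ f t then ENNReal.ofReal (|t - s| ^ (-γ)) * (f t * f s) else 0)
        ≤ ∫⁻ s in W, (f t * f t *
            (if |t - s| ≤ R then ENNReal.ofReal (|t - s| ^ (-γ)) else 0) +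
            f t * ((if |t - s| ≤ R then 0 else ENNReal.ofReal (|t - s| ^ (-γ))) * f s)) := by
          refine lintegral_mono fun s => ?_
          split_ifs with h2 h3
          · simp only [zero_mul, mul_zero, add_zero]
            rw [mul_comm]
            gcongr
          · simp only [mul_zero, zero_add]
            exact le_of_eq (by ring)
          · exact bot_le
          · exact bot_le
      _ = f t * f t * (∫⁻ s in W, if |t - s| ≤ R then ENNReal.ofReal (|t - s| ^ (-γ)) else 0) +
            f t * ∫⁻ s in W,
              (if |t - s| ≤ R then 0 else ENNReal.ofReal (|t - s| ^ (-γ))) * f s := by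
          have m1 : Measurable fun s => (if |t - s| ≤ R then ENNReal.ofReal (|t - s| ^ (-γ))
              else 0) := Measurable.ite (measurableSet_le (by fun_prop) (by fun_prop))
                (by fun_prop) (by fun_prop)
          have m2 : Measurable fun s => (if |t - s| ≤ R then 0 else
              ENNReal.ofReal (|t - s| ^ (-γ))) := Measurable.ite
                (measurableSet_le (by fun_prop) (by fun_prop)) (by fun_prop) (by fun_prop)
          rw [lintegral_add_left (by fun_prop), lintegral_const_mul _ m1,
            lintegral_const_mul _ (by fun_prop)]
      _ ≤ f t * f t * (2 * ENNReal.ofReal (R ^ (1 - γ) / (1 - γ))) +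
            f t * (ENNReal.ofReal (2 / R) ^ (γ / 2) * Φ ^ (1 / p)) := by gcongr
      _ = ENNReal.ofReal (v * v * (2 * (R ^ (1 - γ) / (1 - γ))) +
            v * ((2 / R) ^ (γ / 2) * P ^ (1 / p))) := by
          rw [← hPΦ, ← hvf, ENNReal.ofReal_rpow_of_pos (by positivity),
            ENNReal.ofReal_rpow_of_pos (by positivity), ENNReal.ofReal_add (by positivity)
            (by positivity), ENNReal.ofReal_mul (by positivity), ENNReal.ofReal_mul (by positivity),
            ENNReal.ofReal_mul (by positivity), ENNReal.ofReal_mul (by positivity),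
            ENNReal.ofReal_mul (by positivity)]
          norm_num
      _ = ENNReal.ofReal (c * v ^ p * P ^ (1 - γ)) := by
          congr 1
          have e1 : v * v * R ^ (1 - γ) = v ^ p * P ^ (1 - γ) := by
            rw [hR, Real.div_rpow hP0.le (by positivity), ← Real.rpow_mul hv0.le, ← sq,
              ← Real.rpow_two, mul_div_assoc', mul_comm, mul_div_assoc, ← Real.rpow_sub hv0,
              mul_comm]
            congr 2
            linarith
          have e2 : v * ((1 / R) ^ (γ / 2) * P ^ (1 / p)) = v ^ p * P ^ (1 - γ) := by
            rw [hR, one_div_div, Real.div_rpow (by positivity) hP0.le, ← Real.rpow_mul hv0.le,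
              div_mul_eq_mul_div, mul_div_assoc, ← Real.rpow_sub hP0, ← mul_assoc]
            congr 1
            · conv_lhs => enter [1]; rw [← Real.rpow_one v]
              rw [← Real.rpow_add hv0]
              congr 1
              linarith
            · congr 1
              rw [hp]
              field_simp
              ring
          rw [show (2 / R) = 2 * (1 / R) by ring, Real.mul_rpow two_pos.le (by positivity), hc]
          linear_combination (2 / (1 - γ)) * e1 + (2 : ℝ) ^ (γ / 2) * e2
      _ = _ := by
          rw [ENNReal.ofReal_mul (by positivity), ENNReal.ofReal_mul (by positivity),
            ← ENNReal.ofReal_rpow_of_pos hv0, ← ENNReal.ofReal_rpow_of_pos hP0, hvf, hPΦ]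
  have hm : Measurable fun z : ℝ × ℝ => (if f z.2 ≤ f z.1 then
      ENNReal.ofReal (|z.1 - z.2| ^ (-γ)) * (f z.1 * f z.2) else 0) :=
    Measurable.ite (measurableSet_le (by fun_prop) (by fun_prop)) (by fun_prop) (by fun_prop)
  have hm' : Measurable fun z : ℝ × ℝ => (if f z.1 ≤ f z.2 then
      ENNReal.ofReal (|z.1 - z.2| ^ (-γ)) * (f z.1 * f z.2) else 0) :=
    Measurable.ite (measurableSet_le (by fun_prop) (by fun_prop)) (by fun_prop) (by fun_prop)
  have hint : ∫⁻ t in W, ∫⁻ s in W, (if f s ≤ f t then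
      ENNReal.ofReal (|t - s| ^ (-γ)) * (f t * f s) else 0) ≤ ENNReal.ofReal c * Φ ^ (2 - γ) := by
    refine (lintegral_mono key).trans (le_of_eq ?_)
    rw [lintegral_mul_const _ (by fun_prop), lintegral_const_mul _ (by fun_prop), ← hΦ, mul_assoc]
    congr 1
    conv_lhs => enter [1]; rw [← ENNReal.rpow_one Φ]
    rw [← ENNReal.rpow_add _ _ hΦ0 hΦt]
    congr 1
    ring
  have hint' : ∫⁻ t in W, ∫⁻ s in W, (if f t ≤ f s then
      ENNReal.ofReal (|t - s| ^ (-γ)) * (f t * f s) else 0) ≤ ENNReal.ofReal c * Φ ^ (2 - γ) := by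
    rw [lintegral_lintegral_swap hm'.aemeasurable]
    refine le_trans (le_of_eq ?_) hint
    simp_rw [abs_sub_comm, mul_comm (f _) (f _)]
  calc _ ≤ ∫⁻ t in W, ∫⁻ s in W, ((if f s ≤ f t then
        ENNReal.ofReal (|t - s| ^ (-γ)) * (f t * f s) else 0) + (if f t ≤ f s then
        ENNReal.ofReal (|t - s| ^ (-γ)) * (f t * f s) else 0)) := by
        refine lintegral_mono fun t => lintegral_mono fun s => ?_
        rcases le_total (f s) (f t) with h | h
        · simp only [if_pos h]; exact le_self_add
        · simp only [if_pos h]; exact le_add_self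
    _ = _ + _ := by
        rw [← lintegral_add_left hm.lintegral_prod_right']
        refine lintegral_congr fun t => ?_
        exact lintegral_add_left (hm.comp (measurable_prodMk_left (x := t))) _
    _ ≤ _ := add_le_add hint hint'
    _ = _ := by rw [ENNReal.ofReal_mul two_pos.le, ENNReal.ofReal_ofNat]; ring

/-! ### Dispersive families of operators -/

section Inner

variable {𝕜 H : Type*} [RCLike 𝕜] [NormedAddCommGroup H] [InnerProductSpace 𝕜 H]

lemma enorm_inner_le (x y : H) : ‖inner 𝕜 x y‖ₑ ≤ ‖x‖ₑ * ‖y‖ₑ := by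
  rw [← ofReal_norm, ← ofReal_norm, ← ofReal_norm, ← ENNReal.ofReal_mul (norm_nonneg _)]
  exact ENNReal.ofReal_le_ofReal (norm_inner_le_norm x y)

lemma enorm_inner_symm (x y : H) : ‖inner 𝕜 x y‖ₑ = ‖inner 𝕜 y x‖ₑ := by
  rw [← ofReal_norm, ← ofReal_norm, norm_inner_symm]

lemma enorm_inner_self (x : H) : ‖inner 𝕜 x x‖ₑ = ‖x‖ₑ ^ 2 := by
  rw [inner_self_eq_norm_sq_to_K, ← ofReal_norm, ← ofReal_norm, norm_pow, RCLike.norm_ofReal,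
    abs_norm, ENNReal.ofReal_pow (norm_nonneg _)]

variable [CompleteSpace H] [NormedSpace ℝ H]

lemma enorm_inner_integral_le {α : Type*} [MeasurableSpace α] {μ : Measure α} {f : α → H}
    (hf : Integrable f μ) (h : H) : ‖inner 𝕜 h (∫ t, f t ∂μ)‖ₑ ≤ ∫⁻ t, ‖inner 𝕜 h (f t)‖ₑ ∂μ := by
  rw [← integral_inner hf]
  exact enorm_integral_le_lintegral_enorm _

lemma enorm_inner_integral_le' {α : Type*} [MeasurableSpace α] {μ : Measure α} {f : α → H}
    (hf : Integrable f μ) (h : H) : ‖inner 𝕜 (∫ t, f t ∂μ) h‖ₑ ≤ ∫⁻ t, ‖inner 𝕜 (f t) h‖ₑ ∂μ := by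
  rw [enorm_inner_symm]
  refine (enorm_inner_integral_le hf h).trans (le_of_eq ?_)
  simp_rw [enorm_inner_symm h]

lemma enorm_integral_sq_le {α : Type*} [MeasurableSpace α] {μ : Measure α} {f : α → H}
    (hf : Integrable f μ) :
    ‖∫ t, f t ∂μ‖ₑ ^ 2 ≤ ∫⁻ t, ∫⁻ s, ‖inner 𝕜 (f t) (f s)‖ₑ ∂μ ∂μ := by
  rw [← enorm_inner_self (𝕜 := 𝕜)]
  refine (enorm_inner_integral_le' hf _).trans (lintegral_mono fun t => ?_)
  exact enorm_inner_integral_le hf _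

end Inner

namespace BanachCouple

variable {𝕜 H B₀ B₁ V : Type*} [RCLike 𝕜]
  [NormedAddCommGroup H] [InnerProductSpace 𝕜 H]
  [NormedAddCommGroup B₀] [NormedSpace 𝕜 B₀] [NormedAddCommGroup B₁] [NormedSpace 𝕜 B₁]
  [AddCommGroup V] [Module 𝕜 V] [TopologicalSpace V]

/-- A measurable family of operators `L s : B₀ → H`, for `s ∈ ℝ` (the adjoints of a propagator),
with an energy bound on `B₀` and a bound of order `|t - s| ^ (-σ)` on `B₁` for the form
`(x, y) ↦ ⟪L t y, L s x⟫`. The constants are taken positive, so that one can divide by them. -/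
structure IsDispersive (E : BanachCouple 𝕜 B₀ B₁ V) (σ A D : ℝ) (L : ℝ → B₀ →L[𝕜] H) : Prop where
  A_pos : 0 < A
  D_pos : 0 < D
  aestronglyMeasurable_apply : ∀ g, AEStronglyMeasurable (fun s => L s g) volume
  energy : ∀ s g, ‖L s g‖ₑ ≤ ENNReal.ofReal A * ‖g‖ₑ
  dispersion : ∀ t s, t ≠ s → ∀ x y, ‖inner 𝕜 (L t y) (L s x)‖ₑ ≤
    ENNReal.ofReal (D * |t - s| ^ (-σ)) * E.norm₁ (E.ι₀ y) * E.norm₁ (E.ι₀ x)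

namespace IsDispersive

variable {E : BanachCouple 𝕜 B₀ B₁ V} {σ A D : ℝ} {L : ℝ → B₀ →L[𝕜] H}

lemma enorm_inner_energy_le (hL : E.IsDispersive σ A D L) (t s : ℝ) (x y : B₀) :
    ‖inner 𝕜 (L t y) (L s x)‖ₑ ≤ ENNReal.ofReal (A ^ 2) * ‖y‖ₑ * ‖x‖ₑ := by
  refine (enorm_inner_le _ _).trans ((mul_le_mul' (hL.energy t y) (hL.energy s x)).trans_eq ?_)
  rw [ENNReal.ofReal_pow hL.A_pos.le]
  ring

lemma aestronglyMeasurable (hL : E.IsDispersive σ A D L) {W : Set ℝ} {F : ℝ → B₀}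
    (hF : AEStronglyMeasurable F (volume.restrict W)) :
    AEStronglyMeasurable (fun s => L s (F s)) (volume.restrict W) := by
  have hsimple : ∀ f : SimpleFunc ℝ B₀,
      AEStronglyMeasurable (fun s => L s (f s)) (volume.restrict W) := by
    intro f
    induction f using SimpleFunc.induction with
    | const c hs =>
      refine ((hL.aestronglyMeasurable_apply c).restrict.indicator hs).congr (ae_of_all _ fun s => ?_)
      by_cases h : s ∈ ‹Set ℝ› <;> simp [h]
    | add _ hf hg =>
      exact (hf.add hg).congr (ae_of_all _ fun s => by simp)
  have hm := hF.stronglyMeasurable_mk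
  have h2 : AEStronglyMeasurable (fun s => L s (hF.mk F s)) (volume.restrict W) :=
    aestronglyMeasurable_of_tendsto_ae atTop (fun n => hsimple (hm.approx n))
      (ae_of_all _ fun s => ((L s).continuous.tendsto _).comp (hm.tendsto_approx s))
  refine h2.congr ?_
  filter_upwards [hF.ae_eq_mk] with s hs
  rw [hs]

lemma integrableOn (hL : E.IsDispersive σ A D L) {W : Set ℝ} {F : ℝ → B₀}
    (hF : IntegrableOn F W) : IntegrableOn (fun s => L s (F s)) W := by
  refine (hF.norm.const_mul A).mono' (hL.aestronglyMeasurable hF.1) (ae_of_all _ fun s => ?_)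
  rw [← ENNReal.ofReal_le_ofReal_iff (mul_nonneg hL.A_pos.le (norm_nonneg _)), ofReal_norm,
    ENNReal.ofReal_mul hL.A_pos.le, ofReal_norm]
  exact hL.energy s _

lemma integrableOn_simpleFunc (hL : E.IsDispersive σ A D L) {W : Set ℝ} (hW : volume W ≠ ∞)
    (F : SimpleFunc ℝ B₀) : IntegrableOn (fun s => L s (F s)) W := by
  have : IsFiniteMeasure (volume.restrict W) := ⟨by simpa using hW.lt_top⟩
  exact hL.integrableOn (F.integrable_of_isFiniteMeasure)

variable [IsTopologicalAddGroup V] [T2Space V]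

/-- Interpolation between the energy bound and the dispersive bound, for fixed times. -/
lemma exists_enorm_inner_le (hL : E.IsDispersive σ A D L) {b : ℝ} (hb : b ∈ Icc (0 : ℝ) 1) :
    ∃ C : ℝ≥0, ∀ t s, t ≠ s → ∀ x y, E.interpENorm b (E.ι₀ x) ≠ ∞ →
      ‖inner 𝕜 (L t y) (L s x)‖ₑ ≤ C * ENNReal.ofReal (|t - s| ^ (-(σ * b))) *
        E.interpENorm b (E.ι₀ y) * E.interpENorm b (E.ι₀ x) := by
  rcases hb.1.eq_or_lt with rfl | h0
  · refine ⟨Real.toNNReal (A ^ 2), fun t s _ x y _ => ?_⟩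
    simpa [interpENorm_at_zero, norm₀_ι₀, ENNReal.ofReal] using hL.enorm_inner_energy_le t s x y
  rcases hb.2.eq_or_lt with rfl | h1
  · refine ⟨Real.toNNReal D, fun t s hts x y _ => ?_⟩
    have := hL.dispersion t s hts x y
    rw [ENNReal.ofReal_mul hL.D_pos.le] at this
    simpa [interpENorm_at_one, ENNReal.ofReal] using this
  obtain ⟨C, hC⟩ := E.exists_balanced_decomposition (b := 0) h0 h1 (by simp)
  obtain ⟨C', hC'⟩ := E.exists_sum_functional_le h0 h1
  simp only [mul_zero, add_zero, interpENorm_at_zero, norm₀_ι₀] at hC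
  have hA := hL.A_pos
  have hD := hL.D_pos
  refine ⟨C' * Real.toNNReal ((A ^ 2) ^ (1 - b) * D ^ b) * C ^ (1 / 2 : ℝ),
    fun t s hts x y hx => ?_⟩
  have hts' : 0 < |t - s| := abs_pos.2 (sub_ne_zero.2 hts)
  refine ENNReal.le_of_forall_add_ofReal_mul (Z := ENNReal.ofReal (A ^ 2) * ‖y‖ₑ) (by finiteness)
    fun ε hε => ?_
  obtain ⟨S, z, c, -, hzc, hsum, hrem⟩ := hC 1 ε x one_pos hε hx
  simp only [one_mul] at hzc
  have hl := hC' S (fun k g => ‖inner 𝕜 (L t g) (L s (z k))‖ₑ) c (A ^ 2) (D * |t - s| ^ (-σ)) y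
    (by positivity) (by positivity) (fun k g h => by rw [map_add, inner_add_left]; exact enorm_add_le _ _)
    (fun k _ g => by
      refine (hL.enorm_inner_energy_le t s (z k) g).trans ?_
      rw [ENNReal.ofReal_mul (by positivity)]
      calc _ ≤ ENNReal.ofReal (A ^ 2) * ‖g‖ₑ * (ENNReal.ofReal ((2 ^ k) ^ b) * c k) := by
            gcongr; exact (hzc k).1
        _ = _ := by ring)
    (fun k _ g => by
      refine (hL.dispersion t s hts (z k) g).trans ?_
      rw [ENNReal.ofReal_mul (p := D * |t - s| ^ (-σ)) (by positivity)]
      calc _ ≤ ENNReal.ofReal (D * |t - s| ^ (-σ)) * E.norm₁ (E.ι₀ g) *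
            (ENNReal.ofReal ((2 ^ k) ^ (b - 1)) * c k) := by
            gcongr; exact (hzc k).2
        _ = _ := by ring)
  have hsplit : inner 𝕜 (L t y) (L s x) = ∑ k ∈ S, inner 𝕜 (L t y) (L s (z k)) +
      inner 𝕜 (L t y) (L s (x - ∑ k ∈ S, z k)) := by
    rw [← inner_sum, ← map_sum, ← inner_add_right, ← map_add]
    congr 2
    abel
  rw [hsplit]
  refine (enorm_add_le _ _).trans (add_le_add ((enorm_sum_le _ _).trans (hl.trans ?_)) ?_)
  · have e : ((A ^ 2) ^ (1 - b) * (D * |t - s| ^ (-σ)) ^ b) =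
        (A ^ 2) ^ (1 - b) * D ^ b * |t - s| ^ (-(σ * b)) := by
      rw [Real.mul_rpow hD.le (by positivity), ← Real.rpow_mul hts'.le]
      ring_nf
    rw [e, ENNReal.ofReal_mul (by positivity)]
    have hs : (∑ k ∈ S, c k ^ 2) ^ (1 / 2 : ℝ) ≤
        (C : ℝ≥0∞) ^ (1 / 2 : ℝ) * E.interpENorm b (E.ι₀ x) := by
      refine (ENNReal.rpow_le_rpow hsum (by norm_num)).trans (le_of_eq ?_)
      rw [ENNReal.mul_rpow_of_nonneg _ _ (by norm_num), ← ENNReal.rpow_two, ← ENNReal.rpow_mul]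
      norm_num
    rw [ENNReal.coe_mul, ENNReal.coe_mul, ENNReal.coe_rpow_of_nonneg _ (by norm_num)]
    change _ ≤ C' * ENNReal.ofReal _ * _ * _ * _ * _
    calc _ ≤ C' * (ENNReal.ofReal ((A ^ 2) ^ (1 - b) * D ^ b) *
          ENNReal.ofReal (|t - s| ^ (-(σ * b)))) *
          ((C : ℝ≥0∞) ^ (1 / 2 : ℝ) * E.interpENorm b (E.ι₀ x)) * E.interpENorm b (E.ι₀ y) := by
          gcongr
      _ = _ := by ring
  · refine (hL.enorm_inner_energy_le t s _ y).trans ?_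
    rw [mul_comm (ENNReal.ofReal ε)]
    gcongr
    rw [← ofReal_norm]
    exact ENNReal.ofReal_le_ofReal hrem

variable [CompleteSpace H] [NormedSpace ℝ H]

/-- The homogeneous Strichartz estimate in dual form, away from the endpoint, by the `T T^*`
argument and the Hardy–Littlewood–Sobolev inequality. -/
lemma exists_strichartz_of_lt (hL : E.IsDispersive σ A D L) (hσ : 0 < σ) {b : ℝ}
    (hb : b ∈ Icc (0 : ℝ) 1) (hσb : σ * b < 1) :
    ∃ C : ℝ≥0, ∀ (W : Set ℝ) (F : SimpleFunc ℝ B₀), volume W ≠ ∞ →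
      (∀ s, E.interpENorm b (E.ι₀ (F s)) ≠ ∞) →
      ‖∫ s in W, L s (F s)‖ₑ ≤
        C * (∫⁻ s in W, E.interpENorm b (E.ι₀ (F s)) ^ (2 / (2 - σ * b))) ^
          ((2 - σ * b) / 2) := by
  rcases hb.1.eq_or_lt with rfl | h0
  · refine ⟨Real.toNNReal A, fun W F hW _ => ?_⟩
    have hm : Measurable fun s => ‖F s‖ₑ := (F.map fun x => ‖x‖ₑ).measurable
    simp only [mul_zero, sub_zero, ne_eq, OfNat.ofNat_ne_zero, not_false_eq_true, div_self,
      ENNReal.rpow_one, interpENorm_at_zero, norm₀_ι₀]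
    change _ ≤ ENNReal.ofReal A * _
    rw [← lintegral_const_mul _ hm]
    exact (enorm_integral_le_lintegral_enorm _).trans (lintegral_mono fun s => hL.energy s _)
  obtain ⟨C, hC⟩ := hL.exists_enorm_inner_le hb
  obtain ⟨C', hC'⟩ := exists_hardyLittlewoodSobolev (mul_pos hσ h0) hσb
  refine ⟨(C * C') ^ (1 / 2 : ℝ), fun W F hW hF => ?_⟩
  set N : ℝ → ℝ≥0∞ := fun s => E.interpENorm b (E.ι₀ (F s)) with hN
  have hm : Measurable N := (F.map fun x => E.interpENorm b (E.ι₀ x)).measurable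
  have hint := hL.integrableOn_simpleFunc hW F
  have hsq : ‖∫ s in W, L s (F s)‖ₑ ^ 2 ≤
      C * C' * (∫⁻ s in W, N s ^ (2 / (2 - σ * b))) ^ (2 - σ * b) := by
    calc _ ≤ ∫⁻ t in W, ∫⁻ s in W, ‖inner 𝕜 (L t (F t)) (L s (F s))‖ₑ :=
          enorm_integral_sq_le hint
      _ ≤ ∫⁻ t in W, ∫⁻ s in W, C * (ENNReal.ofReal (|t - s| ^ (-(σ * b))) * (N t * N s)) := by
          refine lintegral_mono fun t => lintegral_mono_ae ?_
          filter_upwards [ae_restrict_of_ae (compl_mem_ae_iff.2 (measure_singleton t))] with s hs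
          refine (hC t s (fun h => hs h.symm) _ _ (hF s)).trans (le_of_eq ?_)
          simp only [hN]
          ring
      _ = C * ∫⁻ t in W, ∫⁻ s in W, ENNReal.ofReal (|t - s| ^ (-(σ * b))) * (N t * N s) := by
          rw [← lintegral_const_mul' _ _ ENNReal.coe_ne_top]
          refine lintegral_congr fun t => ?_
          rw [lintegral_const_mul' _ _ ENNReal.coe_ne_top]
      _ ≤ _ := by
          rw [mul_assoc]
          gcongr
          exact hC' W N hm hF
  have h2 := ENNReal.rpow_le_rpow hsq (z := 1 / 2) (by norm_num)
  rw [← ENNReal.rpow_two, ← ENNReal.rpow_mul, ENNReal.mul_rpow_of_nonneg _ _ (by norm_num),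
    ← ENNReal.rpow_mul, show (2 : ℝ) * (1 / 2) = 1 by norm_num, ENNReal.rpow_one, mul_one_div] at h2
  rw [ENNReal.coe_rpow_of_nonneg _ (by norm_num), ENNReal.coe_mul]
  exact h2

end IsDispersive

end BanachCouple

/-! ### The endpoint Strichartz estimate -/

lemma lintegral_Ici_ite_le {R : ℝ} (c : ℝ≥0∞) (φ : ℝ → ℝ≥0∞) :
    ∫⁻ τ in Ici 0, (if τ ≤ R then c else φ τ) ≤ c * ENNReal.ofReal R + ∫⁻ τ in Ioi R, φ τ := by
  have hsub : Ici (0 : ℝ) ⊆ Icc 0 R ∪ Ioi R := fun τ (hτ : 0 ≤ τ) =>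
    (le_or_gt τ R).imp (fun h => ⟨hτ, h⟩) id
  refine (lintegral_mono_set hsub).trans ((lintegral_union_le _ _ _).trans (add_le_add ?_ ?_))
  · calc _ ≤ ∫⁻ τ in Icc 0 R, c :=
          setLIntegral_mono' measurableSet_Icc fun τ hτ => by rw [if_pos hτ.2]
      _ = _ := by rw [setLIntegral_const, Real.volume_Icc, sub_zero]
  · exact setLIntegral_mono' measurableSet_Ioi fun τ hτ => by rw [if_neg (not_le.2 hτ)]

lemma lintegral_Ioi_mul_rpow_neg {R K σ : ℝ} (hR : 0 < R) (hK : 0 ≤ K) (hσ : 1 < σ) :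
    ∫⁻ τ in Ioi R, ENNReal.ofReal (K * τ ^ (-σ)) = ENNReal.ofReal (K * (R ^ (1 - σ) / (σ - 1))) := by
  simp_rw [ENNReal.ofReal_mul hK]
  rw [lintegral_const_mul _ (by fun_prop)]
  have := lintegral_Ioi_rpow hR (sub_pos.2 hσ)
  rw [show -(σ - 1) - 1 = -σ by ring, show -(σ - 1) = 1 - σ by ring] at this
  rw [this]

lemma lintegral_mul_sqrt_near_le {u v : ℝ → ℝ≥0∞} (hu : Measurable u) (hv : Measurable v)
    (W : Set ℝ) (R : ℝ) :
    ∫⁻ t in W, u t * (∫⁻ s in W, (if |t - s| ≤ R then 1 else 0) * v s ^ 2) ^ (1 / 2 : ℝ) ≤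
      ENNReal.ofReal (2 * R) ^ (1 / 2 : ℝ) *
        ((∫⁻ s in W, u s ^ 2) ^ (1 / 2 : ℝ) * (∫⁻ s in W, v s ^ 2) ^ (1 / 2 : ℝ)) := by
  set φ : ℝ → ℝ≥0∞ := fun τ => if τ ≤ R then 1 else 0 with hφ
  have hm : Measurable φ :=
    Measurable.ite (measurableSet_le (by fun_prop) (by fun_prop)) (by fun_prop) (by fun_prop)
  have hm' : Measurable fun z : ℝ × ℝ => φ |z.1 - z.2| * v z.2 ^ 2 := by fun_prop
  have hm3 : Measurable fun t => ∫⁻ s in W, φ |t - s| * v s ^ 2 := hm'.lintegral_prod_right'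
  have hφi : ∫⁻ τ in Ici 0, φ τ ≤ ENNReal.ofReal R := by
    simpa using lintegral_Ici_ite_le (R := R) 1 (fun _ => 0)
  change ∫⁻ t in W, u t * (∫⁻ s in W, φ |t - s| * v s ^ 2) ^ (1 / 2 : ℝ) ≤ _
  have h := ENNReal.lintegral_mul_le_Lp_mul_Lq (volume.restrict W) Real.HolderConjugate.two_two
    (f := u) (g := fun t => (∫⁻ s in W, φ |t - s| * v s ^ 2) ^ (1 / 2 : ℝ))
    hu.aemeasurable (hm3.pow_const _).aemeasurable
  simp only [Pi.mul_apply, ENNReal.rpow_two] at h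
  have h2 : ∫⁻ t in W, ((∫⁻ s in W, φ |t - s| * v s ^ 2) ^ (1 / 2 : ℝ)) ^ 2 ≤
      ENNReal.ofReal (2 * R) * ∫⁻ s in W, v s ^ 2 := by
    have h3 : ∀ x : ℝ≥0∞, (x ^ (1 / 2 : ℝ)) ^ 2 = x := fun x => by
      rw [← ENNReal.rpow_two, ← ENNReal.rpow_mul]; norm_num
    simp_rw [h3]
    refine (lintegral_lintegral_abs_sub_le hm (hv.pow_const 2) W).trans ?_
    rw [ENNReal.ofReal_mul two_pos.le, ENNReal.ofReal_ofNat]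
    gcongr
  refine (h.trans (mul_le_mul_right (ENNReal.rpow_le_rpow h2 (by norm_num)) _)).trans (le_of_eq ?_)
  rw [ENNReal.mul_rpow_of_nonneg _ _ (by norm_num)]
  ring

/-- A matrix with geometric decay away from the diagonal is bounded on `ℓ²`. -/
lemma exists_sum_geometric_le {r : ℝ} (h0 : 0 ≤ r) (h1 : r < 1) :
    ∃ C : ℝ≥0, ∀ (S : Finset ℤ) (a : ℤ → ℝ≥0∞),
      ∑ k ∈ S, ∑ l ∈ S, ENNReal.ofReal (r ^ (k - l).natAbs) * (a k * a l) ≤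
        C * ∑ k ∈ S, a k ^ 2 := by
  have hsum : Summable fun j : ℤ => r ^ j.natAbs := by
    refine Summable.of_nat_of_neg ?_ ?_ <;> simpa using summable_geometric_of_lt_one h0 h1
  have hT : ∑' j : ℤ, ENNReal.ofReal (r ^ j.natAbs) ≠ ∞ := by
    rw [← ENNReal.ofReal_tsum_of_nonneg (fun j => by positivity) hsum]
    exact ENNReal.ofReal_ne_top
  refine ⟨2 * (∑' j : ℤ, ENNReal.ofReal (r ^ j.natAbs)).toNNReal, fun S a => ?_⟩
  rw [ENNReal.coe_mul, ENNReal.coe_toNNReal hT]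
  set T := ∑' j : ℤ, ENNReal.ofReal (r ^ j.natAbs)
  have hrow : ∑ k ∈ S, ∑ l ∈ S, ENNReal.ofReal (r ^ (k - l).natAbs) * a k ^ 2 ≤
      T * ∑ k ∈ S, a k ^ 2 := by
    rw [Finset.mul_sum]
    refine Finset.sum_le_sum fun k _ => ?_
    rw [← Finset.sum_mul]
    gcongr
    refine (ENNReal.sum_le_tsum _).trans (le_of_eq ?_)
    exact (Equiv.subLeft k).tsum_eq fun j => ENNReal.ofReal (r ^ j.natAbs)
  have hcol : ∑ k ∈ S, ∑ l ∈ S, ENNReal.ofReal (r ^ (k - l).natAbs) * a l ^ 2 ≤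
      T * ∑ k ∈ S, a k ^ 2 := by
    rw [Finset.sum_comm]
    refine le_trans (le_of_eq ?_) hrow
    refine Finset.sum_congr rfl fun k _ => Finset.sum_congr rfl fun l _ => ?_
    rw [← Int.natAbs_neg, neg_sub]
  calc _ ≤ ∑ k ∈ S, ∑ l ∈ S, (ENNReal.ofReal (r ^ (k - l).natAbs) * a k ^ 2 +
        ENNReal.ofReal (r ^ (k - l).natAbs) * a l ^ 2) := by
        refine Finset.sum_le_sum fun k _ => Finset.sum_le_sum fun l _ => ?_
        rw [← mul_add]
        gcongr
        rcases le_total (a k) (a l) with h | h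
        · exact le_add_left (by rw [sq]; gcongr)
        · exact le_add_right (by rw [sq]; gcongr)
    _ ≤ T * ∑ k ∈ S, a k ^ 2 + T * ∑ k ∈ S, a k ^ 2 := by
        simp_rw [Finset.sum_add_distrib]
        exact add_le_add hrow hcol
    _ = _ := by rw [← two_mul, mul_assoc]; norm_num

namespace BanachCouple

variable {𝕜 H B₀ B₁ V : Type*} [RCLike 𝕜]
  [NormedAddCommGroup H] [InnerProductSpace 𝕜 H]
  [NormedAddCommGroup B₀] [NormedSpace 𝕜 B₀] [NormedAddCommGroup B₁] [NormedSpace 𝕜 B₁]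
  [AddCommGroup V] [Module 𝕜 V] [TopologicalSpace V]

/-- `E.IsAtom b ρ u F`: the function `F` lives at the scale `ρ`, with amplitude `u`; that is, the
norms of `F s` in `B₀` and `B₁` are at most `ρ ^ b u s` and `ρ ^ (b - 1) u s`. -/
def IsAtom (E : BanachCouple 𝕜 B₀ B₁ V) (b ρ : ℝ) (u : ℝ → ℝ≥0∞) (F : ℝ → B₀) : Prop :=
  ∀ s, ‖F s‖ₑ ≤ ENNReal.ofReal (ρ ^ b) * u s ∧
    E.norm₁ (E.ι₀ (F s)) ≤ ENNReal.ofReal (ρ ^ (b - 1)) * u s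

namespace IsDispersive

variable {E : BanachCouple 𝕜 B₀ B₁ V} {σ A D : ℝ} {L : ℝ → B₀ →L[𝕜] H}
  [CompleteSpace H] [NormedSpace ℝ H]

/-- At the endpoint exponent, functions living at a single scale satisfy the Strichartz
estimate, because the kernel of `T T^*` is integrable. -/
lemma exists_enorm_integral_atom_le (hL : E.IsDispersive σ A D L) (hσ : 1 < σ) {b : ℝ}
    (hσb : σ * b = 1) :
    ∃ C : ℝ≥0, ∀ (W : Set ℝ) (ρ : ℝ) (v : ℝ → ℝ≥0∞) (F : SimpleFunc ℝ B₀), volume W ≠ ∞ → 0 < ρ →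
      Measurable v → E.IsAtom b ρ v F →
      ‖∫ s in W, L s (F s)‖ₑ ≤ C * (∫⁻ s in W, v s ^ 2) ^ (1 / 2 : ℝ) := by
  have hA := hL.A_pos
  have hD := hL.D_pos
  have hσ1 : 0 < σ - 1 := by linarith
  refine ⟨Real.toNNReal (2 * (A ^ 2 + D / (σ - 1))) ^ (1 / 2 : ℝ), fun W ρ v F hW hρ hv hF => ?_⟩
  set φ : ℝ → ℝ≥0∞ := fun τ => if τ ≤ ρ ^ (-(2 * b)) then ENNReal.ofReal (A ^ 2 * ρ ^ (2 * b))
    else ENNReal.ofReal (D * ρ ^ (2 * (b - 1)) * τ ^ (-σ)) with hφ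
  have hφm : Measurable φ :=
    Measurable.ite (measurableSet_le (by fun_prop) (by fun_prop)) (by fun_prop) (by fun_prop)
  have hφi : ∫⁻ τ in Ici 0, φ τ ≤ ENNReal.ofReal (A ^ 2 + D / (σ - 1)) := by
    refine (lintegral_Ici_ite_le _ _).trans ?_
    rw [lintegral_Ioi_mul_rpow_neg (by positivity) (by positivity) hσ,
      ← ENNReal.ofReal_mul (by positivity), ← ENNReal.ofReal_add (by positivity) (by positivity)]
    apply le_of_eq
    congr 2
    · rw [mul_assoc, ← Real.rpow_add hρ, add_neg_cancel, Real.rpow_zero, mul_one]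
    · rw [← Real.rpow_mul hρ.le, mul_div_assoc', mul_assoc, ← Real.rpow_add hρ,
        show 2 * (b - 1) + -(2 * b) * (1 - σ) = 0 by linear_combination 2 * hσb,
        Real.rpow_zero, mul_one]
  have hpt : ∀ t s, ‖inner 𝕜 (L t (F t)) (L s (F s))‖ₑ ≤ φ |t - s| * (v t * v s) := by
    intro t s
    simp only [hφ]
    split_ifs with h
    · refine (hL.enorm_inner_energy_le t s _ _).trans ?_
      calc _ ≤ ENNReal.ofReal (A ^ 2) * (ENNReal.ofReal (ρ ^ b) * v t) *
            (ENNReal.ofReal (ρ ^ b) * v s) := by gcongr; exacts [(hF t).1, (hF s).1]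
        _ = _ := by
            rw [two_mul b, Real.rpow_add hρ, ENNReal.ofReal_mul (by positivity),
              ENNReal.ofReal_mul (by positivity)]
            ring
    · have hts : t ≠ s := by
        rintro rfl
        exact h (by simp only [sub_self, abs_zero]; positivity)
      refine (hL.dispersion t s hts _ _).trans ?_
      calc _ ≤ ENNReal.ofReal (D * |t - s| ^ (-σ)) * (ENNReal.ofReal (ρ ^ (b - 1)) * v t) *
            (ENNReal.ofReal (ρ ^ (b - 1)) * v s) := by gcongr; exacts [(hF t).2, (hF s).2]
        _ = _ := by
            rw [two_mul (b - 1), Real.rpow_add hρ, ENNReal.ofReal_mul hD.le,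
              ENNReal.ofReal_mul (by positivity), ENNReal.ofReal_mul hD.le,
              ENNReal.ofReal_mul (by positivity)]
            ring
  have hsq : ‖∫ s in W, L s (F s)‖ₑ ^ 2 ≤
      ENNReal.ofReal (2 * (A ^ 2 + D / (σ - 1))) * ∫⁻ s in W, v s ^ 2 := by
    refine (enorm_integral_sq_le (𝕜 := 𝕜) (hL.integrableOn_simpleFunc hW F)).trans
      ((lintegral_mono fun t => lintegral_mono fun s => hpt t s).trans
      ((lintegral_lintegral_convolution_le hφm hv hv W).trans ?_))
    rw [← ENNReal.rpow_add_of_nonneg _ _ (by norm_num) (by norm_num),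
      ENNReal.ofReal_mul two_pos.le, ENNReal.ofReal_ofNat]
    norm_num
    gcongr
  have h2 := ENNReal.rpow_le_rpow hsq (z := 1 / 2) (by norm_num)
  rw [← ENNReal.rpow_two, ← ENNReal.rpow_mul, ENNReal.mul_rpow_of_nonneg _ _ (by norm_num),
    show (2 : ℝ) * (1 / 2) = 1 by norm_num, ENNReal.rpow_one] at h2
  rw [ENNReal.coe_rpow_of_nonneg _ (by norm_num)]
  exact h2

/-- Almost orthogonality at the endpoint: the integrals of functions living at the scales `ρ ≤ ρ'`
are almost orthogonal. Times `t`, `s` with `|t - s| > R` are handled by the dispersive bound. For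
`|t - s| ≤ R`, the function at the smaller scale `ρ` is estimated by the energy bound alone, which
is a gain on intervals that are short compared with its natural time `ρ ^ (-2b)`. The choice of
`R` balances the two. -/
lemma exists_enorm_inner_atom_le (hL : E.IsDispersive σ A D L) (hσ : 1 < σ) {b : ℝ}
    (hσb : σ * b = 1) :
    ∃ C : ℝ≥0, ∀ (W : Set ℝ) (ρ ρ' : ℝ) (u v : ℝ → ℝ≥0∞) (F G : SimpleFunc ℝ B₀), MeasurableSet W →
      volume W ≠ ∞ → 0 < ρ → ρ ≤ ρ' → Measurable u → Measurable v →
      E.IsAtom b ρ u F → E.IsAtom b ρ' v G →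
      ‖inner 𝕜 (∫ t in W, L t (F t)) (∫ s in W, L s (G s))‖ₑ ≤
        C * ENNReal.ofReal ((ρ / ρ') ^ (min (b / 4) ((1 - b) / 2))) *
          ((∫⁻ s in W, u s ^ 2) ^ (1 / 2 : ℝ) * (∫⁻ s in W, v s ^ 2) ^ (1 / 2 : ℝ)) := by
  have hA := hL.A_pos
  have hD := hL.D_pos
  have hσ1 : 0 < σ - 1 := by linarith
  obtain ⟨C, hC⟩ := hL.exists_enorm_integral_atom_le hσ hσb
  refine ⟨2 * Real.toNNReal A * C + 2 * Real.toNNReal (D / (σ - 1)),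
    fun W ρ ρ' u v F G hWm hW hρ hρρ' hu hv hF hG => ?_⟩
  have hρ' : 0 < ρ' := hρ.trans_le hρρ'
  set ε := min (b / 4) ((1 - b) / 2) with hε
  set R : ℝ := (ρ * ρ') ^ (-b) * (ρ' / ρ) ^ (b / 2) with hR
  have hR0 : 0 < R := by positivity
  have hq1 : ρ / ρ' ≤ 1 := (div_le_one hρ').2 hρρ'
  have hq0 : 0 < ρ / ρ' := by positivity
  set I := (∫⁻ s in W, u s ^ 2) ^ (1 / 2 : ℝ)
  set J := (∫⁻ s in W, v s ^ 2) ^ (1 / 2 : ℝ)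
  have hFi := hL.integrableOn_simpleFunc hW F
  have hGi := hL.integrableOn_simpleFunc hW G
  let N : ℝ → Set ℝ := fun t => {s | |t - s| ≤ R}
  have hN : ∀ t, MeasurableSet (N t) := fun t => measurableSet_le (by fun_prop) (by fun_prop)
  have hpt : ∀ t, ‖inner 𝕜 (L t (F t)) (∫ s in W, L s (G s))‖ₑ ≤
      ENNReal.ofReal (A * ρ ^ b) * C * (u t * (∫⁻ s in W, (if |t - s| ≤ R then 1 else 0) * v s ^ 2) ^
        (1 / 2 : ℝ)) +
      ∫⁻ s in W, (if |t - s| ≤ R then 0 else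
        ENNReal.ofReal (D * (ρ * ρ') ^ (b - 1) * |t - s| ^ (-σ))) * (u t * v s) := by
    intro t
    have hsplit : ∫ s in W, L s (G s) =
        (∫ s in W ∩ N t, L s (G s)) + ∫ s in W \ N t, L s (G s) :=
      (integral_inter_add_sdiff (hN t) hGi).symm
    rw [hsplit, inner_add_right]
    refine (enorm_add_le _ _).trans (add_le_add ?_ ?_)
    · have hv' : ∫⁻ s in W ∩ N t, v s ^ 2 = ∫⁻ s in W, (if |t - s| ≤ R then 1 else 0) * v s ^ 2 := by
        rw [inter_comm, ← Measure.restrict_restrict (hN t), ← lintegral_indicator (hN t)]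
        refine lintegral_congr fun s => ?_
        by_cases h : |t - s| ≤ R
        · rw [indicator_of_mem (show s ∈ N t from h), if_pos h, one_mul]
        · rw [indicator_of_notMem (show s ∉ N t from h), if_neg h, zero_mul]
      refine (enorm_inner_le _ _).trans ?_
      have hW' : volume (W ∩ N t) ≠ ∞ := ne_top_of_le_ne_top hW (measure_mono inter_subset_left)
      calc _ ≤ (ENNReal.ofReal A * (ENNReal.ofReal (ρ ^ b) * u t)) *
            (C * (∫⁻ s in W ∩ N t, v s ^ 2) ^ (1 / 2 : ℝ)) := by
            gcongr
            · refine (hL.energy t _).trans ?_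
              gcongr
              exact (hF t).1
            · exact hC _ ρ' v G hW' hρ' hv hG
        _ = _ := by
            rw [hv', ENNReal.ofReal_mul hA.le]
            ring
    · refine (enorm_inner_integral_le (hGi.mono_set sdiff_subset) _).trans ?_
      have hle : ∀ s, s ∉ N t → ‖inner 𝕜 (L t (F t)) (L s (G s))‖ₑ ≤
          (if |t - s| ≤ R then 0 else
            ENNReal.ofReal (D * (ρ * ρ') ^ (b - 1) * |t - s| ^ (-σ))) * (u t * v s) := by
        intro s hs
        have hs' : ¬ |t - s| ≤ R := hs
        have hts : t ≠ s := by
          rintro rfl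
          exact hs' (by simp [hR0.le])
        rw [if_neg hs']
        refine (hL.dispersion t s hts _ _).trans ?_
        calc _ ≤ ENNReal.ofReal (D * |t - s| ^ (-σ)) * (ENNReal.ofReal (ρ ^ (b - 1)) * u t) *
              (ENNReal.ofReal (ρ' ^ (b - 1)) * v s) := by gcongr; exacts [(hF t).2, (hG s).2]
          _ = _ := by
              rw [Real.mul_rpow hρ.le hρ'.le, ENNReal.ofReal_mul hD.le,
                ENNReal.ofReal_mul (by positivity), ENNReal.ofReal_mul hD.le,
                ENNReal.ofReal_mul (by positivity)]
              ring
      exact (setLIntegral_mono' (hWm.diff (hN t)) fun s hs => hle s hs.2).trans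
        (lintegral_mono_set sdiff_subset)
  have hm1 : Measurable fun τ : ℝ => if τ ≤ R then (1 : ℝ≥0∞) else 0 :=
    Measurable.ite (measurableSet_le (by fun_prop) (by fun_prop)) (by fun_prop) (by fun_prop)
  have hm2 : Measurable fun τ : ℝ => if τ ≤ R then (0 : ℝ≥0∞) else
      ENNReal.ofReal (D * (ρ * ρ') ^ (b - 1) * τ ^ (-σ)) :=
    Measurable.ite (measurableSet_le (by fun_prop) (by fun_prop)) (by fun_prop) (by fun_prop)
  have hm1' : Measurable fun z : ℝ × ℝ => (if |z.1 - z.2| ≤ R then (1 : ℝ≥0∞) else 0) * v z.2 ^ 2 :=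
    (hm1.comp (by fun_prop : Measurable fun z : ℝ × ℝ => |z.1 - z.2|)).mul (by fun_prop)
  have hm3 : Measurable fun t => ∫⁻ s in W, (if |t - s| ≤ R then 1 else 0) * v s ^ 2 :=
    hm1'.lintegral_prod_right'
  have hnear := lintegral_mul_sqrt_near_le hu hv W R
  -- the contribution of distant times
  have hfar : ∫⁻ t in W, ∫⁻ s in W, (if |t - s| ≤ R then 0 else
      ENNReal.ofReal (D * (ρ * ρ') ^ (b - 1) * |t - s| ^ (-σ))) * (u t * v s) ≤
      2 * ENNReal.ofReal (D * (ρ * ρ') ^ (b - 1) * (R ^ (1 - σ) / (σ - 1))) * (I * J) := by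
    refine (lintegral_lintegral_convolution_le hm2 hu hv W).trans ?_
    gcongr
    refine (lintegral_Ici_ite_le _ _).trans ?_
    rw [zero_mul, zero_add, lintegral_Ioi_mul_rpow_neg hR0 (by positivity) hσ]
  obtain ⟨x, hx⟩ : ∃ x, Real.exp x = ρ := ⟨_, Real.exp_log hρ⟩
  obtain ⟨y, hy⟩ : ∃ y, Real.exp y = ρ' := ⟨_, Real.exp_log hρ'⟩
  have e1 : ρ ^ b * R ^ (1 / 2 : ℝ) = (ρ / ρ') ^ (b / 4) := by
    rw [hR, ← hx, ← hy]
    simp only [← Real.exp_add, ← Real.exp_sub, ← Real.exp_mul]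
    congr 1
    ring
  have e2 : (ρ * ρ') ^ (b - 1) * R ^ (1 - σ) = (ρ / ρ') ^ ((1 - b) / 2) := by
    rw [hR, ← hx, ← hy]
    simp only [← Real.exp_add, ← Real.exp_sub, ← Real.exp_mul]
    congr 1
    linear_combination (x + y - (y - x) / 2) * hσb
  have hε1 : (ρ / ρ') ^ (b / 4) ≤ (ρ / ρ') ^ ε :=
    Real.rpow_le_rpow_of_exponent_ge hq0 hq1 (min_le_left _ _)
  have hε2 : (ρ / ρ') ^ ((1 - b) / 2) ≤ (ρ / ρ') ^ ε :=
    Real.rpow_le_rpow_of_exponent_ge hq0 hq1 (min_le_right _ _)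
  calc _ ≤ ∫⁻ t in W, ‖inner 𝕜 (L t (F t)) (∫ s in W, L s (G s))‖ₑ :=
        enorm_inner_integral_le' hFi _
    _ ≤ _ := lintegral_mono hpt
    _ = ENNReal.ofReal (A * ρ ^ b) * C * (∫⁻ t in W, u t *
          (∫⁻ s in W, (if |t - s| ≤ R then 1 else 0) * v s ^ 2) ^ (1 / 2 : ℝ)) +
        ∫⁻ t in W, ∫⁻ s in W, (if |t - s| ≤ R then 0 else
          ENNReal.ofReal (D * (ρ * ρ') ^ (b - 1) * |t - s| ^ (-σ))) * (u t * v s) := by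
        rw [lintegral_add_left (by fun_prop), lintegral_const_mul _ (by fun_prop)]
    _ ≤ ENNReal.ofReal (A * ρ ^ b) * C * (ENNReal.ofReal (2 * R) ^ (1 / 2 : ℝ) * (I * J)) +
        2 * ENNReal.ofReal (D * (ρ * ρ') ^ (b - 1) * (R ^ (1 - σ) / (σ - 1))) * (I * J) := by
        gcongr
    _ = (C * ENNReal.ofReal (A * (2 ^ (1 / 2 : ℝ) * (ρ / ρ') ^ (b / 4))) +
        2 * ENNReal.ofReal (D / (σ - 1) * (ρ / ρ') ^ ((1 - b) / 2))) * (I * J) := by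
        rw [← e1, ← e2, ENNReal.ofReal_rpow_of_nonneg (by positivity) (by norm_num),
          Real.mul_rpow two_pos.le hR0.le,
          show A * (2 ^ (1 / 2 : ℝ) * (ρ ^ b * R ^ (1 / 2 : ℝ))) =
            (A * ρ ^ b) * (2 ^ (1 / 2 : ℝ) * R ^ (1 / 2 : ℝ)) by ring,
          ENNReal.ofReal_mul (p := A * ρ ^ b) (by positivity),
          show D / (σ - 1) * ((ρ * ρ') ^ (b - 1) * R ^ (1 - σ)) =
            D * (ρ * ρ') ^ (b - 1) * (R ^ (1 - σ) / (σ - 1)) by ring]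
        ring
    _ ≤ (C * ENNReal.ofReal (A * (2 * (ρ / ρ') ^ ε)) +
        2 * ENNReal.ofReal (D / (σ - 1) * (ρ / ρ') ^ ε)) * (I * J) := by
        have : (2 : ℝ) ^ (1 / 2 : ℝ) ≤ 2 := by
          conv_rhs => rw [← Real.rpow_one 2]
          exact Real.rpow_le_rpow_of_exponent_le one_le_two (by norm_num)
        gcongr
    _ = _ := by
        rw [ENNReal.ofReal_mul hA.le, ENNReal.ofReal_mul two_pos.le, ENNReal.ofReal_ofNat,
          ENNReal.ofReal_mul (by positivity)]
        push_cast
        simp only [ENNReal.ofReal]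
        ring

end IsDispersive

end BanachCouple

namespace BanachCouple

variable {𝕜 H B₀ B₁ V : Type*} [RCLike 𝕜]
  [NormedAddCommGroup H] [InnerProductSpace 𝕜 H]
  [NormedAddCommGroup B₀] [NormedSpace 𝕜 B₀] [NormedAddCommGroup B₁] [NormedSpace 𝕜 B₁]
  [AddCommGroup V] [Module 𝕜 V] [TopologicalSpace V] [IsTopologicalAddGroup V] [T2Space V]

/-- The values of a simple function can be decomposed simultaneously, with a starting point `a` of
the geometric progression that depends on the value. -/
lemma exists_simpleFunc_decomposition (E : BanachCouple 𝕜 B₀ B₁ V) {θ b : ℝ} (h0 : 0 < θ)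
    (h1 : θ < 1) (hb : b ∈ Icc (0 : ℝ) 1) :
    ∃ C : ℝ≥0, ∀ (F : SimpleFunc ℝ B₀) (a : B₀ → ℝ) (ε : ℝ), (∀ x, 0 < a x) → 0 < ε →
      (∀ s, E.interpENorm (θ + (1 - θ) * b) (E.ι₀ (F s)) ≠ ∞) →
      ∃ (S : Finset ℤ) (G : ℤ → SimpleFunc ℝ B₀) (u : ℤ → SimpleFunc ℝ ℝ≥0∞),
        (∀ k s, E.interpENorm b (E.ι₀ (G k s)) ≤ ENNReal.ofReal ((a (F s) * 2 ^ k) ^ θ) * u k s ∧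
          E.norm₁ (E.ι₀ (G k s)) ≤ ENNReal.ofReal ((a (F s) * 2 ^ k) ^ (θ - 1)) * u k s) ∧
        (∀ s, ∑ k ∈ S, u k s ^ 2 ≤ C * E.interpENorm (θ + (1 - θ) * b) (E.ι₀ (F s)) ^ 2) ∧
        ∀ s, ‖F s - ∑ k ∈ S, G k s‖ ≤ ε := by
  obtain ⟨C, hC⟩ := E.exists_balanced_decomposition h0 h1 hb
  refine ⟨C, fun F a ε ha hε hF => ?_⟩
  have h : ∀ x : B₀, ∃ (S : Finset ℤ) (y : ℤ → B₀) (c : ℤ → ℝ≥0∞),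
      E.interpENorm (θ + (1 - θ) * b) (E.ι₀ x) ≠ ∞ →
        (∀ k ∉ S, y k = 0 ∧ c k = 0) ∧
        (∀ k, E.interpENorm b (E.ι₀ (y k)) ≤ ENNReal.ofReal ((a x * 2 ^ k) ^ θ) * c k ∧
          E.norm₁ (E.ι₀ (y k)) ≤ ENNReal.ofReal ((a x * 2 ^ k) ^ (θ - 1)) * c k) ∧
        ∑ k ∈ S, c k ^ 2 ≤ C * E.interpENorm (θ + (1 - θ) * b) (E.ι₀ x) ^ 2 ∧
        ‖x - ∑ k ∈ S, y k‖ ≤ ε := by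
    intro x
    by_cases hx : E.interpENorm (θ + (1 - θ) * b) (E.ι₀ x) = ∞
    · exact ⟨∅, 0, 0, fun h => absurd hx h⟩
    · obtain ⟨S, y, c, h⟩ := hC (a x) ε x (ha x) hε hx
      exact ⟨S, y, c, fun _ => h⟩
  choose S y c h using h
  have hsub : ∀ s, S (F s) ⊆ F.range.biUnion S := fun s =>
    Finset.subset_biUnion_of_mem S (SimpleFunc.mem_range_self F s)
  refine ⟨F.range.biUnion S, fun k => F.map fun x => y x k, fun k => F.map fun x => c x k,
    fun k s => ?_, fun s => ?_, fun s => ?_⟩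
  · exact (h (F s) (hF s)).2.1 k
  · simp only [SimpleFunc.map_apply]
    rw [← Finset.sum_subset (hsub s) fun k _ hk => by simp [((h (F s) (hF s)).1 k hk).2]]
    exact (h (F s) (hF s)).2.2.1
  · simp only [SimpleFunc.map_apply]
    rw [← Finset.sum_subset (hsub s) fun k _ hk => ((h (F s) (hF s)).1 k hk).1]
    exact (h (F s) (hF s)).2.2.2

namespace IsDispersive

variable {E : BanachCouple 𝕜 B₀ B₁ V} {σ A D : ℝ} {L : ℝ → B₀ →L[𝕜] H}
  [CompleteSpace H] [NormedSpace ℝ H]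

/-- The dual homogeneous Strichartz estimate at the endpoint: the values of the function are
decomposed into atoms, whose contributions at different scales are almost orthogonal. -/
lemma exists_strichartz_endpoint (hL : E.IsDispersive σ A D L) (hσ : 1 < σ) {b : ℝ}
    (hb : 0 < b) (hb1 : b < 1) (hσb : σ * b = 1) :
    ∃ C : ℝ≥0, ∀ (W : Set ℝ) (F : SimpleFunc ℝ B₀), MeasurableSet W → volume W ≠ ∞ →
      (∀ s, E.interpENorm b (E.ι₀ (F s)) ≠ ∞) →
      ‖∫ s in W, L s (F s)‖ₑ ≤
        C * (∫⁻ s in W, E.interpENorm b (E.ι₀ (F s)) ^ 2) ^ (1 / 2 : ℝ) := by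
  obtain ⟨C₁, hC₁⟩ := E.exists_simpleFunc_decomposition (b := 0) hb hb1 (by simp)
  simp only [mul_zero, add_zero, interpENorm_at_zero, norm₀_ι₀] at hC₁
  obtain ⟨C₂, hC₂⟩ := hL.exists_enorm_inner_atom_le hσ hσb
  set δ := min (b / 4) ((1 - b) / 2) with hδ
  have hδ0 : 0 < δ := lt_min (by linarith) (by linarith)
  obtain ⟨C₃, hC₃⟩ := exists_sum_geometric_le (r := 2 ^ (-δ)) (by positivity)
    (Real.rpow_lt_one_of_one_lt_of_neg one_lt_two (by linarith))
  refine ⟨(C₂ * C₃ * C₁) ^ (1 / 2 : ℝ), fun W F hWm hW hF => ?_⟩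
  refine ENNReal.le_of_forall_add_ofReal_mul (Z := ENNReal.ofReal A * volume W) (by finiteness)
    fun ε hε => ?_
  obtain ⟨S, G, u, hGu, hsum, hrem⟩ := hC₁ F (fun _ => 1) ε (fun _ => one_pos) hε hF
  simp only [one_mul] at hGu
  have hatom : ∀ k, E.IsAtom b (2 ^ k) (u k) (G k) := fun k s => hGu k s
  have hGi : ∀ k, IntegrableOn (fun s => L s (G k s)) W := fun k =>
    hL.integrableOn_simpleFunc hW (G k)
  have hFi := hL.integrableOn_simpleFunc hW F
  set v : ℤ → H := fun k => ∫ s in W, L s (G k s) with hv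
  set a : ℤ → ℝ≥0∞ := fun k => (∫⁻ s in W, u k s ^ 2) ^ (1 / 2 : ℝ) with ha
  have hinner : ∀ k l, ‖inner 𝕜 (v k) (v l)‖ₑ ≤
      C₂ * (ENNReal.ofReal ((2 ^ (-δ)) ^ (k - l).natAbs) * (a k * a l)) := by
    have hkl : ∀ k l, k ≤ l → ‖inner 𝕜 (v k) (v l)‖ₑ ≤
        C₂ * (ENNReal.ofReal ((2 ^ (-δ)) ^ (k - l).natAbs) * (a k * a l)) := by
      intro k l hkl
      refine (hC₂ W (2 ^ k) (2 ^ l) (u k) (u l) (G k) (G l) hWm hW (by positivity)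
        (zpow_le_zpow_right₀ one_le_two hkl) (u k).measurable (u l).measurable (hatom k)
        (hatom l)).trans (le_of_eq ?_)
      rw [mul_assoc]
      congr 3
      rw [← zpow_sub₀ two_ne_zero, ← Real.rpow_intCast, ← Real.rpow_mul two_pos.le,
        ← Real.rpow_natCast, ← Real.rpow_mul two_pos.le]
      congr 1
      have : (((k - l).natAbs : ℤ) : ℝ) = -((k - l : ℤ) : ℝ) := by
        rw [Int.ofNat_natAbs_of_nonpos (by omega)]; push_cast; ring
      rw [Int.cast_natCast] at this
      rw [this]
      ring
    intro k l
    rcases le_total k l with h | h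
    · exact hkl k l h
    · rw [enorm_inner_symm, ← Int.natAbs_neg, neg_sub, mul_comm (a k)]
      exact hkl l k h
  have hmain : ‖∑ k ∈ S, v k‖ₑ ^ 2 ≤
      C₂ * C₃ * C₁ * ∫⁻ s in W, E.interpENorm b (E.ι₀ (F s)) ^ 2 := by
    have hN : Measurable fun s => E.interpENorm b (E.ι₀ (F s)) :=
      (F.map fun x => E.interpENorm b (E.ι₀ x)).measurable
    calc ‖∑ k ∈ S, v k‖ₑ ^ 2 = ‖∑ k ∈ S, ∑ l ∈ S, inner 𝕜 (v k) (v l)‖ₑ := by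
          rw [← enorm_inner_self (𝕜 := 𝕜), sum_inner]
          simp_rw [inner_sum]
      _ ≤ ∑ k ∈ S, ∑ l ∈ S, C₂ * (ENNReal.ofReal ((2 ^ (-δ)) ^ (k - l).natAbs) * (a k * a l)) :=
          (enorm_sum_le _ _).trans (Finset.sum_le_sum fun k _ => (enorm_sum_le _ _).trans
            (Finset.sum_le_sum fun l _ => hinner k l))
      _ ≤ C₂ * (C₃ * ∑ k ∈ S, a k ^ 2) := by
          simp_rw [← Finset.mul_sum]
          gcongr
          exact hC₃ S a
      _ = C₂ * C₃ * ∫⁻ s in W, ∑ k ∈ S, u k s ^ 2 := by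
          rw [lintegral_finsetSum _ fun k _ => (u k).measurable.pow_const 2, mul_assoc]
          congr 3
          ext k
          simp only [ha]
          rw [← ENNReal.rpow_two, ← ENNReal.rpow_mul]
          norm_num
      _ ≤ C₂ * C₃ * ∫⁻ s in W, C₁ * E.interpENorm b (E.ι₀ (F s)) ^ 2 := by
          gcongr with s
          exact hsum s
      _ = _ := by rw [lintegral_const_mul _ (hN.pow_const 2)]; ring
  have h2 := ENNReal.rpow_le_rpow hmain (z := 1 / 2) (by norm_num)
  rw [← ENNReal.rpow_two, ← ENNReal.rpow_mul, ENNReal.mul_rpow_of_nonneg _ _ (by norm_num),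
    show (2 : ℝ) * (1 / 2) = 1 by norm_num, ENNReal.rpow_one] at h2
  have hsplit : ∫ s in W, L s (F s) =
      ∑ k ∈ S, v k + ∫ s in W, L s (F s - ∑ k ∈ S, G k s) := by
    simp only [hv]
    rw [← integral_finsetSum _ fun k _ => hGi k, ← integral_add]
    · refine integral_congr_ae (ae_of_all _ fun s => ?_)
      simp [map_sub, map_sum]
    · exact integrable_finsetSum _ fun k _ => hGi k
    · simp only [map_sub, map_sum]
      exact hFi.sub (integrable_finsetSum _ fun k _ => hGi k)
  rw [hsplit]
  refine (enorm_add_le _ _).trans (add_le_add ?_ ?_)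
  · rw [ENNReal.coe_rpow_of_nonneg _ (by norm_num), ENNReal.coe_mul, ENNReal.coe_mul]
    exact h2
  · calc _ ≤ ∫⁻ s in W, ENNReal.ofReal A * ENNReal.ofReal ε := by
          refine (enorm_integral_le_lintegral_enorm _).trans (lintegral_mono fun s => ?_)
          refine (hL.energy s _).trans ?_
          gcongr
          rw [← ofReal_norm]
          exact ENNReal.ofReal_le_ofReal (hrem s)
      _ = _ := by rw [setLIntegral_const]; ring

/-- The homogeneous Strichartz estimate in dual form, including the endpoint when `σ > 1`. -/
theorem exists_strichartz (hL : E.IsDispersive σ A D L) (hσ : 0 < σ) {b : ℝ}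
    (hb : b ∈ Icc (0 : ℝ) 1) (hσb : σ * b < 1 ∨ (1 < σ ∧ σ * b = 1)) :
    ∃ C : ℝ≥0, ∀ (W : Set ℝ) (F : SimpleFunc ℝ B₀), MeasurableSet W → volume W ≠ ∞ →
      (∀ s, E.interpENorm b (E.ι₀ (F s)) ≠ ∞) →
      ‖∫ s in W, L s (F s)‖ₑ ≤
        C * (∫⁻ s in W, E.interpENorm b (E.ι₀ (F s)) ^ (2 / (2 - σ * b))) ^
          ((2 - σ * b) / 2) := by
  rcases hσb with h | ⟨h, h'⟩
  · obtain ⟨C, hC⟩ := hL.exists_strichartz_of_lt hσ hb h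
    exact ⟨C, fun W F _ => hC W F⟩
  · have hb0 : 0 < b := hb.1.lt_of_ne (by rintro rfl; simp at h')
    have hb1 : b < 1 := by nlinarith
    obtain ⟨C, hC⟩ := hL.exists_strichartz_endpoint h hb0 hb1 h'
    refine ⟨C, fun W F hWm hW hF => (hC W F hWm hW hF).trans (le_of_eq ?_)⟩
    rw [h']
    norm_num

end IsDispersive

end BanachCouple

/-! ### The estimate at a positive distance from the diagonal -/

/-- Hölder's inequality for a weight `w` of total mass at most one. It allows the time exponents of
the two endpoint estimates to be replaced by `2`. -/
lemma lintegral_mul_rpow_le_of_lintegral_le_one {α : Type*} [MeasurableSpace α] {μ : Measure α}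
    {w d : α → ℝ≥0∞} (hw : Measurable w) (hd : Measurable d) (hw1 : ∫⁻ s, w s ∂μ ≤ 1) {a : ℝ}
    (ha : 0 ≤ a) (ha2 : a ≤ 2) :
    ∫⁻ s, w s * d s ^ a ∂μ ≤ (∫⁻ s, w s * d s ^ 2 ∂μ) ^ (a / 2) := by
  have h := ENNReal.lintegral_mul_norm_pow_le (μ := μ) (f := fun s => w s * d s ^ 2) (g := w)
    (by fun_prop) (by fun_prop) (p := a / 2) (q := 1 - a / 2) (by linarith) (by linarith) (by ring)
  calc ∫⁻ s, w s * d s ^ a ∂μ = ∫⁻ s, (w s * d s ^ 2) ^ (a / 2) * w s ^ (1 - a / 2) ∂μ := by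
        refine lintegral_congr fun s => ?_
        rw [ENNReal.mul_rpow_of_nonneg _ _ (by linarith), ← ENNReal.rpow_two, ← ENNReal.rpow_mul,
          mul_right_comm, ← ENNReal.rpow_add_of_nonneg _ _ (by linarith) (by linarith)]
        ring_nf
        rw [ENNReal.rpow_one, mul_comm]
    _ ≤ _ := h
    _ ≤ (∫⁻ s, w s * d s ^ 2 ∂μ) ^ (a / 2) * 1 := by
        gcongr
        exact ENNReal.rpow_le_one hw1 (by linarith)
    _ = _ := mul_one _

namespace BanachCouple

variable {𝕜 H B₀ B₁ V : Type*} [RCLike 𝕜]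
  [NormedAddCommGroup H] [InnerProductSpace 𝕜 H]
  [NormedAddCommGroup B₀] [NormedSpace 𝕜 B₀] [NormedAddCommGroup B₁] [NormedSpace 𝕜 B₁]
  [AddCommGroup V] [Module 𝕜 V] [TopologicalSpace V]

namespace IsDispersive

variable {E : BanachCouple 𝕜 B₀ B₁ V} {σ A D : ℝ} {L : ℝ → B₀ →L[𝕜] H}
  [CompleteSpace H] [NormedSpace ℝ H]

/-- The dispersive bound for a function supported at distance `δ` from `t`. -/
lemma enorm_inner_integral_le_dispersion (hL : E.IsDispersive σ A D L) (hσ : 0 < σ) {t δ : ℝ}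
    (hδ : 0 < δ) {W : Set ℝ} (hWm : MeasurableSet W) (hW : volume W ≠ ∞) (hWt : W ⊆ Iic (t - δ))
    (F : SimpleFunc ℝ B₀) (g : B₀) :
    ‖inner 𝕜 (L t g) (∫ s in W, L s (F s))‖ₑ ≤
      ENNReal.ofReal (D * δ ^ (-σ)) * E.norm₁ (E.ι₀ g) * ∫⁻ s in W, E.norm₁ (E.ι₀ (F s)) := by
  have hm : Measurable fun s => E.norm₁ (E.ι₀ (F s)) := (F.map fun x => E.norm₁ (E.ι₀ x)).measurable
  rw [← lintegral_const_mul _ hm]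
  refine (enorm_inner_integral_le (hL.integrableOn_simpleFunc hW F) _).trans
    (setLIntegral_mono' hWm fun s hs => ?_)
  have hs' : δ ≤ t - s := by have : s ≤ t - δ := hWt hs; linarith
  refine (hL.dispersion t s (by rintro rfl; linarith) _ _).trans ?_
  gcongr ENNReal.ofReal (D * ?_) * _ * _
  · exact hL.D_pos.le
  · rw [abs_of_pos (hδ.trans_le hs')]
    exact Real.rpow_le_rpow_of_nonpos hδ hs' (by linarith)

variable [IsTopologicalAddGroup V] [T2Space V]

/-- Bilinear interpolation between the Strichartz estimate, with `F` in `L^{1/ν} B_b` and `g` in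
`B₀`, and the dispersive estimate, with `F` in `L¹ B₁` and `g` in `B₁`. The point at which the
values of `F` are decomposed depends on their norm, in such a way that each term of the
decomposition has the same weight in the two spaces. Both time exponents are at most `2`, which is
why the second exponent `2` of the real interpolation spaces suffices. -/
lemma exists_enorm_inner_integral_le_of_le_one (hL : E.IsDispersive σ A D L) (hσ : 0 < σ)
    {θ b : ℝ} (h0 : 0 < θ) (h1 : θ < 1) (hb : b ∈ Icc (0 : ℝ) 1)
    (hσb : σ * b < 1 ∨ (1 < σ ∧ σ * b = 1)) :
    ∃ C : ℝ≥0, ∀ (t δ : ℝ) (W : Set ℝ) (F : SimpleFunc ℝ B₀) (g : B₀), 0 < δ → MeasurableSet W →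
      volume W ≠ ∞ → W ⊆ Iic (t - δ) →
      (∀ s, E.interpENorm (θ + (1 - θ) * b) (E.ι₀ (F s)) ≠ ∞) →
      ∫⁻ s in W, E.interpENorm (θ + (1 - θ) * b) (E.ι₀ (F s)) ^
        (1 / ((1 - θ) * ((2 - σ * b) / 2) + θ)) ≤ 1 →
      ‖inner 𝕜 (L t g) (∫ s in W, L s (F s))‖ₑ ≤
        C * ENNReal.ofReal (δ ^ (-(σ * θ))) * E.interpENorm θ (E.ι₀ g) := by
  set ν : ℝ := (2 - σ * b) / 2 with hν
  set κ : ℝ := (1 - θ) * ν + θ with hκ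
  set r : ℝ := 1 / κ with hr
  have hσb1 : σ * b ≤ 1 := hσb.elim le_of_lt fun h => h.2.le
  have hσb0 : 0 ≤ σ * b := mul_nonneg hσ.le hb.1
  have hν2 : 1 / 2 ≤ ν := by rw [hν]; linarith
  have hν0 : 0 < ν := by linarith
  have hκ0 : 0 < κ := by have : 0 < 1 - θ := by linarith
                         positivity
  have hr0 : 0 < r := by positivity
  have hrκ : r * κ = 1 := by rw [hr]; field_simp
  obtain ⟨C₁, hC₁⟩ := hL.exists_strichartz hσ hb hσb
  obtain ⟨C₂, hC₂⟩ := E.exists_simpleFunc_decomposition h0 h1 hb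
  obtain ⟨C₃, hC₃⟩ := E.exists_sum_functional_le h0 h1
  have hA := hL.A_pos
  have hD := hL.D_pos
  refine ⟨C₃ * Real.toNNReal ((A * (C₁ + 1)) ^ (1 - θ) * D ^ θ) * C₂ ^ (1 / 2 : ℝ),
    fun t δ W F g hδ hWm hW hWt hF hΦ => ?_⟩
  refine ENNReal.le_of_forall_add_ofReal_mul
    (Z := ENNReal.ofReal (A ^ 2) * ‖g‖ₑ * volume W) (by finiteness) fun ε hε => ?_
  set N : B₀ → ℝ≥0∞ := fun x => E.interpENorm (θ + (1 - θ) * b) (E.ι₀ x) with hN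
  -- the starting point of the progression, chosen so that the two time exponents match
  set a : B₀ → ℝ := fun x => if N x = 0 then 1 else (N x).toReal ^ (r * (ν - 1)) with ha
  set φ : ℝ → ℝ≥0∞ := fun s => N (F s) with hφ
  have hφm : Measurable φ := (F.map N).measurable
  have hφt : ∀ s, φ s ≠ ∞ := hF
  obtain ⟨S, G, u, hGu, hsum, hrem⟩ : ∃ (S : Finset ℤ) (G : ℤ → SimpleFunc ℝ B₀)
      (u : ℤ → SimpleFunc ℝ ℝ≥0∞),
        (∀ k s, E.interpENorm b (E.ι₀ (G k s)) ≤ ENNReal.ofReal ((a (F s) * 2 ^ k) ^ θ) * u k s ∧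
          E.norm₁ (E.ι₀ (G k s)) ≤ ENNReal.ofReal ((a (F s) * 2 ^ k) ^ (θ - 1)) * u k s) ∧
        (∀ s, ∑ k ∈ S, u k s ^ 2 ≤ C₂ * φ s ^ 2) ∧
        ∀ s, ‖F s - ∑ k ∈ S, G k s‖ ≤ ε := by
    -- outside the range of `F` the value of `a` is irrelevant
    obtain ⟨S, G, u, h1, h2, h3⟩ := hC₂ F (fun x => max (a x) (if N x = ∞ then 1 else a x)) ε
      (fun x => by
        by_cases hx : N x = ∞
        · simp [hx]
        · refine lt_max_of_lt_left ?_
          simp only [ha]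
          split_ifs with h
          · exact one_pos
          · exact Real.rpow_pos_of_pos (ENNReal.toReal_pos h hx) _) hε hF
    refine ⟨S, G, u, fun k s => ?_, h2, h3⟩
    have hs : N (F s) ≠ ∞ := hF s
    simpa [if_neg hs] using h1 k s
  set d : ℤ → ℝ → ℝ≥0∞ := fun k s => u k s / φ s with hd
  have hdm : ∀ k, Measurable (d k) := fun k => (u k).measurable.div hφm
  have hφd : ∀ k (c : ℝ), Measurable fun s => φ s ^ r * d k s ^ c := fun k c =>
    (hφm.pow_const _).mul ((hdm k).pow_const _)
  have hφd2 : ∀ k, Measurable fun s => φ s ^ r * d k s ^ 2 := fun k =>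
    (hφm.pow_const _).mul ((hdm k).pow_const _)
  have hu2 : ∀ k ∈ S, ∀ s, u k s ^ 2 ≤ C₂ * φ s ^ 2 := fun k hk s =>
    (Finset.single_le_sum (f := fun k => u k s ^ 2) (fun _ _ => bot_le) hk).trans (hsum s)
  have hut : ∀ k ∈ S, ∀ s, u k s ≠ ∞ := fun k hk s h => by
    have := hu2 k hk s
    rw [h, ENNReal.top_pow two_ne_zero, top_le_iff] at this
    exact ENNReal.mul_ne_top ENNReal.coe_ne_top (ENNReal.pow_ne_top (hφt s)) this
  have hu0 : ∀ k ∈ S, ∀ s, φ s = 0 → u k s = 0 := fun k hk s h => by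
    have := hu2 k hk s
    rw [h] at this
    simpa using this
  -- the two pointwise bounds
  have hpow : ∀ k ∈ S, ∀ s (e : ℝ), ENNReal.ofReal ((a (F s) * 2 ^ k) ^ e) * u k s =
      ENNReal.ofReal ((2 ^ k) ^ e) * (φ s ^ (r * (ν - 1) * e + 1) * d k s) := by
    intro k hk s e
    by_cases hs : φ s = 0
    · have hz := hu0 k hk s hs
      simp [hd, hz]
    · have hsr : 0 < (φ s).toReal := ENNReal.toReal_pos hs (hφt s)
      have hau : a (F s) = (φ s).toReal ^ (r * (ν - 1)) := if_neg hs
      have hud : u k s = φ s * d k s := (ENNReal.mul_div_cancel hs (hφt s)).symm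
      rw [hau, hud, Real.mul_rpow (by positivity) (by positivity), ← Real.rpow_mul hsr.le,
        ENNReal.ofReal_mul (by positivity), ← ENNReal.ofReal_rpow_of_pos hsr,
        ENNReal.ofReal_toReal (hφt s), ENNReal.rpow_add _ _ hs (hφt s), ENNReal.rpow_one]
      ring
  have eθ : r * (ν - 1) * θ + 1 = r * ν := by
    have : r * (ν - 1) * θ + r * κ = r * ν := by rw [hκ]; ring
    rwa [hrκ] at this
  have eθ1 : r * (ν - 1) * (θ - 1) + 1 = r := by
    have : r * (ν - 1) * (θ - 1) + r * κ = r := by rw [hκ]; ring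
    rwa [hrκ] at this
  have hGb : ∀ k ∈ S, ∀ s, E.interpENorm b (E.ι₀ (G k s)) ≤
      ENNReal.ofReal ((2 ^ k) ^ θ) * (φ s ^ (r * ν) * d k s) := fun k hk s =>
    ((hGu k s).1.trans_eq (hpow k hk s θ)).trans_eq (by rw [eθ])
  have hG1 : ∀ k ∈ S, ∀ s, E.norm₁ (E.ι₀ (G k s)) ≤
      ENNReal.ofReal ((2 ^ k) ^ (θ - 1)) * (φ s ^ r * d k s) := fun k hk s =>
    ((hGu k s).2.trans_eq (hpow k hk s (θ - 1))).trans_eq (by rw [eθ1])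
  set e : ℤ → ℝ≥0∞ := fun k => (∫⁻ s in W, φ s ^ r * d k s ^ 2) ^ (1 / 2 : ℝ) with he
  have hGi : ∀ k, IntegrableOn (fun s => L s (G k s)) W := fun k =>
    hL.integrableOn_simpleFunc hW (G k)
  have hFi := hL.integrableOn_simpleFunc hW F
  have hl₀ : ∀ k ∈ S, ∀ g, ‖inner 𝕜 (L t g) (∫ s in W, L s (G k s))‖ₑ ≤
      ENNReal.ofReal (A * (C₁ + 1) * (2 ^ k) ^ θ) * e k * ‖g‖ₑ := by
    intro k hk g
    have hfin : ∀ s, E.interpENorm b (E.ι₀ (G k s)) ≠ ∞ := fun s =>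
      ne_top_of_le_ne_top (ENNReal.mul_ne_top ENNReal.ofReal_ne_top (hut k hk s)) (hGu k s).1
    have h2 : 2 / (2 - σ * b) = 1 / ν := by rw [hν, one_div_div]
    have hS := hC₁ W (G k) hWm hW hfin
    rw [h2] at hS
    have hint : (∫⁻ s in W, E.interpENorm b (E.ι₀ (G k s)) ^ (1 / ν)) ^ ν ≤
        ENNReal.ofReal ((2 ^ k) ^ θ) * e k := by
      have h3 : ∫⁻ s in W, E.interpENorm b (E.ι₀ (G k s)) ^ (1 / ν) ≤
          ENNReal.ofReal ((2 ^ k) ^ θ) ^ (1 / ν) *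
            (∫⁻ s in W, φ s ^ r * d k s ^ 2) ^ (1 / ν / 2) := by
        calc _ ≤ ∫⁻ s in W, ENNReal.ofReal ((2 ^ k) ^ θ) ^ (1 / ν) *
              (φ s ^ r * d k s ^ (1 / ν)) := by
              refine lintegral_mono fun s => ?_
              refine (ENNReal.rpow_le_rpow (hGb k hk s) (by positivity)).trans (le_of_eq ?_)
              rw [ENNReal.mul_rpow_of_nonneg _ _ (by positivity),
                ENNReal.mul_rpow_of_nonneg _ _ (by positivity), ← ENNReal.rpow_mul,
                mul_assoc r, mul_one_div_cancel hν0.ne', mul_one]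
          _ = ENNReal.ofReal ((2 ^ k) ^ θ) ^ (1 / ν) *
              ∫⁻ s in W, φ s ^ r * d k s ^ (1 / ν) := by
              rw [lintegral_const_mul _ (hφd k _)]
          _ ≤ _ := by
              gcongr
              refine lintegral_mul_rpow_le_of_lintegral_le_one (hφm.pow_const _) (hdm k) hΦ
                (by positivity) ?_
              rw [div_le_iff₀ hν0]
              linarith
      refine (ENNReal.rpow_le_rpow h3 hν0.le).trans (le_of_eq ?_)
      rw [ENNReal.mul_rpow_of_nonneg _ _ hν0.le, ← ENNReal.rpow_mul, ← ENNReal.rpow_mul,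
        one_div_mul_cancel hν0.ne', ENNReal.rpow_one]
      congr 2
      field_simp
    refine (enorm_inner_le _ _).trans ?_
    calc _ ≤ (ENNReal.ofReal A * ‖g‖ₑ) * ((C₁ + 1) * (ENNReal.ofReal ((2 ^ k) ^ θ) * e k)) := by
          gcongr
          · exact hL.energy t g
          · exact hS.trans (mul_le_mul' le_self_add hint)
      _ = _ := by
          rw [ENNReal.ofReal_mul (by positivity), ENNReal.ofReal_mul hA.le,
            ENNReal.ofReal_add (by positivity) zero_le_one, ENNReal.ofReal_coe_nnreal,
            ENNReal.ofReal_one]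
          ring
  have hl₁ : ∀ k ∈ S, ∀ g, ‖inner 𝕜 (L t g) (∫ s in W, L s (G k s))‖ₑ ≤
      ENNReal.ofReal (D * δ ^ (-σ) * (2 ^ k) ^ (θ - 1)) * e k * E.norm₁ (E.ι₀ g) := by
    intro k hk g
    refine (hL.enorm_inner_integral_le_dispersion hσ hδ hWm hW hWt (G k) g).trans ?_
    have h3 : ∫⁻ s in W, E.norm₁ (E.ι₀ (G k s)) ≤ ENNReal.ofReal ((2 ^ k) ^ (θ - 1)) * e k := by
      calc _ ≤ ∫⁻ s in W, ENNReal.ofReal ((2 ^ k) ^ (θ - 1)) * (φ s ^ r * d k s ^ (1 : ℝ)) := by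
            refine lintegral_mono fun s => ?_
            rw [ENNReal.rpow_one]
            exact hG1 k hk s
        _ = ENNReal.ofReal ((2 ^ k) ^ (θ - 1)) * ∫⁻ s in W, φ s ^ r * d k s ^ (1 : ℝ) := by
            rw [lintegral_const_mul _ (hφd k _)]
        _ ≤ _ := by
            gcongr
            exact lintegral_mul_rpow_le_of_lintegral_le_one (hφm.pow_const _) (hdm k) hΦ
              zero_le_one one_le_two
    calc _ ≤ ENNReal.ofReal (D * δ ^ (-σ)) * E.norm₁ (E.ι₀ g) *
          (ENNReal.ofReal ((2 ^ k) ^ (θ - 1)) * e k) := by gcongr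
      _ = _ := by rw [ENNReal.ofReal_mul (p := D * δ ^ (-σ)) (by positivity)]; ring
  have hl := hC₃ S (fun k g => ‖inner 𝕜 (L t g) (∫ s in W, L s (G k s))‖ₑ) e (A * (C₁ + 1))
    (D * δ ^ (-σ)) g (by positivity) (by positivity)
    (fun k g h => by rw [map_add, inner_add_left]; exact enorm_add_le _ _) hl₀ hl₁
  have hesum : ∑ k ∈ S, e k ^ 2 ≤ C₂ := by
    calc ∑ k ∈ S, e k ^ 2 = ∫⁻ s in W, ∑ k ∈ S, φ s ^ r * d k s ^ 2 := by
          rw [lintegral_finsetSum _ fun k _ => hφd2 k]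
          refine Finset.sum_congr rfl fun k _ => ?_
          simp only [he]
          rw [← ENNReal.rpow_two, ← ENNReal.rpow_mul]
          norm_num
      _ ≤ ∫⁻ s in W, C₂ * φ s ^ r := by
          refine lintegral_mono fun s => ?_
          rw [← Finset.mul_sum]
          by_cases hs : φ s = 0
          · rw [hs, ENNReal.zero_rpow_of_pos hr0]; simp
          rw [mul_comm]
          gcongr
          simp only [hd, div_eq_mul_inv, mul_pow]
          rw [← Finset.sum_mul, ← ENNReal.inv_pow, ← div_eq_mul_inv]
          exact ENNReal.div_le_of_le_mul (hsum s)
      _ = C₂ * ∫⁻ s in W, φ s ^ r := lintegral_const_mul _ (hφm.pow_const _)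
      _ ≤ C₂ * 1 := by gcongr
      _ = _ := mul_one _
  have hsplit : ∫ s in W, L s (F s) =
      ∑ k ∈ S, (∫ s in W, L s (G k s)) + ∫ s in W, L s (F s - ∑ k ∈ S, G k s) := by
    rw [← integral_finsetSum _ fun k _ => hGi k, ← integral_add]
    · refine integral_congr_ae (ae_of_all _ fun s => ?_)
      simp [map_sub, map_sum]
    · exact integrable_finsetSum _ fun k _ => hGi k
    · simp only [map_sub, map_sum]
      exact hFi.sub (integrable_finsetSum _ fun k _ => hGi k)
  rw [hsplit, inner_add_right, inner_sum]
  refine (enorm_add_le _ _).trans (add_le_add ((enorm_sum_le _ _).trans (hl.trans ?_)) ?_)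
  · have e1 : (A * (C₁ + 1)) ^ (1 - θ) * (D * δ ^ (-σ)) ^ θ =
        (A * (C₁ + 1)) ^ (1 - θ) * D ^ θ * δ ^ (-(σ * θ)) := by
      rw [Real.mul_rpow hD.le (by positivity), ← Real.rpow_mul hδ.le]
      ring_nf
    rw [e1, ENNReal.ofReal_mul (by positivity), ENNReal.coe_mul, ENNReal.coe_mul,
      ENNReal.coe_rpow_of_nonneg _ (by norm_num)]
    change _ ≤ C₃ * ENNReal.ofReal _ * _ * _ * _
    calc _ ≤ C₃ * (ENNReal.ofReal ((A * (C₁ + 1)) ^ (1 - θ) * D ^ θ) *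
          ENNReal.ofReal (δ ^ (-(σ * θ)))) * (C₂ : ℝ≥0∞) ^ (1 / 2 : ℝ) *
          E.interpENorm θ (E.ι₀ g) := by gcongr
      _ = _ := by ring
  · refine (enorm_inner_le _ _).trans ?_
    calc _ ≤ (ENNReal.ofReal A * ‖g‖ₑ) * ∫⁻ s in W, ENNReal.ofReal A * ENNReal.ofReal ε := by
          gcongr
          · exact hL.energy t g
          · refine (enorm_integral_le_lintegral_enorm _).trans (lintegral_mono fun s => ?_)
            refine (hL.energy s _).trans ?_
            gcongr
            rw [← ofReal_norm]
            exact ENNReal.ofReal_le_ofReal (hrem s)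
      _ = _ := by rw [setLIntegral_const, ENNReal.ofReal_pow hA.le]; ring

end IsDispersive

end BanachCouple

/-- The parameter `b` for which `θ'` lies at the proportion `θ` of the way from `b` to `1`. The
conditions on `θ` and `θ'` say that the Strichartz estimate is available for it. -/
lemma exists_strichartz_parameter {σ θ θ' : ℝ} (hσ : 0 < σ) (hθ : θ ∈ Ico (0 : ℝ) 1)
    (hθ' : θ' ∈ Icc (0 : ℝ) 1) (hle : θ ≤ θ')
    (hcond : σ < 1 ∨ (σ = 1 ∧ θ < 1 ∧ θ' < 1) ∨
      (1 < σ ∧ (σ - 1) / σ * (1 - θ) ≤ 1 - θ' ∧ (σ - 1) / σ * (1 - θ') ≤ 1 - θ)) :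
    ∃ b ∈ Icc (0 : ℝ) 1, (σ * b < 1 ∨ (1 < σ ∧ σ * b = 1)) ∧ θ + (1 - θ) * b = θ' ∧
      (1 - θ) * ((2 - σ * b) / 2) + θ = 1 - σ * (θ' / 2 - θ / 2) := by
  have h1 : 0 < 1 - θ := by linarith [hθ.2]
  have hb : θ + (1 - θ) * ((θ' - θ) / (1 - θ)) = θ' := by
    rw [mul_div_cancel₀ _ h1.ne']; ring
  set b := (θ' - θ) / (1 - θ) with hbd
  have hb0 : 0 ≤ b := div_nonneg (by linarith) h1.le
  have hb1 : b ≤ 1 := (div_le_one h1).2 (by linarith [hθ'.2])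
  refine ⟨b, ⟨hb0, hb1⟩, ?_, hb, ?_⟩
  · rcases hcond with h | ⟨h, -, h'⟩ | ⟨h, h', -⟩
    · left; nlinarith
    · left
      rw [h, one_mul]
      exact (div_lt_one h1).2 (by linarith)
    · have h2 : (σ - 1) * (1 - θ) ≤ σ * (1 - θ') := by
        rw [div_mul_eq_mul_div, div_le_iff₀ hσ] at h'
        linarith
      have h3 : σ * b ≤ 1 := by
        rw [hbd, ← mul_div_assoc, div_le_one h1]
        linarith
      rcases h3.lt_or_eq with h4 | h4
      · exact Or.inl h4
      · exact Or.inr ⟨h, h4⟩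
  · have : (1 - θ) * b = θ' - θ := by linarith
    linear_combination (-σ / 2) * this

namespace BanachCouple

variable {𝕜 H B₀ B₁ V : Type*} [RCLike 𝕜]
  [NormedAddCommGroup H] [InnerProductSpace 𝕜 H]
  [NormedAddCommGroup B₀] [NormedSpace 𝕜 B₀] [NormedAddCommGroup B₁] [NormedSpace 𝕜 B₁]
  [AddCommGroup V] [Module 𝕜 V] [TopologicalSpace V]

namespace IsDispersive

variable {E : BanachCouple 𝕜 B₀ B₁ V} {σ A D : ℝ} {L : ℝ → B₀ →L[𝕜] H} [NormedSpace ℝ H]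

/-- Passage from functions whose norm is at most one to all functions. -/
lemma enorm_inner_integral_le_of_homogeneous {W : Set ℝ} {θ' κ : ℝ} (hκ : 0 < κ) (h : H)
    {K : ℝ≥0∞} (hK0 : K ≠ 0) (hK : K ≠ ∞)
    (hone : ∀ F : SimpleFunc ℝ B₀, (∀ s, E.interpENorm θ' (E.ι₀ (F s)) ≠ ∞) →
      ∫⁻ s in W, E.interpENorm θ' (E.ι₀ (F s)) ^ (1 / κ) ≤ 1 →
      ‖inner 𝕜 h (∫ s in W, L s (F s))‖ₑ ≤ K)
    (F : SimpleFunc ℝ B₀) (hF : ∀ s, E.interpENorm θ' (E.ι₀ (F s)) ≠ ∞) :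
    ‖inner 𝕜 h (∫ s in W, L s (F s))‖ₑ ≤
      K * (∫⁻ s in W, E.interpENorm θ' (E.ι₀ (F s)) ^ (1 / κ)) ^ κ := by
  set N : B₀ → ℝ≥0∞ := fun x => E.interpENorm θ' (E.ι₀ x) with hN
  set Φ := ∫⁻ s in W, N (F s) ^ (1 / κ) with hΦ
  have hNm : ∀ F : SimpleFunc ℝ B₀, Measurable fun s => N (F s) := fun F => (F.map N).measurable
  have key : ∀ η : ℝ, 0 < η → Φ ≤ ENNReal.ofReal η →
      ‖inner 𝕜 h (∫ s in W, L s (F s))‖ₑ ≤ K * ENNReal.ofReal (η ^ κ) := by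
    intro η hη hΦη
    set c : ℝ := η ^ (-κ) with hc
    have hc0 : 0 < c := Real.rpow_pos_of_pos hη _
    have hce : ‖(c : 𝕜)‖ₑ = ENNReal.ofReal c := by
      rw [← ofReal_norm, RCLike.norm_ofReal, abs_of_pos hc0]
    have hNc : ∀ s, N ((c : 𝕜) • F s) ≤ ENNReal.ofReal c * N (F s) := fun s => by
      simp only [hN, map_smul]
      exact (E.interpENorm_smul_le _ _ _).trans_eq (by rw [hce])
    have h1 := hone (F.map fun x => (c : 𝕜) • x)
      (fun s => ne_top_of_le_ne_top (ENNReal.mul_ne_top ENNReal.ofReal_ne_top (hF s)) (hNc s)) (by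
        calc ∫⁻ s in W, N ((c : 𝕜) • F s) ^ (1 / κ)
            ≤ ∫⁻ s in W, ENNReal.ofReal c ^ (1 / κ) * N (F s) ^ (1 / κ) := by
              refine lintegral_mono fun s => ?_
              rw [← ENNReal.mul_rpow_of_nonneg _ _ (by positivity)]
              exact ENNReal.rpow_le_rpow (hNc s) (by positivity)
          _ = ENNReal.ofReal c ^ (1 / κ) * Φ := lintegral_const_mul _ ((hNm F).pow_const _)
          _ ≤ ENNReal.ofReal c ^ (1 / κ) * ENNReal.ofReal η := by gcongr
          _ = 1 := by
              rw [ENNReal.ofReal_rpow_of_pos hc0, hc, ← Real.rpow_mul hη.le,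
                ← ENNReal.ofReal_mul (by positivity)]
              rw [show -κ * (1 / κ) = -1 by field_simp, Real.rpow_neg_one, inv_mul_cancel₀ hη.ne',
                ENNReal.ofReal_one])
    have h2 : ∫ s in W, L s ((F.map fun x => (c : 𝕜) • x) s) = (c : 𝕜) • ∫ s in W, L s (F s) := by
      rw [← integral_smul]
      simp
    rw [h2, inner_smul_right, enorm_mul, hce] at h1
    calc _ = ENNReal.ofReal (η ^ κ) *
          (ENNReal.ofReal c * ‖inner 𝕜 h (∫ s in W, L s (F s))‖ₑ) := by
          rw [← mul_assoc, ← ENNReal.ofReal_mul (by positivity), hc, ← Real.rpow_add hη]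
          simp
      _ ≤ _ := by rw [mul_comm K]; gcongr
  rcases eq_or_ne Φ 0 with h0 | h0
  · rw [h0, ENNReal.zero_rpow_of_pos hκ, mul_zero]
    refine ENNReal.le_of_forall_add_ofReal_mul hK fun ε hε => ?_
    refine (key (ε ^ (1 / κ)) (by positivity) (by rw [h0]; exact bot_le)).trans (le_of_eq ?_)
    rw [← Real.rpow_mul hε.le, one_div_mul_cancel hκ.ne', Real.rpow_one, zero_add, mul_comm]
  rcases eq_or_ne Φ ∞ with h1 | h1
  · rw [h1, ENNReal.top_rpow_of_pos hκ, ENNReal.mul_top hK0]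
    exact le_top
  · have h2 : 0 < Φ.toReal := ENNReal.toReal_pos h0 h1
    refine (key Φ.toReal h2 (ENNReal.ofReal_toReal h1).ge).trans (le_of_eq ?_)
    rw [← ENNReal.ofReal_rpow_of_pos h2, ENNReal.ofReal_toReal h1]

variable [IsTopologicalAddGroup V] [T2Space V] [CompleteSpace H]

/-- The local estimate for simple functions: `F` is restricted to times that precede `t` by at
least `δ`, or to any times at all if `θ = 0`. -/
lemma exists_enorm_inner_integral_simpleFunc_le (hL : E.IsDispersive σ A D L) (hσ : 0 < σ)
    {θ θ' : ℝ} (hθ : θ ∈ Icc (0 : ℝ) 1) (hθ' : θ' ∈ Icc (0 : ℝ) 1) (hle : θ ≤ θ')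
    (hcond : σ < 1 ∨ (σ = 1 ∧ θ < 1 ∧ θ' < 1) ∨
      (1 < σ ∧ (σ - 1) / σ * (1 - θ) ≤ 1 - θ' ∧ (σ - 1) / σ * (1 - θ') ≤ 1 - θ))
    {κ : ℝ} (hκ : κ = 1 - σ * (θ' / 2 - θ / 2)) (hκ0 : 0 < κ) :
    ∃ C : ℝ≥0, ∀ (t δ : ℝ) (W : Set ℝ) (F : SimpleFunc ℝ B₀) (g : B₀), 0 < δ → MeasurableSet W →
      volume W ≠ ∞ → (θ = 0 ∨ W ⊆ Iic (t - δ)) →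
      (∀ s, E.interpENorm θ' (E.ι₀ (F s)) ≠ ∞) → E.interpENorm θ (E.ι₀ g) ≠ ∞ →
      ‖inner 𝕜 (L t g) (∫ s in W, L s (F s))‖ₑ ≤
        C * ENNReal.ofReal (δ ^ (-(σ * θ))) * E.interpENorm θ (E.ι₀ g) *
          (∫⁻ s in W, E.interpENorm θ' (E.ι₀ (F s)) ^ (1 / κ)) ^ κ := by
  rcases hθ.2.eq_or_lt with rfl | h1
  · -- the dispersive estimate, since `θ' = 1` as well
    obtain rfl : θ' = 1 := le_antisymm hθ'.2 hle
    obtain rfl : κ = 1 := by rw [hκ]; ring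
    refine ⟨D.toNNReal, fun t δ W F g hδ hWm hW hWt hF hg => ?_⟩
    have := hL.enorm_inner_integral_le_dispersion hσ hδ hWm hW (hWt.resolve_left one_ne_zero) F g
    rw [ENNReal.ofReal_mul hL.D_pos.le] at this
    simpa [interpENorm_at_one, ENNReal.ofReal] using this
  obtain ⟨b, hb, hσb, hbθ, hbκ⟩ := exists_strichartz_parameter hσ ⟨hθ.1, h1⟩ hθ' hle hcond
  rcases hθ.1.eq_or_lt with rfl | h0
  · -- the energy estimate for `g` and the Strichartz estimate for `F`
    obtain rfl : b = θ' := by linarith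
    have hbκ' : κ = (2 - σ * b) / 2 := by rw [hκ, ← hbκ]; ring
    obtain ⟨C, hC⟩ := hL.exists_strichartz hσ hb hσb
    refine ⟨A.toNNReal * C, fun t δ W F g hδ hWm hW hWt hF hg => ?_⟩
    have h2 := hC W F hWm hW hF
    rw [show 2 / (2 - σ * b) = 1 / κ by rw [hbκ', one_div_div], ← hbκ'] at h2
    refine (enorm_inner_le _ _).trans ((mul_le_mul' (hL.energy t g) h2).trans (le_of_eq ?_))
    simp only [interpENorm_at_zero, norm₀_ι₀, mul_zero, neg_zero, Real.rpow_zero,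
      ENNReal.ofReal_one, ENNReal.coe_mul, mul_one]
    rw [ENNReal.ofReal]
    ring
  · obtain ⟨C, hC⟩ := hL.exists_enorm_inner_integral_le_of_le_one hσ h0 h1 hb hσb
    rw [hbκ, ← hκ, hbθ] at hC
    refine ⟨C + 1, fun t δ W F g hδ hWm hW hWt hF hg => ?_⟩
    rcases eq_or_ne (E.interpENorm θ (E.ι₀ g)) 0 with hg0 | hg0
    · have : g = 0 := E.injective₀ (by rw [E.eq_zero_of_interpENorm hg0, map_zero])
      simp [this]
    refine enorm_inner_integral_le_of_homogeneous hκ0 _ ?_ (by finiteness) (fun F hF hΦ => ?_) F hF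
    · have : 0 < δ ^ (-(σ * θ)) := by positivity
      simp [hg0, this]
    · refine (hC t δ W F g hδ hWm hW (hWt.resolve_left h0.ne') hF hΦ).trans ?_
      gcongr
      exact_mod_cast le_self_add

end IsDispersive
end BanachCouple

namespace BanachCouple

variable {𝕜 H B₀ B₁ V : Type*} [RCLike 𝕜]
  [NormedAddCommGroup H] [InnerProductSpace 𝕜 H]
  [NormedAddCommGroup B₀] [NormedSpace 𝕜 B₀] [NormedAddCommGroup B₁] [NormedSpace 𝕜 B₁]
  [AddCommGroup V] [Module 𝕜 V] [TopologicalSpace V] [IsTopologicalAddGroup V] [T2Space V]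

lemma interpENorm_incl (E : BanachCouple 𝕜 B₀ B₁ V) (θ : ℝ) (x : E.Interp θ) :
    E.interpENorm θ (E.incl θ x) = ‖x‖ₑ := by
  rw [← ofReal_norm]
  exact (ENNReal.ofReal_toReal x.2.ne).symm

/-- The intersection `B₀ ∩ B_θ`, as the space of pairs that agree in `V`, with the maximum of the
two norms. -/
def interSubmodule (E : BanachCouple 𝕜 B₀ B₁ V) (θ : ℝ) : Submodule 𝕜 (B₀ × E.Interp θ) where
  carrier := {z | E.ι₀ z.1 = E.incl θ z.2}
  add_mem' {z w} hz hw := by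
    change E.ι₀ (z.1 + w.1) = E.incl θ (z.2 + w.2)
    rw [map_add, map_add, show E.ι₀ z.1 = _ from hz, show E.ι₀ w.1 = _ from hw]
  zero_mem' := by
    change E.ι₀ 0 = E.incl θ 0
    rw [map_zero, map_zero]
  smul_mem' c z hz := by
    change E.ι₀ (c • z.1) = E.incl θ (c • z.2)
    rw [map_smul, map_smul, show E.ι₀ z.1 = _ from hz]

/-- Functions that agree almost everywhere in `V` are given by a strongly measurable function with
values in `B₀ ∩ B_θ`. -/
lemma exists_stronglyMeasurable_inter (E : BanachCouple 𝕜 B₀ B₁ V) {θ : ℝ} {μ : Measure ℝ}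
    {F₀ : ℝ → B₀} {F : ℝ → E.Interp θ} (hF₀ : AEStronglyMeasurable F₀ μ)
    (hF : AEStronglyMeasurable F μ) (hFF : ∀ᵐ s ∂μ, E.ι₀ (F₀ s) = E.incl θ (F s)) :
    ∃ f : ℝ → E.interSubmodule θ, StronglyMeasurable f ∧ F₀ =ᵐ[μ] (fun s => (f s).1.1) ∧
      F =ᵐ[μ] fun s => (f s).1.2 := by
  classical
  set f : ℝ → E.interSubmodule θ := fun s =>
    if h : E.ι₀ (F₀ s) = E.incl θ (F s) then ⟨(F₀ s, F s), h⟩ else 0 with hf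
  have h1 : (fun s => (f s).1) =ᵐ[μ] fun s => (F₀ s, F s) := by
    filter_upwards [hFF] with s hs
    simp [hf, hs]
  have h2 : AEStronglyMeasurable f μ :=
    Topology.IsEmbedding.subtypeVal.aestronglyMeasurable_comp_iff.1
      ((hF₀.prodMk hF).congr h1.symm)
  refine ⟨h2.mk f, h2.stronglyMeasurable_mk, ?_, ?_⟩
  · filter_upwards [h1, h2.ae_eq_mk] with s hs hs'
    rw [← hs', hs]
  · filter_upwards [h1, h2.ae_eq_mk] with s hs hs'
    rw [← hs', hs]

namespace IsDispersive

variable {E : BanachCouple 𝕜 B₀ B₁ V} {σ A D : ℝ} {L : ℝ → B₀ →L[𝕜] H}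
  [NormedSpace ℝ H]

/-- Passage from simple functions to all functions, by approximation in `B₀ ∩ B_θ'`. -/
lemma enorm_inner_integral_le_of_simpleFunc (hL : E.IsDispersive σ A D L) {W : Set ℝ}
    (hW : MeasurableSet W) {θ' κ : ℝ} (hκ : 0 < κ) (h : H) {K : ℝ≥0∞} (hK : K ≠ ∞)
    (hsimple : ∀ (W' : Set ℝ) (F : SimpleFunc ℝ B₀), W' ⊆ W → MeasurableSet W' → volume W' ≠ ∞ →
      (∀ s, E.interpENorm θ' (E.ι₀ (F s)) ≠ ∞) →
      ‖inner 𝕜 h (∫ s in W', L s (F s))‖ₑ ≤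
        K * (∫⁻ s in W', E.interpENorm θ' (E.ι₀ (F s)) ^ (1 / κ)) ^ κ)
    {F₀ : ℝ → B₀} {F : ℝ → E.Interp θ'} (hF₀ : IntegrableOn F₀ W)
    (hF : AEStronglyMeasurable F (volume.restrict W))
    (hFF : ∀ᵐ s ∂volume.restrict W, E.ι₀ (F₀ s) = E.incl θ' (F s)) :
    ‖inner 𝕜 h (∫ s in W, L s (F₀ s))‖ₑ ≤ K * (∫⁻ s in W, ‖F s‖ₑ ^ (1 / κ)) ^ κ := by
  obtain ⟨f, hf, hf₀, hf₁⟩ := E.exists_stronglyMeasurable_inter hF₀.1 hF hFF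
  have hNf : ∀ z : E.interSubmodule θ', E.interpENorm θ' (E.ι₀ z.1.1) = ‖z.1.2‖ₑ := fun z => by
    rw [show E.ι₀ z.1.1 = E.incl θ' z.1.2 from z.2, interpENorm_incl]
  have hle₀ : ∀ z : E.interSubmodule θ', ‖z.1.1‖ ≤ ‖z‖ := fun z => norm_fst_le z.1
  have hle₁ : ∀ z : E.interSubmodule θ', ‖z.1.2‖ₑ ≤ ENNReal.ofReal ‖z‖ := fun z => by
    rw [← ofReal_norm]
    exact ENNReal.ofReal_le_ofReal (norm_snd_le z.1)
  have hint : IntegrableOn (fun s => L s (f s).1.1) W :=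
    hL.integrableOn (hF₀.congr hf₀)
  rw [integral_congr_ae (hf₀.mono fun s hs => by simp only [hs] :
      (fun s => L s (F₀ s)) =ᵐ[volume.restrict W] fun s => L s (f s).1.1),
    lintegral_congr_ae (hf₁.mono fun s hs => by simp only [hs] :
      (fun s => ‖F s‖ₑ ^ (1 / κ)) =ᵐ[volume.restrict W] fun s => ‖(f s).1.2‖ₑ ^ (1 / κ))]
  -- truncation to times and values of size at most `n`
  set W' : ℕ → Set ℝ := fun n => W ∩ (Icc (-n : ℝ) n ∩ {s | ‖f s‖ ≤ n}) with hW'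
  have hW'm : ∀ n, MeasurableSet (W' n) := fun n =>
    hW.inter (measurableSet_Icc.inter (measurableSet_le hf.norm.measurable measurable_const))
  have hW't : ∀ n, volume (W' n) ≠ ∞ := fun n =>
    ne_top_of_le_ne_top (by simp) (measure_mono fun s hs => hs.2.1 : _ ≤ volume (Icc (-n : ℝ) n))
  have hmono : Monotone W' := fun m n hmn s hs =>
    have hmn' : (m : ℝ) ≤ n := by exact_mod_cast hmn
    ⟨hs.1, ⟨by linarith [hs.2.1.1], by linarith [hs.2.1.2]⟩, le_trans hs.2.2 hmn'⟩
  have hunion : ⋃ n, W' n = W := by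
    refine subset_antisymm (iUnion_subset fun n => inter_subset_left) fun s hs => ?_
    obtain ⟨n, hn⟩ := exists_nat_ge (max |s| ‖f s‖)
    exact mem_iUnion.2 ⟨n, hs, abs_le.1 ((le_max_left _ _).trans hn), (le_max_right _ _).trans hn⟩
  have hlim := tendsto_setIntegral_of_monotone (μ := volume) (f := fun s => L s (f s).1.1) hW'm
    hmono (by rwa [hunion])
  rw [hunion] at hlim
  refine le_of_tendsto ((continuous_enorm.tendsto _).comp
    (((innerSL 𝕜 h).continuous.tendsto _).comp hlim)) (Eventually.of_forall fun n => ?_)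
  suffices hn : ‖inner 𝕜 h (∫ s in W' n, L s (f s).1.1)‖ₑ ≤
      K * (∫⁻ s in W' n, ‖(f s).1.2‖ₑ ^ (1 / κ)) ^ κ by
    refine hn.trans ?_
    gcongr
    exact inter_subset_left
  -- approximation by simple functions, with dominated convergence on `W' n`
  let _ : NormedSpace ℝ (E.interSubmodule θ') := NormedSpace.restrictScalars ℝ 𝕜 _
  set G : ℕ → SimpleFunc ℝ (E.interSubmodule θ') := fun k => hf.approxBounded n k with hG
  have hGle : ∀ k s, ‖G k s‖ ≤ n := fun k s => hf.norm_approxBounded_le (Nat.cast_nonneg n) k s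
  have hGlim : ∀ s ∈ W' n, Tendsto (fun k => G k s) atTop (𝓝 (f s)) := fun s hs =>
    hf.tendsto_approxBounded_of_norm_le hs.2.2
  have hlim₀ : Tendsto (fun k => ∫ s in W' n, L s (G k s).1.1) atTop
      (𝓝 (∫ s in W' n, L s (f s).1.1)) := by
    refine tendsto_integral_of_dominated_convergence (fun _ => A * n)
      (fun k => (hL.integrableOn_simpleFunc (hW't n) ((G k).map fun z : E.interSubmodule θ' => z.1.1)).1) ?_
      (fun k => ae_of_all _ fun s => ?_) ?_
    · exact integrableOn_const (hW't n)
    · have h1 := hL.energy s (G k s).1.1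
      rw [← ofReal_norm, ← ofReal_norm, ← ENNReal.ofReal_mul hL.A_pos.le,
        ENNReal.ofReal_le_ofReal_iff (by have := hL.A_pos; positivity)] at h1
      exact h1.trans (mul_le_mul_of_nonneg_left ((hle₀ _).trans (hGle k s)) hL.A_pos.le)
    · refine (ae_restrict_iff' (hW'm n)).2 (ae_of_all _ fun s hs => ?_)
      exact ((L s).continuous.tendsto _).comp
        (((continuous_fst.comp continuous_subtype_val).tendsto _).comp (hGlim s hs))
  have hlim₁ : Tendsto (fun k => ∫⁻ s in W' n, ‖(G k s).1.2‖ₑ ^ (1 / κ)) atTop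
      (𝓝 (∫⁻ s in W' n, ‖(f s).1.2‖ₑ ^ (1 / κ))) := by
    refine tendsto_lintegral_of_dominated_convergence (fun _ => ENNReal.ofReal n ^ (1 / κ))
      (fun k => ((G k).map fun z : E.interSubmodule θ' => ‖z.1.2‖ₑ ^ (1 / κ)).measurable)
      (fun k => ae_of_all _ fun s => ?_) ?_ ?_
    · refine ENNReal.rpow_le_rpow ((hle₁ _).trans ?_) (by positivity)
      exact ENNReal.ofReal_le_ofReal (hGle k s)
    · rw [setLIntegral_const]
      exact ENNReal.mul_ne_top (ENNReal.rpow_ne_top_of_nonneg (by positivity) ENNReal.ofReal_ne_top)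
        (hW't n)
    · refine (ae_restrict_iff' (hW'm n)).2 (ae_of_all _ fun s hs => ?_)
      exact ((ENNReal.continuous_rpow_const.comp (continuous_enorm.comp
        (continuous_snd.comp continuous_subtype_val))).tendsto _).comp (hGlim s hs)
  refine le_of_tendsto_of_tendsto' ((continuous_enorm.tendsto _).comp
    (((innerSL 𝕜 h).continuous.tendsto _).comp hlim₀))
    (ENNReal.Tendsto.const_mul ((ENNReal.continuous_rpow_const.tendsto _).comp hlim₁)
      (Or.inr hK)) fun k => ?_
  have h1 := hsimple (W' n) ((G k).map fun z : E.interSubmodule θ' => z.1.1) inter_subset_left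
    (hW'm n) (hW't n) fun s => by
      rw [SimpleFunc.map_apply, hNf]
      exact enorm_ne_top
  simp only [SimpleFunc.map_apply, hNf] at h1
  exact h1

/-- The local estimate: `F` is restricted to times that precede `t` by at least `δ`, or to any
times at all if `θ = 0`. -/
lemma exists_enorm_inner_integral_local_le [CompleteSpace H] (hL : E.IsDispersive σ A D L)
    (hσ : 0 < σ) {θ θ' : ℝ} (hθ : θ ∈ Icc (0 : ℝ) 1) (hθ' : θ' ∈ Icc (0 : ℝ) 1) (hle : θ ≤ θ')
    (hcond : σ < 1 ∨ (σ = 1 ∧ θ < 1 ∧ θ' < 1) ∨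
      (1 < σ ∧ (σ - 1) / σ * (1 - θ) ≤ 1 - θ' ∧ (σ - 1) / σ * (1 - θ') ≤ 1 - θ))
    {κ : ℝ} (hκ : κ = 1 - σ * (θ' / 2 - θ / 2)) (hκ0 : 0 < κ) :
    ∃ C : ℝ≥0, ∀ (t δ : ℝ) (W : Set ℝ) (F₀ : ℝ → B₀) (F : ℝ → E.Interp θ') (x : B₀)
      (y : E.Interp θ), 0 < δ → MeasurableSet W → (θ = 0 ∨ W ⊆ Iic (t - δ)) →
      IntegrableOn F₀ W → AEStronglyMeasurable F (volume.restrict W) →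
      (∀ᵐ s ∂volume.restrict W, E.ι₀ (F₀ s) = E.incl θ' (F s)) → E.ι₀ x = E.incl θ y →
      ‖inner 𝕜 (L t x) (∫ s in W, L s (F₀ s))‖ₑ ≤
        C * ENNReal.ofReal (δ ^ (-(σ * θ))) * ‖y‖ₑ * (∫⁻ s in W, ‖F s‖ₑ ^ (1 / κ)) ^ κ := by
  obtain ⟨C, hC⟩ := hL.exists_enorm_inner_integral_simpleFunc_le hσ hθ hθ' hle hcond hκ hκ0
  refine ⟨C, fun t δ W F₀ F x y hδ hWm hWt hF₀ hF hFF hxy => ?_⟩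
  have hxy' : E.interpENorm θ (E.ι₀ x) = ‖y‖ₑ := by rw [hxy, interpENorm_incl]
  refine hL.enorm_inner_integral_le_of_simpleFunc hWm hκ0 _ (by finiteness)
    (fun W' G hW' hW'm hW't hG => ?_) hF₀ hF hFF
  rw [← hxy']
  exact hC t δ W' G x hδ hW'm hW't (hWt.imp_right hW'.trans) hG (by rw [hxy']; finiteness)

end IsDispersive
end BanachCouple

/-! ### The weak-type bound for sums over dyadic windows -/

lemma ae_ne_top_of_weakLpNorm_ne_top {q : ℝ≥0∞} (hq : q ≠ 0) {M : ℝ → ℝ≥0∞}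
    (hM : weakLpNorm q M ≠ ∞) : ∀ᵐ t, M t ≠ ∞ := by
  unfold weakLpNorm at hM
  split_ifs at hM with h
  · filter_upwards [ENNReal.ae_le_essSup M] with t ht
    exact ne_top_of_le_ne_top hM ht
  have hq' : 0 < 1 / q.toReal := one_div_pos.2 (ENNReal.toReal_pos hq h)
  set B := ⨆ r : ℝ≥0, (r : ℝ≥0∞) * volume {t | (r : ℝ≥0∞) < M t} ^ (1 / q.toReal)
  have hle : ∀ r : ℝ≥0, (r : ℝ≥0∞) * volume {t | M t = ∞} ^ (1 / q.toReal) ≤ B := fun r => by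
    refine le_trans ?_ (le_iSup _ r)
    gcongr with t
    intro ht
    rw [ht]
    exact ENNReal.coe_lt_top
  have h0 : volume {t | M t = ∞} ^ (1 / q.toReal) = 0 := by
    by_contra hne
    have h1 : (∞ : ℝ≥0∞) * volume {t | M t = ∞} ^ (1 / q.toReal) ≤ B := by
      generalize volume {t | M t = ∞} ^ (1 / q.toReal) = v at hle
      rw [← ENNReal.iSup_natCast, ENNReal.iSup_mul]
      exact iSup_le fun n => by simpa using hle n
    rw [ENNReal.top_mul hne, top_le_iff] at h1
    exact hM h1
  rw [ENNReal.rpow_eq_zero_iff_of_pos hq'] at h0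
  rw [ae_iff]
  simpa using h0

lemma weakLpNorm_mono_ae {q : ℝ≥0∞} {M N : ℝ → ℝ≥0∞} (h : ∀ᵐ t, M t ≤ N t) :
    weakLpNorm q M ≤ weakLpNorm q N := by
  unfold weakLpNorm
  split_ifs
  · exact essSup_mono_ae h
  · refine iSup_mono fun r => ?_
    gcongr 1
    refine ENNReal.rpow_le_rpow (measure_mono_ae ?_) (by positivity)
    filter_upwards [h] with t ht h'
    exact lt_of_lt_of_le h' ht

lemma weakLpNorm_const_mul_le {q : ℝ≥0∞} {c : ℝ≥0} (hc : c ≠ 0) (M : ℝ → ℝ≥0∞) :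
    weakLpNorm q (fun t => c * M t) ≤ c * weakLpNorm q M := by
  unfold weakLpNorm
  split_ifs
  · exact (ENNReal.essSup_const_mul).le
  · refine iSup_le fun r => ?_
    refine le_trans ?_ (mul_le_mul_right (le_iSup _ (r / c)) _)
    rw [← mul_assoc, ← ENNReal.coe_mul, mul_div_cancel₀ _ hc]
    refine mul_le_mul_right (ENNReal.rpow_le_rpow (measure_mono fun t ht => ?_) (by positivity)) _
    rw [mem_ofPred_eq, ENNReal.coe_div hc]
    exact ENNReal.div_lt_of_lt_mul' ht

/-- The times that precede `t` by an amount between `2 ^ j` and `2 ^ (j + 1)`. -/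
def dyadicWindow (j : ℤ) (t : ℝ) : Set ℝ := Ioc (t - 2 ^ (j + 1)) (t - 2 ^ j)

lemma iUnion_dyadicWindow (t : ℝ) : ⋃ j, dyadicWindow j t = Iio t := by
  ext s
  simp only [mem_iUnion, dyadicWindow, mem_Ioc, mem_Iio]
  constructor
  · rintro ⟨j, -, h⟩
    have : (0 : ℝ) < 2 ^ j := by positivity
    linarith
  · intro h
    obtain ⟨j, hj⟩ := exists_mem_Ico_zpow (sub_pos.2 h) one_lt_two
    exact ⟨j, by linarith [hj.2], by linarith [hj.1]⟩

lemma pairwise_disjoint_dyadicWindow (t : ℝ) :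
    Pairwise (Function.onFun Disjoint fun j => dyadicWindow j t) := by
  have key : ∀ i j : ℤ, i < j → Disjoint (dyadicWindow i t) (dyadicWindow j t) := by
    refine fun i j hij => Set.disjoint_left.2 fun s hi hj => ?_
    have : (2 : ℝ) ^ (i + 1) ≤ 2 ^ j := zpow_le_zpow_right₀ one_le_two hij
    linarith [hi.1, hj.2]
  intro i j hij
  rcases hij.lt_or_gt with h | h
  · exact key i j h
  · exact (key j i h).symm

lemma measurableSet_dyadicWindow (j : ℤ) :
    MeasurableSet {p : ℝ × ℝ | p.2 ∈ dyadicWindow j p.1} := by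
  have h1 : Measurable fun p : ℝ × ℝ => p.1 - 2 ^ (j + 1) := by fun_prop
  have h2 : Measurable fun p : ℝ × ℝ => p.1 - 2 ^ j := by fun_prop
  exact (measurableSet_lt h1 measurable_snd).inter (measurableSet_le measurable_snd h2)

lemma measurable_lintegral_window {W : ℝ → Set ℝ}
    (hW : MeasurableSet {p : ℝ × ℝ | p.2 ∈ W p.1}) {f : ℝ → ℝ≥0∞} (hf : Measurable f) :
    Measurable fun t => ∫⁻ s in W t, f s := by
  have h : ∀ t, ∫⁻ s in W t, f s =
      ∫⁻ s, {p : ℝ × ℝ | p.2 ∈ W p.1}.indicator (fun p => f p.2) (t, s) := fun t => by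
    have hWt : MeasurableSet (W t) := measurable_prodMk_left hW
    rw [← lintegral_indicator hWt]
    rfl
  simp_rw [h]
  exact ((hf.comp measurable_snd).indicator hW).lintegral_prod_right'

lemma lintegral_lintegral_dyadicWindow (j : ℤ) {f : ℝ → ℝ≥0∞} (hf : Measurable f) :
    ∫⁻ t, ∫⁻ s in dyadicWindow j t, f s = ENNReal.ofReal (2 ^ j) * ∫⁻ s, f s := by
  have hm := measurableSet_dyadicWindow j
  calc _ = ∫⁻ t, ∫⁻ s, {p : ℝ × ℝ | p.2 ∈ dyadicWindow j p.1}.indicator (fun p => f p.2) (t, s) := by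
        refine lintegral_congr fun t => ?_
        rw [dyadicWindow, ← lintegral_indicator measurableSet_Ioc]
        rfl
    _ = ∫⁻ s, ∫⁻ t, {p : ℝ × ℝ | p.2 ∈ dyadicWindow j p.1}.indicator (fun p => f p.2) (t, s) :=
        lintegral_lintegral_swap ((hf.comp measurable_snd).indicator hm).aemeasurable
    _ = ∫⁻ s, ENNReal.ofReal (2 ^ j) * f s := by
        refine lintegral_congr fun s => ?_
        have : ∀ t, {p : ℝ × ℝ | p.2 ∈ dyadicWindow j p.1}.indicator (fun p => f p.2) (t, s) =
            (Ico (s + 2 ^ j) (s + 2 ^ (j + 1))).indicator (fun _ => f s) t := fun t => by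
          simp only [indicator, dyadicWindow, mem_Ioc, mem_Ico]
          congr 1
          simp only [eq_iff_iff]
          constructor
          · rintro ⟨h1, h2⟩; constructor <;> linarith
          · rintro ⟨h1, h2⟩; constructor <;> linarith
        simp_rw [this]
        rw [lintegral_indicator measurableSet_Ico, setLIntegral_const, Real.volume_Ico, mul_comm]
        congr 2
        rw [zpow_add_one₀ two_ne_zero]
        ring
    _ = _ := lintegral_const_mul _ hf

/-- Chebyshev's inequality for one window. -/
lemma volume_dyadicWindow_le {α κ : ℝ} (hκ : 0 < κ) (j : ℤ) {f : ℝ → ℝ≥0∞} (hf : Measurable f)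
    {c : ℝ} (hc : 0 < c) :
    volume {t | ENNReal.ofReal c <
      ENNReal.ofReal ((2 ^ j) ^ (-α)) * (∫⁻ s in dyadicWindow j t, f s) ^ κ} ≤
    ENNReal.ofReal ((c * (2 ^ j) ^ α) ^ (-(1 / κ)) * 2 ^ j) * ∫⁻ s, f s := by
  set ε : ℝ≥0∞ := ENNReal.ofReal ((c * (2 ^ j) ^ α) ^ (1 / κ)) with hε
  have h2 : (0 : ℝ) < 2 ^ j := by positivity
  have hpos : 0 < (c * ((2 : ℝ) ^ j) ^ α) ^ (1 / κ) := by positivity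
  have h := mul_meas_ge_le_lintegral₀ (μ := volume)
    (f := fun t => ∫⁻ s in dyadicWindow j t, f s) 
    (measurable_lintegral_window (measurableSet_dyadicWindow j) hf).aemeasurable ε
  rw [lintegral_lintegral_dyadicWindow j hf] at h
  have hsub : {t | ENNReal.ofReal c <
      ENNReal.ofReal ((2 ^ j) ^ (-α)) * (∫⁻ s in dyadicWindow j t, f s) ^ κ} ⊆
      {t | ε ≤ ∫⁻ s in dyadicWindow j t, f s} := by
    intro t ht
    rw [mem_ofPred_eq] at ht ⊢
    rw [hε, ← ENNReal.ofReal_rpow_of_pos (by positivity), one_div,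
      ENNReal.rpow_inv_le_iff hκ, mul_comm c, ENNReal.ofReal_mul (by positivity)]
    calc _ ≤ ENNReal.ofReal ((2 ^ j) ^ α) * (ENNReal.ofReal ((2 ^ j) ^ (-α)) *
          (∫⁻ s in dyadicWindow j t, f s) ^ κ) := by gcongr
      _ = _ := by
          rw [← mul_assoc, ← ENNReal.ofReal_mul (by positivity), ← Real.rpow_add h2]
          simp
  calc _ ≤ volume {t | ε ≤ ∫⁻ s in dyadicWindow j t, f s} := measure_mono hsub
    _ = ENNReal.ofReal ((c * (2 ^ j) ^ α) ^ (-(1 / κ))) *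
        (ε * volume {t | ε ≤ ∫⁻ s in dyadicWindow j t, f s}) := by
        rw [← mul_assoc, hε, ← ENNReal.ofReal_mul (by positivity),
          ← Real.rpow_add (by positivity)]
        simp
    _ ≤ ENNReal.ofReal ((c * (2 ^ j) ^ α) ^ (-(1 / κ))) *
        (ENNReal.ofReal (2 ^ j) * ∫⁻ s, f s) := by gcongr
    _ = _ := by rw [← mul_assoc, ← ENNReal.ofReal_mul (by positivity)]

/-- The sum over the dyadic windows is of weak type. The windows of length at least `2 ^ J`
are estimated uniformly in `t`, the others by Chebyshev's inequality. -/
lemma exists_volume_tsum_dyadicWindow_le {α κ : ℝ} (hα : 0 < α) (hακ : α < κ) :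
    ∃ C : ℝ≥0, ∀ f : ℝ → ℝ≥0∞, Measurable f → ∀ r : ℝ≥0,
      (r : ℝ≥0∞) * volume {t | (r : ℝ≥0∞) < ∑' j : ℤ, ENNReal.ofReal ((2 ^ j) ^ (-α)) *
        (∫⁻ s in dyadicWindow j t, f s) ^ κ} ^ α ≤ C * (∫⁻ s, f s) ^ κ := by
  have hκ : 0 < κ := hα.trans hακ
  -- the ratios of the three geometric series
  set ρ : ℝ := 2 ^ (-α) with hρ
  have hρ0 : 0 < ρ := by positivity
  have hρ1 : ρ < 1 := Real.rpow_lt_one_of_one_lt_of_neg one_lt_two (by linarith)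
  set β : ℝ := (κ - α) / 2 with hβ
  have hβ0 : 0 < β := by rw [hβ]; linarith
  set ω : ℝ := 2 ^ (-β) with hω
  have hω0 : 0 < ω := by positivity
  have hω1 : ω < 1 := Real.rpow_lt_one_of_one_lt_of_neg one_lt_two (by linarith)
  set τ : ℝ := 2 ^ (-(β / κ)) with hτ
  have hτ0 : 0 < τ := by positivity
  have hτ1 : τ < 1 :=
    Real.rpow_lt_one_of_one_lt_of_neg one_lt_two (neg_neg_of_pos (by positivity))
  set K : ℝ := 2 * (1 - ρ)⁻¹ with hK
  have hK0 : 0 < K := by have := sub_pos.2 hρ1; positivity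
  set c : ℝ := 1 - ω with hc
  have hc0 : 0 < c := sub_pos.2 hω1
  set P : ℝ := (c / 2) ^ (-(1 / κ)) * (1 - τ)⁻¹ * 2 ^ (1 - α / κ) * K ^ (-(1 / κ)) with hP
  have hP0 : 0 < P := by have := sub_pos.2 hτ1; positivity
  refine ⟨Real.toNNReal (P ^ α * K), fun f hf r => ?_⟩
  set Φ := ∫⁻ s, f s with hΦ
  have hI : ∀ j t, ∫⁻ s in dyadicWindow j t, f s ≤ Φ := fun j t => setLIntegral_le_lintegral _ _
  rcases eq_or_ne Φ ∞ with hΦt | hΦt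
  · rw [hΦt, ENNReal.top_rpow_of_pos hκ, ENNReal.mul_top]
    · exact le_top
    · have : 0 < P ^ α * K := by positivity
      simpa using this
  rcases eq_or_ne Φ 0 with hΦ0 | hΦ0
  · have : ∀ j t, ∫⁻ s in dyadicWindow j t, f s = 0 := fun j t =>
      le_antisymm ((hI j t).trans hΦ0.le) bot_le
    simp [this, ENNReal.zero_rpow_of_pos hκ, ENNReal.zero_rpow_of_pos hα]
  rcases eq_or_ne r 0 with rfl | hr
  · simp
  have hr0 : (0 : ℝ) < r := by positivity
  set φ : ℝ := Φ.toReal with hφ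
  have hφ0 : 0 < φ := ENNReal.toReal_pos hΦ0 hΦt
  have hΦφ : Φ = ENNReal.ofReal φ := (ENNReal.ofReal_toReal hΦt).symm
  set X : ℝ := (K * φ ^ κ / r) ^ (1 / α) with hX
  have hX0 : 0 < X := by positivity
  have hXα : X ^ α = K * φ ^ κ / r := by
    rw [hX, ← Real.rpow_mul (by positivity), one_div_mul_cancel hα.ne', Real.rpow_one]
  obtain ⟨J, hXJ, hJX⟩ : ∃ J : ℤ, X ≤ 2 ^ J ∧ (2 : ℝ) ^ J ≤ 2 * X := by
    obtain ⟨n, hn⟩ := exists_mem_Ioc_zpow hX0 one_lt_two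
    refine ⟨n + 1, hn.2, ?_⟩
    rw [zpow_add_one₀ two_ne_zero]
    linarith [hn.1]
  set y : ℝ := 2 ^ J with hy
  have hy0 : 0 < y := by positivity
  set a : ℤ → ℝ → ℝ≥0∞ := fun j t =>
    ENNReal.ofReal ((2 ^ j) ^ (-α)) * (∫⁻ s in dyadicWindow j t, f s) ^ κ with ha
  -- the long windows
  have hlong : ∀ t, ∑' n : ℕ, a (n + J) t ≤ ENNReal.ofReal (r / 2) := by
    intro t
    calc ∑' n : ℕ, a (n + J) t ≤ ∑' n : ℕ, ENNReal.ofReal (y ^ (-α) * φ ^ κ * ρ ^ n) := by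
          refine ENNReal.tsum_le_tsum fun n => ?_
          simp only [ha]
          calc _ ≤ ENNReal.ofReal ((2 ^ ((n : ℤ) + J)) ^ (-α)) * Φ ^ κ := by
                gcongr
                exact hI _ _
            _ = _ := by
                rw [hΦφ, ENNReal.ofReal_rpow_of_pos hφ0, ← ENNReal.ofReal_mul (by positivity)]
                congr 1
                rw [zpow_add₀ two_ne_zero, ← hy, Real.mul_rpow (by positivity) hy0.le, hρ,
                  zpow_natCast, ← Real.rpow_natCast, ← Real.rpow_natCast, ← Real.rpow_mul two_pos.le,
                  ← Real.rpow_mul two_pos.le, mul_comm (n : ℝ)]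
                ring
      _ = ENNReal.ofReal (∑' n : ℕ, y ^ (-α) * φ ^ κ * ρ ^ n) :=
          (ENNReal.ofReal_tsum_of_nonneg (fun n => by positivity)
            ((summable_geometric_of_lt_one hρ0.le hρ1).mul_left _)).symm
      _ ≤ ENNReal.ofReal (r / 2) := by
          refine ENNReal.ofReal_le_ofReal ?_
          rw [tsum_mul_left, tsum_geometric_of_lt_one hρ0.le hρ1]
          have h1 : y ^ (-α) ≤ X ^ (-α) := Real.rpow_le_rpow_of_nonpos hX0 hXJ (by linarith)
          have h2 : (1 - ρ)⁻¹ = K / 2 := by rw [hK]; ring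
          rw [h2]
          calc y ^ (-α) * φ ^ κ * (K / 2) ≤ X ^ (-α) * φ ^ κ * (K / 2) := by gcongr
            _ = r / 2 := by
                rw [Real.rpow_neg hX0.le, hXα]
                field_simp
  -- one of the short windows has to be large
  have hsub : {t | (r : ℝ≥0∞) < ∑' j : ℤ, a j t} ⊆
      ⋃ n : ℕ, {t | ENNReal.ofReal (r / 2 * c * ω ^ n) < a (-(n + 1) + J) t} := by
    intro t ht
    rw [mem_ofPred_eq, ← (Equiv.addRight J).tsum_eq,
      tsum_of_nat_of_neg_add_one ENNReal.summable ENNReal.summable] at ht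
    by_contra hne
    simp only [mem_iUnion, mem_ofPred_eq, not_exists, not_lt] at hne
    have h1 : ∑' n : ℕ, a (-(n + 1) + J) t ≤ ENNReal.ofReal (r / 2) := by
      refine (ENNReal.tsum_le_tsum hne).trans ?_
      rw [← ENNReal.ofReal_tsum_of_nonneg (fun n => by positivity)
        ((summable_geometric_of_lt_one hω0.le hω1).mul_left _), tsum_mul_left,
        tsum_geometric_of_lt_one hω0.le hω1, mul_assoc, ← hc, mul_inv_cancel₀ hc0.ne', mul_one]
    have h2 := ht.trans_le (add_le_add (hlong t) h1)
    rw [← ENNReal.ofReal_add (by positivity) (by positivity), add_halves,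
      ENNReal.ofReal_coe_nnreal] at h2
    exact lt_irrefl _ h2
  have hvol : volume {t | (r : ℝ≥0∞) < ∑' j : ℤ, a j t} ≤ ENNReal.ofReal (P * X) := by
    calc _ ≤ ∑' n : ℕ, volume {t | ENNReal.ofReal (r / 2 * c * ω ^ n) < a (-(n + 1) + J) t} :=
          (measure_mono hsub).trans (measure_iUnion_le _)
      _ ≤ ∑' n : ℕ, ENNReal.ofReal ((r * c / 2) ^ (-(1 / κ)) * y ^ (1 - α / κ) * φ * τ ^ n) := by
          refine ENNReal.tsum_le_tsum fun n => ?_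
          refine (volume_dyadicWindow_le hκ _ hf (by positivity)).trans ?_
          rw [← hΦ, hΦφ, ← ENNReal.ofReal_mul (by positivity)]
          refine ENNReal.ofReal_le_ofReal ?_
          have hz : (2 : ℝ) ^ (-((n : ℤ) + 1) + J) = 2 ^ (-((n : ℝ) + 1)) * y := by
            rw [zpow_add₀ two_ne_zero, ← hy, ← Real.rpow_intCast]
            push_cast
            rfl
          rw [hz]
          set w : ℝ := 2 ^ (-((n : ℝ) + 1)) with hw
          have hw0 : 0 < w := by positivity
          have h1 : (ω ^ n) ^ (-(1 / κ)) * w ^ (1 - α / κ) ≤ τ ^ n := by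
            rw [hω, hτ, hw, ← Real.rpow_natCast, ← Real.rpow_natCast, ← Real.rpow_mul two_pos.le,
              ← Real.rpow_mul two_pos.le, ← Real.rpow_mul two_pos.le, ← Real.rpow_mul two_pos.le,
              ← Real.rpow_add two_pos]
            refine Real.rpow_le_rpow_of_exponent_le one_le_two ?_
            have e1 : 1 - α / κ = 2 * (β / κ) := by rw [hβ]; field_simp
            have e2 : 0 ≤ β / κ := by positivity
            rw [e1]
            have : -β * n * -(1 / κ) = β / κ * n := by ring
            rw [this]
            nlinarith
          have h2 : (r / 2 * c * ω ^ n * (w * y) ^ α) ^ (-(1 / κ)) * (w * y) =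
              (r * c / 2) ^ (-(1 / κ)) * y ^ (1 - α / κ) *
                ((ω ^ n) ^ (-(1 / κ)) * w ^ (1 - α / κ)) := by
            rw [show r / 2 * c * ω ^ n * (w * y) ^ α = r * c / 2 * (ω ^ n * (w * y) ^ α) by ring,
              Real.mul_rpow (by positivity) (by positivity),
              Real.mul_rpow (by positivity) (by positivity), ← Real.rpow_mul (by positivity)]
            have e1 : (w * y) ^ (α * -(1 / κ)) * (w * y) = w ^ (1 - α / κ) * y ^ (1 - α / κ) := by
              rw [← Real.rpow_add_one (by positivity), ← Real.mul_rpow hw0.le hy0.le]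
              congr 1
              ring
            linear_combination (r * c / 2 : ℝ) ^ (-(1 / κ)) * (ω ^ n) ^ (-(1 / κ)) * e1
          rw [h2]
          calc _ ≤ (r * c / 2) ^ (-(1 / κ)) * y ^ (1 - α / κ) * τ ^ n * φ := by gcongr
            _ = _ := by ring
      _ = ENNReal.ofReal (∑' n : ℕ, (r * c / 2) ^ (-(1 / κ)) * y ^ (1 - α / κ) * φ * τ ^ n) :=
          (ENNReal.ofReal_tsum_of_nonneg (fun n => by positivity)
            ((summable_geometric_of_lt_one hτ0.le hτ1).mul_left _)).symm
      _ ≤ ENNReal.ofReal (P * X) := by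
          refine ENNReal.ofReal_le_ofReal ?_
          rw [tsum_mul_left, tsum_geometric_of_lt_one hτ0.le hτ1]
          have h1 : y ^ (1 - α / κ) ≤ (2 * X) ^ (1 - α / κ) :=
            Real.rpow_le_rpow hy0.le hJX (sub_nonneg.2 ((div_le_one hκ).2 hακ.le))
          have h2 : φ = r ^ (1 / κ) * X ^ (α / κ) * K ^ (-(1 / κ)) := by
            have : X ^ (α / κ) = K ^ (1 / κ) * φ * r ^ (-(1 / κ)) := by
              rw [div_eq_mul_one_div α, Real.rpow_mul hX0.le, hXα, Real.div_rpow (by positivity) hr0.le,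
                Real.mul_rpow hK0.le (by positivity), ← Real.rpow_mul hφ0.le,
                mul_one_div_cancel hκ.ne', Real.rpow_one, Real.rpow_neg hr0.le, div_eq_mul_inv]
            rw [this, Real.rpow_neg hr0.le, Real.rpow_neg hK0.le]
            field_simp
          have h3 : X ^ (1 - α / κ) * X ^ (α / κ) = X := by
            rw [← Real.rpow_add hX0, sub_add_cancel, Real.rpow_one]
          have h4 : (r : ℝ) ^ (-(1 / κ)) * r ^ (1 / κ) = 1 := by
            rw [← Real.rpow_add hr0, neg_add_cancel, Real.rpow_zero]
          have hτ2 := sub_pos.2 hτ1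
          calc _ ≤ (r * c / 2) ^ (-(1 / κ)) * (2 * X) ^ (1 - α / κ) * φ * (1 - τ)⁻¹ := by gcongr
            _ = (r ^ (-(1 / κ)) * r ^ (1 / κ)) * (X ^ (1 - α / κ) * X ^ (α / κ)) *
                ((c / 2) ^ (-(1 / κ)) * (1 - τ)⁻¹ * 2 ^ (1 - α / κ) * K ^ (-(1 / κ))) := by
                rw [mul_div_assoc, Real.mul_rpow hr0.le (by positivity),
                  Real.mul_rpow two_pos.le hX0.le]
                conv_lhs => rw [h2]
                ring
            _ = P * X := by rw [h3, h4, hP]; ring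
  calc _ ≤ (r : ℝ≥0∞) * ENNReal.ofReal (P * X) ^ α := by gcongr
    _ = ENNReal.ofReal (P ^ α * K) * Φ ^ κ := by
        rw [hΦφ, ENNReal.ofReal_rpow_of_pos hφ0, ENNReal.ofReal_rpow_of_pos (by positivity),
          ← ENNReal.ofReal_coe_nnreal, ← ENNReal.ofReal_mul hr0.le,
          ← ENNReal.ofReal_mul (by positivity), Real.mul_rpow hP0.le hX0.le, hXα]
        congr 1
        field_simp
    _ = _ := rfl

/-- A decomposition of every half-line `(-∞, t)` into countably many windows `W j t`, with a
length `δ j` attached to each index. That `W j t` stays at distance `δ j` from `t` is not required: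
in the case without a singularity at the diagonal, the half-line itself is a window. -/
structure IsWindowSystem (W : ℤ → ℝ → Set ℝ) (δ : ℤ → ℝ) : Prop where
  δ_pos : ∀ j, 0 < δ j
  measurableSet : ∀ j, MeasurableSet {p : ℝ × ℝ | p.2 ∈ W j p.1}
  pairwise_disjoint : ∀ t, Pairwise (Function.onFun Disjoint fun j => W j t)
  iUnion_eq : ∀ t, ⋃ j, W j t = Iio t

/-- The sum over the windows of the local bounds, for `f = ‖F‖ ^ (1 / κ)`. -/
noncomputable def windowSum (W : ℤ → ℝ → Set ℝ) (δ : ℤ → ℝ) (α κ : ℝ) (f : ℝ → ℝ≥0∞) (t : ℝ) :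
    ℝ≥0∞ :=
  ∑' j, ENNReal.ofReal (δ j ^ (-α)) * (∫⁻ s in W j t, f s) ^ κ

lemma IsWindowSystem.measurableSet_apply {W : ℤ → ℝ → Set ℝ} {δ : ℤ → ℝ}
    (hW : IsWindowSystem W δ) (j : ℤ) (t : ℝ) : MeasurableSet (W j t) :=
  measurable_prodMk_left (hW.measurableSet j)

lemma IsWindowSystem.subset_Iio {W : ℤ → ℝ → Set ℝ} {δ : ℤ → ℝ}
    (hW : IsWindowSystem W δ) (j : ℤ) (t : ℝ) : W j t ⊆ Iio t := by
  rw [← hW.iUnion_eq t]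
  exact subset_iUnion (fun j => W j t) j

/-- For `α > 0` the dyadic windows are used. For `α = 0` the local estimate holds up to the
diagonal, and the half-line is a single window. -/
lemma exists_isWindowSystem {α κ : ℝ} (hα : 0 ≤ α) (hακ : α < κ) {q : ℝ≥0∞}
    (hq : ENNReal.ofReal α = q⁻¹) :
    ∃ (W : ℤ → ℝ → Set ℝ) (δ : ℤ → ℝ), IsWindowSystem W δ ∧
      (α = 0 ∨ ∀ j t, W j t ⊆ Iic (t - δ j)) ∧
      ∃ C : ℝ≥0, ∀ f : ℝ → ℝ≥0∞, Measurable f →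
        weakLpNorm q (windowSum W δ α κ f) ≤ C * (∫⁻ s, f s) ^ κ := by
  rcases hα.eq_or_lt with rfl | hα
  · have hq' : q = ∞ := by
      rw [ENNReal.ofReal_zero] at hq
      exact ENNReal.inv_eq_zero.1 hq.symm
    refine ⟨fun j t => if j = 0 then Iio t else ∅, fun _ => 1, ⟨fun _ => one_pos, fun j => ?_,
      fun t i j hij => ?_, fun t => ?_⟩, Or.inl rfl, 1, fun f hf => ?_⟩
    · split_ifs
      · exact measurableSet_lt measurable_snd measurable_fst
      · simp
    · simp only [Function.onFun]
      split_ifs with h1 h2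
      · exact absurd (h1.trans h2.symm) hij
      all_goals simp
    · ext s
      simp
    · have : ∀ t, windowSum (fun j t => if j = 0 then Iio t else ∅) (fun _ => 1) 0 κ f t ≤
          (∫⁻ s, f s) ^ κ := fun t => by
        unfold windowSum
        rw [tsum_eq_single 0]
        · simp only [if_true, neg_zero, Real.rpow_zero, ENNReal.ofReal_one, one_mul]
          gcongr
          exact Measure.restrict_le_self
        · intro j hj
          simp [hj, ENNReal.zero_rpow_of_pos hακ]
      rw [weakLpNorm, if_pos hq', ENNReal.coe_one, one_mul]
      exact essSup_le_of_ae_le _ (ae_of_all _ this)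
  · obtain ⟨C, hC⟩ := exists_volume_tsum_dyadicWindow_le hα hακ
    have hqt : q ≠ ∞ := by
      rintro rfl
      simp [hα.not_ge] at hq
    have hqα : 1 / q.toReal = α := by
      rw [one_div, ← ENNReal.toReal_inv, ← hq, ENNReal.toReal_ofReal hα.le]
    refine ⟨dyadicWindow, fun j => 2 ^ j, ⟨fun j => by positivity, measurableSet_dyadicWindow,
      pairwise_disjoint_dyadicWindow, iUnion_dyadicWindow⟩, Or.inr fun j t => Ioc_subset_Iic_self,
      C, fun f hf => ?_⟩
    rw [weakLpNorm, if_neg hqt, hqα]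
    exact iSup_le fun r => hC f hf r

/-! ### Functionals on the spaces of the scale -/

section Dual

variable {𝕜 X Y V : Type*} [RCLike 𝕜] [NormedAddCommGroup X] [NormedSpace 𝕜 X]
  [NormedAddCommGroup Y] [NormedSpace 𝕜 Y]

/-- The functional in `Y^*` is determined by its values on `X ∩ Y`, if `X ∩ Y` is dense in `Y`. -/
lemma DualAgree.unique {i : X → V} {j : Y → V} (hd : Dense {y | ∃ x, i x = j y})
    {u : ConjDual 𝕜 X} {w w' : ConjDual 𝕜 Y} (hw : DualAgree i j u w) (hw' : DualAgree i j u w') :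
    w = w' := by
  refine DFunLike.coe_injective (Continuous.ext_on hd w.continuous w'.continuous ?_)
  rintro y ⟨x, hx⟩
  rw [← hw x y hx, ← hw' x y hx]

lemma norm_apply_le_of_dualENorm_le {i : X → V} {j : Y → V} {u : ConjDual 𝕜 X} {K : ℝ}
    (h : dualENorm i j u ≤ ENNReal.ofReal K) {x : X} {y : Y} (hxy : i x = j y) :
    ‖u x‖ₑ ≤ ENNReal.ofReal K * ‖y‖ₑ := by
  have : ‖u x‖ₑ ≤ dualENorm i j u * ‖y‖ₑ := by
    rcases eq_or_ne ‖y‖ₑ 0 with hy | hy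
    · have hy0 : y = 0 := by simpa using hy
      by_cases hne : ∃ w : ConjDual 𝕜 Y, DualAgree i j u w
      · obtain ⟨w, hw⟩ := hne
        simp [hw x y hxy, hy0]
      · push Not at hne
        have : dualENorm i j u = ∞ := by simp [dualENorm, hne]
        rw [this] at h
        exact absurd h (by simp)
    rw [← ENNReal.div_le_iff hy enorm_ne_top]
    refine le_iInf₂ fun w hw => ?_
    rw [ENNReal.div_le_iff hy enorm_ne_top, hw x y hxy]
    exact w.le_opENorm y
  exact this.trans (by gcongr)

variable [AddCommGroup V] [Module 𝕜 V]

/-- By the Hahn–Banach theorem, a functional on `X` that is bounded on `X ∩ Y` by the norm of `Y`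
lies in `Y^*`. -/
lemma exists_dualAgree (i : X →ₗ[𝕜] V) (hi : Function.Injective i) (j : Y →ₗ[𝕜] V)
    (u : ConjDual 𝕜 X) (K : ℝ≥0) (h : ∀ x y, i x = j y → ‖u x‖ ≤ K * ‖y‖) :
    ∃ w : ConjDual 𝕜 Y, DualAgree i j u w ∧ ‖w‖ ≤ K := by
  set p : Submodule 𝕜 Y := (LinearMap.range i).comap j with hp
  have hpx : ∀ y : p, ∃ x, i x = j y := fun y => y.2
  choose x hx using hpx
  set f : p →ₗ[𝕜] 𝕜 :=
    { toFun := fun y => star (u (x y))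
      map_add' := fun y z => by
        have : x (y + z) = x y + x z := hi (by simp [hx])
        rw [this, map_add, star_add]
      map_smul' := fun c y => by
        have : x (c • y) = c • x y := hi (by simp [hx])
        rw [this, map_smulₛₗ, smul_eq_mul, star_mul']
        simp } with hf
  have hfle : ∀ y, ‖f y‖ ≤ K * ‖y‖ := fun y => by
    simpa [hf] using h (x y) y (hx y)
  obtain ⟨g, hg, hgn⟩ := exists_extension_norm_eq p (f.mkContinuous K hfle)
  have hgK : ‖g‖ ≤ K := hgn ▸ f.mkContinuous_norm_le K.2 hfle
  have hgle : ∀ y, ‖star (g y)‖ ≤ K * ‖y‖ := fun y => by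
    rw [norm_star]
    exact (g.le_opNorm y).trans (by gcongr)
  set w : Y →ₗ⋆[𝕜] 𝕜 :=
    { toFun := fun y => star (g y)
      map_add' := fun y z => by rw [map_add, star_add]
      map_smul' := fun c y => by rw [map_smul, smul_eq_mul, star_mul']; simp } with hw
  refine ⟨w.mkContinuous K hgle, fun x' y hxy => ?_, w.mkContinuous_norm_le K.2 hgle⟩
  have h1 : g y = star (u (x ⟨y, x', hxy⟩)) := hg ⟨y, x', hxy⟩
  have h2 : x ⟨y, x', hxy⟩ = x' := hi (by rw [hx, hxy])
  change u x' = star (g y)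
  rw [h1, h2, star_star]

lemma dualENorm_le (i : X →ₗ[𝕜] V) (hi : Function.Injective i) (j : Y →ₗ[𝕜] V)
    (u : ConjDual 𝕜 X) (K : ℝ≥0∞) (h : ∀ x y, i x = j y → ‖u x‖ₑ ≤ K * ‖y‖ₑ) :
    dualENorm i j u ≤ K := by
  rcases eq_or_ne K ∞ with rfl | hK
  · exact le_top
  lift K to ℝ≥0 using hK
  obtain ⟨w, hw, hwK⟩ := exists_dualAgree i hi j u K fun x y hxy => by
    have := h x y hxy
    simp only [enorm_eq_nnnorm] at this
    exact_mod_cast this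
  refine (iInf₂_le w hw).trans ?_
  rw [enorm_eq_nnnorm]
  exact_mod_cast hwK

end Dual

namespace BanachCouple

variable {𝕜 B₀ B₁ V : Type*} [RCLike 𝕜]
  [NormedAddCommGroup B₀] [NormedSpace 𝕜 B₀] [NormedAddCommGroup B₁] [NormedSpace 𝕜 B₁]
  [AddCommGroup V] [Module 𝕜 V] [TopologicalSpace V] [IsTopologicalAddGroup V] [T2Space V]

/-- `B₀ ∩ B_θ` is dense in `B_θ` for `θ < 1`, and for `θ = 1` if `B₀ ∩ B₁` is dense in `B₁`. -/
lemma dense_interp (E : BanachCouple 𝕜 B₀ B₁ V) {θ : ℝ} (hθ : θ ∈ Icc (0 : ℝ) 1)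
    (h : θ = 1 → Dense {g₁ : B₁ | ∃ g₀ : B₀, E.ι₀ g₀ = E.ι₁ g₁}) :
    Dense {y : E.Interp θ | ∃ x, E.ι₀ x = E.incl θ y} := by
  suffices key : ∀ (y : E.Interp θ) (ε : ℝ≥0∞), ε ≠ 0 →
      ∃ x, E.interpENorm θ (E.incl θ y - E.ι₀ x) ≤ ε by
    intro y
    refine EMetric.mem_closure_iff.2 fun ε hε => ?_
    obtain ⟨ε', hε', hlt⟩ := exists_between (lt_min hε ENNReal.zero_lt_top)
    obtain ⟨x, hx⟩ := key y ε' hε'.ne'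
    have hfin : E.interpENorm θ (E.incl θ y - E.ι₀ x) < ∞ :=
      hx.trans_lt (hlt.trans_le (min_le_right _ _))
    set z : E.Interp θ := ⟨E.incl θ y - E.ι₀ x, hfin⟩ with hz
    have hzi : E.incl θ z = E.incl θ y - E.ι₀ x := rfl
    refine ⟨y - z, ⟨x, by rw [map_sub, hzi, sub_sub_cancel]⟩, ?_⟩
    rw [edist_eq_enorm_sub, sub_sub_cancel, ← interpENorm_incl, hzi]
    exact hx.trans_lt (hlt.trans_le (min_le_left _ _))
  intro y ε hε
  have hy : E.interpENorm θ (E.incl θ y) ≠ ∞ := y.2.ne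
  rcases hθ.1.eq_or_lt with rfl | h0
  · rw [interpENorm_at_zero, norm₀] at hy
    obtain ⟨x, hx⟩ : ∃ x, E.ι₀ x = E.incl 0 y := by
      by_contra hne
      push Not at hne
      exact hy (by simp [hne])
    exact ⟨x, by rw [hx, sub_self, interpENorm_zero]; exact bot_le⟩
  rcases hθ.2.eq_or_lt with rfl | h1
  · rw [interpENorm_at_one, norm₁] at hy
    obtain ⟨b, hb⟩ : ∃ b, E.ι₁ b = E.incl 1 y := by
      by_contra hne
      push Not at hne
      exact hy (by simp [hne])
    obtain ⟨b', ⟨x, hx⟩, hlt⟩ := EMetric.mem_closure_iff.1 (h rfl b) ε hε.bot_lt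
    refine ⟨x, ?_⟩
    rw [interpENorm_at_one, ← hb, hx, ← map_sub]
    refine (E.norm₁_le _ rfl).trans ?_
    rw [← edist_eq_enorm_sub]
    exact hlt.le
  · exact E.exists_interpENorm_sub_le h0 h1 hy hε

/-- The functions with values in `B₀ ∩ B_θ` that are integrable in `B₀` are dense in `L^p B_θ`. -/
lemma exists_integrable_approx (E : BanachCouple 𝕜 B₀ B₁ V) {θ : ℝ}
    (hd : Dense {y : E.Interp θ | ∃ x, E.ι₀ x = E.incl θ y}) {μ : Measure ℝ} {p : ℝ≥0∞}
    (hp : p ≠ ∞) {F : ℝ → E.Interp θ} (hF : MemLp F p μ) {ε : ℝ≥0∞} (hε : ε ≠ 0) :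
    ∃ G : ℝ → E.Interp θ, eLpNorm (F - G) p μ ≤ ε ∧ MemLp G p μ ∧
      ∃ G₀ : ℝ → B₀, Integrable G₀ μ ∧ ∀ s, E.ι₀ (G₀ s) = E.incl θ (G s) := by
  refine hF.induction_dense hp (fun G => MemLp G p μ ∧
    ∃ G₀ : ℝ → B₀, Integrable G₀ μ ∧ ∀ s, E.ι₀ (G₀ s) = E.incl θ (G s)) ?_ ?_ ?_ hε
  · intro c s hs hμs ε hε
    have hε' : ε / (μ s ^ (1 / p.toReal) + 1) ≠ 0 := by
      refine (ENNReal.div_pos hε ?_).ne'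
      have := ENNReal.rpow_ne_top_of_nonneg (by positivity : 0 ≤ 1 / p.toReal) hμs.ne
      finiteness
    obtain ⟨c', ⟨x, hx⟩, hlt⟩ := EMetric.mem_closure_iff.1 (hd c) _ hε'.bot_lt
    refine ⟨s.indicator fun _ => c', ?_, memLp_indicator_const p hs c' (Or.inr hμs.ne),
      s.indicator fun _ => x, (integrable_indicator_iff hs).2 (integrableOn_const hμs.ne),
      fun t => ?_⟩
    · rw [← indicator_sub']
      refine (eLpNorm_indicator_const_le (c' - c) p).trans ?_
      rw [← edist_eq_enorm_sub, edist_comm]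
      have h1 := ENNReal.rpow_ne_top_of_nonneg (by positivity : 0 ≤ 1 / p.toReal) hμs.ne
      calc _ ≤ ε / (μ s ^ (1 / p.toReal) + 1) * (μ s ^ (1 / p.toReal) + 1) :=
            mul_le_mul' hlt.le le_self_add
        _ = ε := ENNReal.div_mul_cancel (by simp) (by finiteness)
    · by_cases ht : t ∈ s <;> simp [ht, hx]
  · rintro F G ⟨hF, F₀, hF₀, hFF⟩ ⟨hG, G₀, hG₀, hGG⟩
    exact ⟨hF.add hG, F₀ + G₀, hF₀.add hG₀, fun s => by simp [hFF, hGG]⟩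
  · exact fun G hG => hG.1.1

end BanachCouple

namespace BanachCouple

variable {𝕜 B₀ B₁ V : Type*} [RCLike 𝕜]
  [NormedAddCommGroup B₀] [NormedSpace 𝕜 B₀] [NormedAddCommGroup B₁] [NormedSpace 𝕜 B₁]
  [AddCommGroup V] [Module 𝕜 V] [TopologicalSpace V] [IsTopologicalAddGroup V] [T2Space V]

/-- The pairs of functions in `L^p B_θ` and in `L¹ B₀` that agree almost everywhere in `V`. -/
def agreeingPairs (E : BanachCouple 𝕜 B₀ B₁ V) (θ : ℝ) (p : ℝ≥0∞) (μ : Measure ℝ) :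
    Submodule 𝕜 (Lp (E.Interp θ) p μ × Lp B₀ 1 μ) where
  carrier := {z | ∀ᵐ s ∂μ, E.ι₀ (z.2 s) = E.incl θ (z.1 s)}
  add_mem' {z w} hz hw := by
    rw [mem_ofPred_eq] at *
    filter_upwards [hz, hw, Lp.coeFn_add z.1 w.1, Lp.coeFn_add z.2 w.2] with s h1 h2 h3 h4
    rw [Prod.fst_add, Prod.snd_add, h3, h4, Pi.add_apply, Pi.add_apply, map_add, map_add, h1, h2]
  zero_mem' := by
    rw [mem_ofPred_eq]
    filter_upwards [Lp.coeFn_zero (E.Interp θ) p μ, Lp.coeFn_zero B₀ 1 μ] with s h3 h4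
    rw [Prod.fst_zero, Prod.snd_zero, h3, h4, Pi.zero_apply, Pi.zero_apply, map_zero, map_zero]
  smul_mem' c z hz := by
    rw [mem_ofPred_eq] at *
    filter_upwards [hz, Lp.coeFn_smul c z.1, Lp.coeFn_smul c z.2] with s h1 h3 h4
    rw [Prod.smul_fst, Prod.smul_snd, h3, h4, Pi.smul_apply, Pi.smul_apply, map_smul, map_smul, h1]

/-- An operator on `L¹ B₀` with values in `B₀^*` that is bounded from `L^p B_θ'` to `B_θ^*`
extends to all of `L^p B_θ'`. -/
lemma exists_clm_of_bound (E : BanachCouple 𝕜 B₀ B₁ V) {θ θ' : ℝ}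
    (hd : Dense {y : E.Interp θ | ∃ x, E.ι₀ x = E.incl θ y})
    (hd' : Dense {y : E.Interp θ' | ∃ x, E.ι₀ x = E.incl θ' y}) {μ : Measure ℝ} {p : ℝ≥0∞}
    [Fact (1 ≤ p)] (hp : p ≠ ∞) (Φ : Lp B₀ 1 μ →ₗ[𝕜] ConjDual 𝕜 B₀) (K : ℝ≥0)
    (hΦ : ∀ (F₀ : Lp B₀ 1 μ) (F : Lp (E.Interp θ') p μ),
      (∀ᵐ s ∂μ, E.ι₀ (F₀ s) = E.incl θ' (F s)) →
      ∀ (x : B₀) (y : E.Interp θ), E.ι₀ x = E.incl θ y → ‖Φ F₀ x‖ ≤ K * ‖F‖ * ‖y‖) :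
    ∃ S : Lp (E.Interp θ') p μ →L[𝕜] ConjDual 𝕜 (E.Interp θ), (∀ F, ‖S F‖ ≤ K * ‖F‖) ∧
      ∀ (F₀ : Lp B₀ 1 μ) (F : Lp (E.Interp θ') p μ),
        (∀ᵐ s ∂μ, E.ι₀ (F₀ s) = E.incl θ' (F s)) →
        DualAgree E.ι₀ (E.incl θ) (Φ F₀) (S F) := by
  have hw : ∀ z : E.agreeingPairs θ' p μ, ∃ w : ConjDual 𝕜 (E.Interp θ),
      DualAgree E.ι₀ (E.incl θ) (Φ z.1.2) w ∧ ‖w‖ ≤ K * ‖z.1.1‖ := fun z =>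
    exists_dualAgree (E.ι₀ : B₀ →ₗ[𝕜] V) E.injective₀ (E.incl θ) (Φ z.1.2) (K * ‖z.1.1‖₊)
      (hΦ z.1.2 z.1.1 z.2)
  choose w hwa hwn using hw
  set f : E.agreeingPairs θ' p μ →ₗ[𝕜] ConjDual 𝕜 (E.Interp θ) :=
    { toFun := w
      map_add' := fun z z' => (hwa (z + z')).unique hd fun x y hxy => by
        rw [Submodule.coe_add, Prod.snd_add, map_add, add_apply,
          add_apply, hwa z x y hxy, hwa z' x y hxy]
      map_smul' := fun c z => (hwa (c • z)).unique hd fun x y hxy => by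
        rw [Submodule.coe_smul, Prod.smul_snd, map_smul, smul_apply,
          RingHom.id_apply, smul_apply, hwa z x y hxy] } with hf
  set e : E.agreeingPairs θ' p μ →ₗ[𝕜] Lp (E.Interp θ') p μ :=
    LinearMap.fst 𝕜 _ _ ∘ₗ (E.agreeingPairs θ' p μ).subtype with he
  have hle : ∀ z, ‖f z‖ ≤ K * ‖e z‖ := hwn
  have hde : DenseRange e := by
    intro F
    refine EMetric.mem_closure_iff.2 fun ε hε => ?_
    obtain ⟨ε', hε', hlt⟩ := exists_between hε
    obtain ⟨G, hFG, hG, G₀, hG₀, hGG⟩ :=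
      E.exists_integrable_approx hd' hp (Lp.memLp F) hε'.ne'
    have hG₀' := memLp_one_iff_integrable.2 hG₀
    refine ⟨hG.toLp G, ⟨⟨(hG.toLp G, hG₀'.toLp G₀), ?_⟩, rfl⟩, ?_⟩
    · change ∀ᵐ s ∂μ, _
      filter_upwards [hG.coeFn_toLp, hG₀'.coeFn_toLp] with s h1 h2
      rw [h1, h2, hGG]
    · refine lt_of_le_of_lt ?_ hlt
      rw [Lp.edist_def]
      refine le_trans (le_of_eq (eLpNorm_congr_ae ?_)) hFG
      filter_upwards [hG.coeFn_toLp] with s h1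
      rw [Pi.sub_apply, Pi.sub_apply, h1]
  refine ⟨f.extendOfNorm e, f.norm_extendOfNorm_apply_le hde K hle, fun F₀ F hFF => ?_⟩
  have h1 := f.extendOfNorm_eq hde ⟨K, hle⟩ ⟨(F, F₀), hFF⟩
  change f.extendOfNorm e F = w _ at h1
  rw [h1]
  exact hwa ⟨(F, F₀), hFF⟩

end BanachCouple

/-! ### The retarded operator -/

lemma eLpNorm_eq_lintegral_rpow_of_inv_eq {X : Type*} [NormedAddCommGroup X] {p : ℝ≥0∞} {κ : ℝ}
    (hκ : 0 < κ) (hp : p⁻¹ = ENNReal.ofReal κ) (F : ℝ → X) (μ : Measure ℝ) :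
    eLpNorm F p μ = (∫⁻ s, ‖F s‖ₑ ^ (1 / κ) ∂μ) ^ κ := by
  have h0 : p ≠ 0 := by rintro rfl; simp at hp
  have ht : p ≠ ∞ := by rintro rfl; simp [hκ.not_ge, eq_comm] at hp
  have hr : p.toReal = 1 / κ := by
    rw [← inv_inv p, hp, ENNReal.toReal_inv, ENNReal.toReal_ofReal hκ.le, one_div]
  rw [eLpNorm_eq_lintegral_rpow_enorm_toReal h0 ht, hr, one_div_one_div]

lemma tendsto_conjDual_apply {𝕜 Y : Type*} [RCLike 𝕜] [NormedAddCommGroup Y] [NormedSpace 𝕜 Y]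
    {w : ℕ → ConjDual 𝕜 Y} {w' : ConjDual 𝕜 Y} {y : ℕ → Y} {y' : Y}
    (hw : Tendsto w atTop (𝓝 w')) (hy : Tendsto y atTop (𝓝 y')) :
    Tendsto (fun n => w n (y n)) atTop (𝓝 (w' y')) := by
  have h1 : Tendsto (fun n => (w n - w') (y n)) atTop (𝓝 0) := by
    refine squeeze_zero_norm (fun n => (w n - w').le_opNorm (y n)) ?_
    simpa using (tendsto_iff_norm_sub_tendsto_zero.1 hw).mul hy.norm
  simpa using h1.add ((w'.continuous.tendsto y').comp hy)

namespace BanachCouple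

variable {𝕜 H B₀ B₁ V : Type*} [RCLike 𝕜]
  [NormedAddCommGroup H] [InnerProductSpace 𝕜 H] [CompleteSpace H]
  [NormedAddCommGroup B₀] [NormedSpace 𝕜 B₀] [NormedAddCommGroup B₁] [NormedSpace 𝕜 B₁]
  [AddCommGroup V] [Module 𝕜 V] [TopologicalSpace V]

lemma hasSum_retarded [NormedSpace ℝ H] {E : BanachCouple 𝕜 B₀ B₁ V} {σ A D : ℝ}
    {U : ℝ → H →L[𝕜] ConjDual 𝕜 B₀} (hL : E.IsDispersive σ A D fun s => preAdjoint (U s))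
    {W : ℤ → ℝ → Set ℝ} {δ : ℤ → ℝ} (hW : IsWindowSystem W δ) {F₀ : ℝ → B₀} {t : ℝ}
    (hF₀ : IntegrableOn F₀ (Iio t)) :
    HasSum (fun j => U t (∫ s in W j t, preAdjoint (U s) (F₀ s))) (retarded U F₀ t) := by
  have hint := hL.integrableOn hF₀
  rw [retarded, (U t).integral_comp_comm hint, ← hW.iUnion_eq t]
  refine (hasSum_integral_iUnion (fun j => hW.measurableSet_apply j t) (hW.pairwise_disjoint t)
    ?_).mapL (U t)
  rwa [hW.iUnion_eq t]

variable [IsTopologicalAddGroup V] [T2Space V]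

/-- The bound for the part of the retarded operator that comes from one window. -/
def WindowBound [NormedSpace ℝ H] (E : BanachCouple 𝕜 B₀ B₁ V) (U : ℝ → H →L[𝕜] ConjDual 𝕜 B₀)
    (W : ℤ → ℝ → Set ℝ) (δ : ℤ → ℝ) (θ θ' α κ : ℝ) (C : ℝ≥0) : Prop :=
  ∀ (j : ℤ) (t : ℝ) (F₀ : ℝ → B₀) (F : ℝ → E.Interp θ') (x : B₀) (y : E.Interp θ),
    IntegrableOn F₀ (W j t) → AEStronglyMeasurable F (volume.restrict (W j t)) →
    (∀ᵐ s ∂volume.restrict (W j t), E.ι₀ (F₀ s) = E.incl θ' (F s)) → E.ι₀ x = E.incl θ y →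
    ‖U t (∫ s in W j t, preAdjoint (U s) (F₀ s)) x‖ₑ ≤
      C * ENNReal.ofReal (δ j ^ (-α)) * (∫⁻ s in W j t, ‖F s‖ₑ ^ (1 / κ)) ^ κ * ‖y‖ₑ

section

variable [NormedSpace ℝ H] {E : BanachCouple 𝕜 B₀ B₁ V} {σ A D : ℝ}
  {U : ℝ → H →L[𝕜] ConjDual 𝕜 B₀}
  {W : ℤ → ℝ → Set ℝ} {δ : ℤ → ℝ} {θ θ' α κ : ℝ} {C : ℝ≥0}

lemma dualENorm_retarded_le (hL : E.IsDispersive σ A D fun s => preAdjoint (U s))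
    (hW : IsWindowSystem W δ) (hC : E.WindowBound U W δ θ θ' α κ C) {F₀ : ℝ → B₀}
    {F : ℝ → E.Interp θ'} {t : ℝ} (hF₀ : IntegrableOn F₀ (Iio t))
    (hF : AEStronglyMeasurable F volume) (hFF : ∀ᵐ s, E.ι₀ (F₀ s) = E.incl θ' (F s)) :
    dualENorm (Y := E.Interp θ) E.ι₀ (E.incl θ) (retarded U F₀ t) ≤
      C * windowSum W δ α κ (fun s => ‖F s‖ₑ ^ (1 / κ)) t := by
  refine dualENorm_le (E.ι₀ : B₀ →ₗ[𝕜] V) E.injective₀ (E.incl θ) _ _ fun x y hxy => ?_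
  have hsum : HasSum (fun j => U t (∫ s in W j t, preAdjoint (U s) (F₀ s)) x)
      (retarded U F₀ t x) :=
    (hasSum_retarded hL hW hF₀).map
      ({ toFun := fun u => u x, map_zero' := rfl, map_add' := fun _ _ => rfl } :
        ConjDual 𝕜 B₀ →+ 𝕜) (continuous_eval_const x)
  rw [← hsum.tsum_eq, windowSum, ← ENNReal.tsum_mul_left, ← ENNReal.tsum_mul_right]
  refine (enorm_tsum_le_tsum_enorm).trans (ENNReal.tsum_le_tsum fun j => ?_)
  refine (hC j t F₀ F x y (hF₀.mono_set (hW.subset_Iio j t)) hF.restrict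
    (ae_restrict_of_ae hFF) hxy).trans (le_of_eq ?_)
  ring

/-- The operators that extend the parts of the retarded operator coming from the windows. -/
lemma exists_window_operator (hL : E.IsDispersive σ A D fun s => preAdjoint (U s))
    (hC : E.WindowBound U W δ θ θ' α κ C)
    (hd : Dense {y : E.Interp θ | ∃ x, E.ι₀ x = E.incl θ y})
    (hd' : Dense {y : E.Interp θ' | ∃ x, E.ι₀ x = E.incl θ' y}) {p : ℝ≥0∞} [Fact (1 ≤ p)]
    (hκ : 0 < κ) (hp : p⁻¹ = ENNReal.ofReal κ) (j : ℤ) (t : ℝ) :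
    ∃ S : Lp (E.Interp θ') p volume →L[𝕜] ConjDual 𝕜 (E.Interp θ),
      (∀ F, ‖S F‖ₑ ≤
        C * (ENNReal.ofReal (δ j ^ (-α)) * (∫⁻ s in W j t, ‖F s‖ₑ ^ (1 / κ)) ^ κ)) ∧
      ∀ (F₀ : ℝ → B₀) (F : Lp (E.Interp θ') p volume), IntegrableOn F₀ (W j t) →
        (∀ᵐ s ∂volume.restrict (W j t), E.ι₀ (F₀ s) = E.incl θ' (F s)) →
        DualAgree E.ι₀ (E.incl θ) (U t (∫ s in W j t, preAdjoint (U s) (F₀ s))) (S F) := by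
  have hpt : p ≠ ∞ := by rintro rfl; simp [hκ.not_ge, eq_comm] at hp
  set μ := volume.restrict (W j t) with hμ
  have hint : ∀ F₀ : Lp B₀ 1 μ, Integrable (fun s => preAdjoint (U s) (F₀ s)) μ := fun F₀ =>
    hL.integrableOn (memLp_one_iff_integrable.1 (Lp.memLp F₀))
  set Φ : Lp B₀ 1 μ →ₗ[𝕜] ConjDual 𝕜 B₀ :=
    { toFun := fun F₀ => U t (∫ s, preAdjoint (U s) (F₀ s) ∂μ)
      map_add' := fun F₀ G₀ => by
        rw [← map_add, ← integral_add (hint F₀) (hint G₀)]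
        congr 1
        refine integral_congr_ae ?_
        filter_upwards [Lp.coeFn_add F₀ G₀] with s hs
        rw [hs, Pi.add_apply, map_add]
      map_smul' := fun c F₀ => by
        rw [RingHom.id_apply, ← map_smul, ← integral_smul]
        congr 1
        refine integral_congr_ae ?_
        filter_upwards [Lp.coeFn_smul c F₀] with s hs
        rw [hs, Pi.smul_apply, map_smul] } with hΦ
  set K : ℝ≥0 := C * (δ j ^ (-α)).toNNReal with hK
  have hKe : (K : ℝ≥0∞) = C * ENNReal.ofReal (δ j ^ (-α)) := by rw [hK, ENNReal.coe_mul]; rfl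
  obtain ⟨S, hS, hSa⟩ := E.exists_clm_of_bound hd hd' hpt Φ K fun F₀ F hFF x y hxy => by
    have h := hC j t F₀ F x y (memLp_one_iff_integrable.1 (Lp.memLp F₀))
      (Lp.aestronglyMeasurable F) hFF hxy
    rw [← hKe, ← eLpNorm_eq_lintegral_rpow_of_inv_eq hκ hp, ← Lp.enorm_def] at h
    simp only [enorm_eq_nnnorm] at h
    exact_mod_cast h
  refine ⟨S.comp (LpToLpRestrictCLM ℝ (E.Interp θ') 𝕜 volume p (W j t)), fun F => ?_,
    fun F₀ F hF₀ hFF => ?_⟩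
  · have h1 := hS (LpToLpRestrictCLM ℝ (E.Interp θ') 𝕜 volume p (W j t) F)
    have h2 : ‖S (LpToLpRestrictCLM ℝ (E.Interp θ') 𝕜 volume p (W j t) F)‖ₑ ≤
        K * ‖LpToLpRestrictCLM ℝ (E.Interp θ') 𝕜 volume p (W j t) F‖ₑ := by
      simp only [enorm_eq_nnnorm]
      exact_mod_cast h1
    rw [Lp.enorm_def, eLpNorm_congr_ae (LpToLpRestrictCLM_coeFn 𝕜 (W j t) F),
      eLpNorm_eq_lintegral_rpow_of_inv_eq hκ hp, hKe, mul_assoc] at h2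
    exact h2
  · have hF₀' := memLp_one_iff_integrable.2 hF₀
    have h1 := hSa (hF₀'.toLp F₀) (LpToLpRestrictCLM ℝ (E.Interp θ') 𝕜 volume p (W j t) F) (by
      filter_upwards [hF₀'.coeFn_toLp, LpToLpRestrictCLM_coeFn 𝕜 (W j t) F, hFF] with s h1 h2 h3
      rw [h1, h2, h3])
    have h2 : Φ (hF₀'.toLp F₀) = U t (∫ s in W j t, preAdjoint (U s) (F₀ s)) := by
      change U t (∫ s in W j t, preAdjoint (U s) (hF₀'.toLp F₀ s)) = _
      congr 1
      refine integral_congr_ae ?_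
      filter_upwards [hF₀'.coeFn_toLp] with s hs
      rw [hs]
    rw [← h2]
    exact h1

/-- Weak-`*` measurability: the values are limits of `⟪U^*(t) xₙ, ∫ U^*(s) Fₙ(s) ds⟫` for `xₙ` in
`B₀` and integrable `Fₙ` with values in `B₀`. -/
lemma aestronglyMeasurable_window_operator
    (hL : E.IsDispersive σ A D fun s => preAdjoint (U s)) (hW : IsWindowSystem W δ)
    (hd : Dense {y : E.Interp θ | ∃ x, E.ι₀ x = E.incl θ y})
    (hd' : Dense {y : E.Interp θ' | ∃ x, E.ι₀ x = E.incl θ' y}) {p : ℝ≥0∞} [Fact (1 ≤ p)]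
    (hp : p ≠ ∞) (j : ℤ)
    {S : ℝ → Lp (E.Interp θ') p volume →L[𝕜] ConjDual 𝕜 (E.Interp θ)}
    (hS : ∀ (t : ℝ) (F₀ : ℝ → B₀) (F : Lp (E.Interp θ') p volume), IntegrableOn F₀ (W j t) →
      (∀ᵐ s ∂volume.restrict (W j t), E.ι₀ (F₀ s) = E.incl θ' (F s)) →
      DualAgree E.ι₀ (E.incl θ) (U t (∫ s in W j t, preAdjoint (U s) (F₀ s))) (S t F))
    (F : Lp (E.Interp θ') p volume) (y : E.Interp θ) :
    AEStronglyMeasurable (fun t => S t F y) volume := by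
  have hε : ∀ n : ℕ, ((n : ℝ≥0∞) + 1)⁻¹ ≠ 0 := fun n => by simp
  choose G hFG hG G₀ hG₀ hGG using fun n : ℕ =>
    E.exists_integrable_approx hd' hp (Lp.memLp F) (hε n)
  obtain ⟨y', hy'd, hy'⟩ := mem_closure_iff_seq_limit.1 (hd y)
  choose x hx using hy'd
  have hlimG : Tendsto (fun n => (hG n).toLp (G n)) atTop (𝓝 F) := by
    rw [tendsto_iff_edist_tendsto_0]
    have h0 : Tendsto (fun n : ℕ => ((n : ℝ≥0∞) + 1)⁻¹) atTop (𝓝 0) := by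
      simpa using (tendsto_add_atTop_iff_nat 1).2 ENNReal.tendsto_inv_nat_nhds_zero
    refine tendsto_of_tendsto_of_tendsto_of_le_of_le tendsto_const_nhds h0 (fun _ => bot_le)
      fun n => ?_
    rw [edist_comm, Lp.edist_def]
    refine le_trans (le_of_eq (eLpNorm_congr_ae ?_)) (hFG n)
    filter_upwards [(hG n).coeFn_toLp] with s h1
    rw [Pi.sub_apply, Pi.sub_apply, h1]
  refine aestronglyMeasurable_of_tendsto_ae (u := atTop)
    (f := fun n t => U t (∫ s in W j t, preAdjoint (U s) (G₀ n s)) (x n)) (fun n => ?_)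
    (ae_of_all _ fun t => ?_)
  · simp_rw [← inner_preAdjoint]
    refine (hL.aestronglyMeasurable_apply (x n)).inner ?_
    have h1 : AEStronglyMeasurable (fun s => preAdjoint (U s) (G₀ n s)) volume := by
      simpa using hL.aestronglyMeasurable (W := univ) (by simpa using (hG₀ n).1)
    set v := h1.mk _ with hv
    have h2 : ∀ t, ∫ s in W j t, preAdjoint (U s) (G₀ n s) =
        ∫ s, {q : ℝ × ℝ | q.2 ∈ W j q.1}.indicator (fun q => v q.2) (t, s) := fun t => by
      rw [integral_congr_ae (ae_restrict_of_ae h1.ae_eq_mk),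
        ← integral_indicator (hW.measurableSet_apply j t)]
      rfl
    simp_rw [h2]
    exact ((h1.stronglyMeasurable_mk.comp_measurable measurable_snd).indicator
      (hW.measurableSet j)).integral_prod_right'.aestronglyMeasurable
  · have h1 : ∀ n, U t (∫ s in W j t, preAdjoint (U s) (G₀ n s)) (x n) =
        S t ((hG n).toLp (G n)) (y' n) := fun n => by
      refine hS t (G₀ n) _ (hG₀ n).integrableOn ?_ (x n) (y' n) (hx n)
      filter_upwards [ae_restrict_of_ae (hG n).coeFn_toLp] with s hs
      rw [hs, hGG]
    simp_rw [h1]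
    exact tendsto_conjDual_apply (((S t).continuous.tendsto F).comp hlimG) hy'

end

end BanachCouple

namespace BanachCouple

variable {𝕜 H B₀ B₁ V : Type*} [RCLike 𝕜]
  [NormedAddCommGroup H] [InnerProductSpace 𝕜 H] [CompleteSpace H]
  [NormedAddCommGroup B₀] [NormedSpace 𝕜 B₀] [NormedAddCommGroup B₁] [NormedSpace 𝕜 B₁]
  [AddCommGroup V] [Module 𝕜 V] [TopologicalSpace V]

/-- The energy estimate and the dispersive estimate pass from `U` to its adjoint. The constants are
increased to be positive. -/
lemma exists_isDispersive (E : BanachCouple 𝕜 B₀ B₁ V) {σ : ℝ} {U : ℝ → H →L[𝕜] ConjDual 𝕜 B₀}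
    (hmeas : ∀ g : B₀, AEStronglyMeasurable (fun s => preAdjoint (U s) g) volume)
    (henergy : ∃ A : ℝ, ∀ (t : ℝ) (f : H), ‖U t f‖ ≤ A * ‖f‖)
    (hdisp : ∃ D : ℝ, ∀ t s : ℝ, t ≠ s → ∀ (g₀ : B₀) (g₁ : B₁), E.ι₀ g₀ = E.ι₁ g₁ →
      dualENorm (Y := B₁) E.ι₀ E.ι₁ (U t (preAdjoint (U s) g₀))
        ≤ ENNReal.ofReal (D * |t - s| ^ (-σ) * ‖g₁‖)) :
    ∃ A D : ℝ, E.IsDispersive σ A D fun s => preAdjoint (U s) := by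
  obtain ⟨A, hA⟩ := henergy
  obtain ⟨D, hD⟩ := hdisp
  have htop : ∀ x, (¬∃ x₁, E.ι₁ x₁ = E.ι₀ x) → E.norm₁ (E.ι₀ x) = ∞ := fun x hx => by
    push Not at hx
    simp [norm₁, hx]
  have hzero : ∀ x, E.norm₁ (E.ι₀ x) = 0 → x = 0 := fun x hx => by
    by_cases hx₁ : ∃ x₁, E.ι₁ x₁ = E.ι₀ x
    · obtain ⟨x₁, hx₁⟩ := hx₁
      rw [← hx₁, norm₁_ι₁, enorm_eq_zero] at hx
      exact E.injective₀ (by rw [← hx₁, hx, map_zero, map_zero])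
    · rw [htop x hx₁] at hx
      exact absurd hx (by simp)
  refine ⟨max A 1, max D 1, by positivity, by positivity, hmeas, fun s g => ?_,
    fun t s hts x y => ?_⟩
  · have h1 : ‖preAdjoint (U s) g‖ ^ 2 ≤ max A 1 * ‖preAdjoint (U s) g‖ * ‖g‖ := by
      have h0 : ‖preAdjoint (U s) g‖ ^ 2 =
          ‖inner 𝕜 (preAdjoint (U s) g) (preAdjoint (U s) g)‖ := by
        rw [inner_self_eq_norm_sq_to_K]
        simp
      rw [h0, inner_preAdjoint]
      refine ((U s (preAdjoint (U s) g)).le_opNorm g).trans ?_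
      gcongr
      exact (hA s _).trans (by gcongr; exact le_max_left _ _)
    have h2 : ‖preAdjoint (U s) g‖ ≤ max A 1 * ‖g‖ := by
      rcases (norm_nonneg (preAdjoint (U s) g)).eq_or_lt with h | h
      · rw [← h]; positivity
      · nlinarith
    rw [← ofReal_norm, ← ofReal_norm, ← ENNReal.ofReal_mul (by positivity)]
    exact ENNReal.ofReal_le_ofReal h2
  · have hts' : 0 < |t - s| := abs_pos.2 (sub_ne_zero.2 hts)
    have hc : ENNReal.ofReal (max D 1 * |t - s| ^ (-σ)) ≠ 0 := by
      have : 0 < max D 1 * |t - s| ^ (-σ) := by positivity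
      simpa using this
    by_cases hx : ∃ x₁, E.ι₁ x₁ = E.ι₀ x
    swap
    · rw [htop x hx]
      rcases eq_or_ne (E.norm₁ (E.ι₀ y)) 0 with h0 | h0
      · simp [hzero y h0]
      · rw [ENNReal.mul_top (mul_ne_zero hc h0)]
        exact le_top
    by_cases hy : ∃ y₁, E.ι₁ y₁ = E.ι₀ y
    swap
    · rw [htop y hy]
      rcases eq_or_ne (E.norm₁ (E.ι₀ x)) 0 with h0 | h0
      · simp [hzero x h0]
      · rw [ENNReal.mul_top hc, ENNReal.top_mul h0]
        exact le_top
    obtain ⟨x₁, hx⟩ := hx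
    obtain ⟨y₁, hy⟩ := hy
    have h1 := norm_apply_le_of_dualENorm_le (hD t s hts x x₁ hx.symm) hy.symm
    rw [inner_preAdjoint]
    refine h1.trans ?_
    rw [← hx, ← hy, norm₁_ι₁, norm₁_ι₁, ENNReal.ofReal_mul' (norm_nonneg _), ofReal_norm,
      mul_right_comm]
    gcongr
    exact le_max_left _ _

variable [IsTopologicalAddGroup V] [T2Space V]

lemma exists_windowBound [NormedSpace ℝ H] {E : BanachCouple 𝕜 B₀ B₁ V} {σ A D : ℝ}
    {U : ℝ → H →L[𝕜] ConjDual 𝕜 B₀} (hL : E.IsDispersive σ A D fun s => preAdjoint (U s))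
    (hσ : 0 < σ) {θ θ' : ℝ} (hθ : θ ∈ Icc (0 : ℝ) 1) (hθ' : θ' ∈ Icc (0 : ℝ) 1) (hle : θ ≤ θ')
    (hcond : σ < 1 ∨ (σ = 1 ∧ θ < 1 ∧ θ' < 1) ∨
      (1 < σ ∧ (σ - 1) / σ * (1 - θ) ≤ 1 - θ' ∧ (σ - 1) / σ * (1 - θ') ≤ 1 - θ))
    {κ : ℝ} (hκ : κ = 1 - σ * (θ' / 2 - θ / 2)) (hκ0 : 0 < κ) {W : ℤ → ℝ → Set ℝ} {δ : ℤ → ℝ}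
    (hW : IsWindowSystem W δ) (hWδ : σ * θ = 0 ∨ ∀ j t, W j t ⊆ Iic (t - δ j)) :
    ∃ C : ℝ≥0, C ≠ 0 ∧ E.WindowBound U W δ θ θ' (σ * θ) κ C := by
  obtain ⟨C, hC⟩ := hL.exists_enorm_inner_integral_local_le hσ hθ hθ' hle hcond hκ hκ0
  refine ⟨C + 1, by positivity, fun j t F₀ F x y hF₀ hF hFF hxy => ?_⟩
  rw [← inner_preAdjoint]
  refine (hC t (δ j) (W j t) F₀ F x y (hW.δ_pos j) (hW.measurableSet_apply j t)
    (hWδ.imp (fun h => (mul_eq_zero.1 h).resolve_left hσ.ne') fun h => h j t)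
    hF₀ hF hFF hxy).trans ?_
  rw [mul_right_comm]
  gcongr
  exact_mod_cast le_self_add

section

variable [NormedSpace ℝ H] {E : BanachCouple 𝕜 B₀ B₁ V} {σ A D : ℝ}
  {U : ℝ → H →L[𝕜] ConjDual 𝕜 B₀}
  {W : ℤ → ℝ → Set ℝ} {δ : ℤ → ℝ} {θ θ' α κ : ℝ} {C C' : ℝ≥0} {q p : ℝ≥0∞}

/-- The estimate for the integral itself. -/
lemma weakLpNorm_dualENorm_retarded_le (hL : E.IsDispersive σ A D fun s => preAdjoint (U s))
    (hW : IsWindowSystem W δ) (hC0 : C ≠ 0) (hC : E.WindowBound U W δ θ θ' α κ C)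
    (hC' : ∀ f : ℝ → ℝ≥0∞, Measurable f →
      weakLpNorm q (windowSum W δ α κ f) ≤ C' * (∫⁻ s, f s) ^ κ)
    (hκ : 0 < κ) (hp : p⁻¹ = ENNReal.ofReal κ)
    {F₀ : ℝ → B₀} {F : ℝ → E.Interp θ'} (hF₀ : ∀ t, IntegrableOn F₀ (Iio t))
    (hF : AEStronglyMeasurable F volume) (hFF : ∀ᵐ s, E.ι₀ (F₀ s) = E.incl θ' (F s)) :
    weakLpNorm q (fun t => dualENorm (Y := E.Interp θ) E.ι₀ (E.incl θ) (retarded U F₀ t)) ≤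
      (C * C' : ℝ≥0) * eLpNorm F p volume := by
  have hFF' : ∀ᵐ s, E.ι₀ (F₀ s) = E.incl θ' (hF.mk F s) := by
    filter_upwards [hFF, hF.ae_eq_mk] with s h1 h2
    rw [h1, h2]
  have hm : Measurable fun s => ‖hF.mk F s‖ₑ ^ (1 / κ) :=
    hF.stronglyMeasurable_mk.enorm.pow_const _
  calc _ ≤ weakLpNorm q (fun t => C * windowSum W δ α κ (fun s => ‖hF.mk F s‖ₑ ^ (1 / κ)) t) :=
        weakLpNorm_mono_ae <| ae_of_all _ fun t => dualENorm_retarded_le hL hW hC (hF₀ t)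
          hF.stronglyMeasurable_mk.aestronglyMeasurable hFF'
    _ ≤ C * (C' * (∫⁻ s, ‖hF.mk F s‖ₑ ^ (1 / κ)) ^ κ) :=
        (weakLpNorm_const_mul_le hC0 _).trans (by gcongr; exact hC' _ hm)
    _ = _ := by
        rw [eLpNorm_congr_ae hF.ae_eq_mk, eLpNorm_eq_lintegral_rpow_of_inv_eq hκ hp,
          ENNReal.coe_mul, mul_assoc]

/-- The extension is the sum of the extensions of the parts that come from the windows. The sum
converges for almost every `t`, by the weak-type bound. -/
lemma exists_retarded_extension (hL : E.IsDispersive σ A D fun s => preAdjoint (U s))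
    (hW : IsWindowSystem W δ) (hC0 : C ≠ 0) (hC : E.WindowBound U W δ θ θ' α κ C)
    (hC' : ∀ f : ℝ → ℝ≥0∞, Measurable f →
      weakLpNorm q (windowSum W δ α κ f) ≤ C' * (∫⁻ s, f s) ^ κ)
    (hq : q ≠ 0) (hκ : 0 < κ) (hp : p⁻¹ = ENNReal.ofReal κ) [Fact (1 ≤ p)]
    (hd : Dense {y : E.Interp θ | ∃ x, E.ι₀ x = E.incl θ y})
    (hd' : Dense {y : E.Interp θ' | ∃ x, E.ι₀ x = E.incl θ' y}) :
    ∃ T : Lp (E.Interp θ') p volume → ℝ → ConjDual 𝕜 (E.Interp θ),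
      (∀ F G, T (F + G) =ᵐ[volume] T F + T G) ∧
      (∀ (c : 𝕜) F, T (c • F) =ᵐ[volume] c • T F) ∧
      (∀ F (g : E.Interp θ), AEStronglyMeasurable (fun t => T F t g) volume) ∧
      (∀ F, weakLpNorm q (fun t => ‖T F t‖ₑ) ≤ (C * C' : ℝ≥0) * eLpNorm F p volume) ∧
      (∀ (F₀ : ℝ → B₀) (F : Lp (E.Interp θ') p volume),
        (∀ t, IntegrableOn F₀ (Iio t)) →
        (∀ᵐ s, E.ι₀ (F₀ s) = E.incl θ' (F s)) →
        ∀ᵐ t, DualAgree E.ι₀ (E.incl θ) (retarded U F₀ t) (T F t)) := by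
  classical
  have hpt : p ≠ ∞ := by rintro rfl; simp [hκ.not_ge, eq_comm] at hp
  choose S hS hSa using fun (j : ℤ) (t : ℝ) =>
    exists_window_operator hL hC hd hd' hκ hp j t
  set M : Lp (E.Interp θ') p volume → ℝ → ℝ≥0∞ := fun F =>
    windowSum W δ α κ (fun s => ‖F s‖ₑ ^ (1 / κ)) with hM
  have hMw : ∀ F, weakLpNorm q (M F) ≤ C' * eLpNorm F p volume := fun F => by
    rw [eLpNorm_eq_lintegral_rpow_of_inv_eq hκ hp]
    exact hC' _ ((Lp.stronglyMeasurable F).enorm.pow_const _)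
  have hMt : ∀ F, ∀ᵐ t, M F t ≠ ∞ := fun F => ae_ne_top_of_weakLpNorm_ne_top hq
    (ne_top_of_le_ne_top (ENNReal.mul_ne_top ENNReal.coe_ne_top (Lp.eLpNorm_ne_top F)) (hMw F))
  have hSM : ∀ F t, ∑' j, ‖S j t F‖ₑ ≤ C * M F t := fun F t => by
    simp only [hM]
    rw [windowSum, ← ENNReal.tsum_mul_left]
    exact ENNReal.tsum_le_tsum fun j => hS j t F
  -- the sum can diverge only for `t` in a null set, which depends on `F`
  set T : Lp (E.Interp θ') p volume → ℝ → ConjDual 𝕜 (E.Interp θ) := fun F t =>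
    if M F t = ∞ then 0 else ∑' j, S j t F with hT
  have hsum : ∀ F t, M F t ≠ ∞ → HasSum (fun j => S j t F) (T F t) := fun F t ht => by
    have h1 : Summable fun j => S j t F := by
      refine Summable.of_enorm ?_
      exact ne_top_of_le_ne_top (ENNReal.mul_ne_top ENNReal.coe_ne_top ht) (hSM F t)
    simpa only [hT, if_neg ht] using h1.hasSum
  have happly : ∀ F t, M F t ≠ ∞ → ∀ y, HasSum (fun j => S j t F y) (T F t y) := fun F t ht y =>
    (hsum F t ht).map
      ({ toFun := fun u => u y, map_zero' := rfl, map_add' := fun _ _ => rfl } :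
        ConjDual 𝕜 (E.Interp θ) →+ 𝕜) (continuous_eval_const y)
  refine ⟨T, fun F G => ?_, fun c F => ?_, fun F y => ?_, fun F => ?_, fun F₀ F hF₀ hFF => ?_⟩
  · filter_upwards [hMt F, hMt G, hMt (F + G)] with t h1 h2 h3
    refine (hsum (F + G) t h3).unique ?_
    simp only [map_add]
    exact (hsum F t h1).add (hsum G t h2)
  · filter_upwards [hMt F, hMt (c • F)] with t h1 h2
    refine (hsum (c • F) t h2).unique ?_
    simp only [map_smul]
    exact (hsum F t h1).const_smul c
  · refine aestronglyMeasurable_of_tendsto_ae (u := (atTop : Filter (Finset ℤ)))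
      (f := fun s t => ∑ j ∈ s, S j t F y) (fun s => ?_) ?_
    · exact Finset.aestronglyMeasurable_fun_sum _ fun j _ =>
        aestronglyMeasurable_window_operator hL hW hd hd' hpt j (hSa j) F y
    · filter_upwards [hMt F] with t ht
      exact happly F t ht y
  · have hle : ∀ t, ‖T F t‖ₑ ≤ C * M F t := fun t => by
      by_cases ht : M F t = ∞
      · have h0 : T F t = 0 := if_pos ht
        rw [h0, ← ofReal_norm, norm_zero, ENNReal.ofReal_zero]
        exact bot_le
      · rw [← (hsum F t ht).tsum_eq]
        exact (enorm_tsum_le_tsum_enorm (f := fun j => S j t F)).trans (hSM F t)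
    calc _ ≤ weakLpNorm q (fun t => C * M F t) := weakLpNorm_mono_ae (ae_of_all _ hle)
      _ ≤ C * (C' * eLpNorm F p volume) :=
          (weakLpNorm_const_mul_le hC0 _).trans (by gcongr; exact hMw F)
      _ = _ := by rw [ENNReal.coe_mul, mul_assoc]
  · filter_upwards [hMt F] with t ht x y hxy
    have h1 : HasSum (fun j => U t (∫ s in W j t, preAdjoint (U s) (F₀ s)) x)
        (retarded U F₀ t x) :=
      (hasSum_retarded hL hW (hF₀ t)).map
        ({ toFun := fun u => u x, map_zero' := rfl, map_add' := fun _ _ => rfl } :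
          ConjDual 𝕜 B₀ →+ 𝕜) (continuous_eval_const x)
    refine h1.unique ?_
    have h2 : ∀ j, U t (∫ s in W j t, preAdjoint (U s) (F₀ s)) x = S j t F y := fun j =>
      hSa j t F₀ F ((hF₀ t).mono_set (hW.subset_Iio j t)) (ae_restrict_of_ae hFF) x y hxy
    simp_rw [h2]
    exact happly F t ht y

end

end BanachCouple

theorem theorem1p1
    {𝕜 H B₀ B₁ V : Type*} [RCLike 𝕜]
    [NormedAddCommGroup H] [InnerProductSpace 𝕜 H] [CompleteSpace H]
    [NormedAddCommGroup B₀] [NormedSpace 𝕜 B₀] [CompleteSpace B₀]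
    [NormedAddCommGroup B₁] [NormedSpace 𝕜 B₁] [CompleteSpace B₁]
    [AddCommGroup V] [Module 𝕜 V] [TopologicalSpace V] [IsTopologicalAddGroup V]
    [ContinuousSMul 𝕜 V] [T2Space V]
    -- the compatible couple of Banach spaces
    (E : BanachCouple 𝕜 B₀ B₁ V)
    (σ : ℝ) (hσ : 0 < σ)
    (U : ℝ → H →L[𝕜] ConjDual 𝕜 B₀)
    (hmeas : ∀ g : B₀, AEStronglyMeasurable (fun s => preAdjoint (U s) g) volume)
    -- the energy estimate
    (henergy : ∃ A : ℝ, ∀ (t : ℝ) (f : H), ‖U t f‖ ≤ A * ‖f‖)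
    -- the dispersive estimate, for `g ∈ B₀ ∩ B₁`
    (hdisp : ∃ D : ℝ, ∀ t s : ℝ, t ≠ s → ∀ (g₀ : B₀) (g₁ : B₁), E.ι₀ g₀ = E.ι₁ g₁ →
      dualENorm (Y := B₁) E.ι₀ E.ι₁ (U t (preAdjoint (U s) g₀))
        ≤ ENNReal.ofReal (D * |t - s| ^ (-σ) * ‖g₁‖))
    (θ θ' : ℝ) (hθ : θ ∈ Icc (0 : ℝ) 1) (hθ' : θ' ∈ Icc (0 : ℝ) 1)
    (hcond : σ < 1 ∨ (σ = 1 ∧ θ < 1 ∧ θ' < 1) ∨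
      (1 < σ ∧ (σ - 1) / σ * (1 - θ) ≤ 1 - θ' ∧ (σ - 1) / σ * (1 - θ') ≤ 1 - θ))
    -- `q`, `q̃` and the conjugate exponent `q̃'`
    (q r r' : ℝ≥0∞) (hr : ENNReal.HolderConjugate r r')
    (hq : ENNReal.ofReal (σ * θ) = q⁻¹)
    (hlt : q⁻¹ < r'⁻¹)
    (hr' : r'⁻¹ = ENNReal.ofReal (1 - σ * (θ' / 2 - θ / 2)))
    (hle : θ ≤ θ') :
    ∃ C : ℝ≥0,
      -- the estimate for all `F ∈ L^{q̃'}(B_θ')` for which the integral converges absolutely in `B₀^*`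
      (∀ (F₀ : ℝ → B₀) (F : ℝ → E.Interp θ'),
        (∀ t, IntegrableOn F₀ (Iio t)) → MemLp F r' volume →
        (∀ᵐ s, E.ι₀ (F₀ s) = E.incl θ' (F s)) →
        weakLpNorm q (fun t => dualENorm (Y := E.Interp θ) E.ι₀ (E.incl θ) (retarded U F₀ t))
          ≤ C * eLpNorm F r' volume) ∧
      -- the extension of the retarded operator to all of `L^{q̃'}(B_θ')`
      ((θ' = 1 → Dense {g₁ : B₁ | ∃ g₀ : B₀, E.ι₀ g₀ = E.ι₁ g₁}) →
        ∃ T : Lp (E.Interp θ') r' volume → ℝ → ConjDual 𝕜 (E.Interp θ),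
          (∀ F G, T (F + G) =ᵐ[volume] T F + T G) ∧
          (∀ (c : 𝕜) F, T (c • F) =ᵐ[volume] c • T F) ∧
          (∀ F (g : E.Interp θ), AEStronglyMeasurable (fun t => T F t g) volume) ∧
          (∀ F, weakLpNorm q (fun t => ‖T F t‖ₑ) ≤ C * eLpNorm F r' volume) ∧
          (∀ (F₀ : ℝ → B₀) (F : Lp (E.Interp θ') r' volume),
            (∀ t, IntegrableOn F₀ (Iio t)) →
            (∀ᵐ s, E.ι₀ (F₀ s) = E.incl θ' (F s)) →
            ∀ᵐ t, DualAgree E.ι₀ (E.incl θ) (retarded U F₀ t) (T F t))) := by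
  let _ : NormedSpace ℝ H := NormedSpace.restrictScalars ℝ 𝕜 H
  obtain ⟨A, D, hL⟩ := E.exists_isDispersive hmeas henergy hdisp
  set κ : ℝ := 1 - σ * (θ' / 2 - θ / 2) with hκ
  have hα : 0 ≤ σ * θ := mul_nonneg hσ.le hθ.1
  rw [← hq, hr', ENNReal.ofReal_lt_ofReal_iff_of_nonneg hα] at hlt
  have hκ0 : 0 < κ := hα.trans_lt hlt
  have hκ1 : κ ≤ 1 := by
    have : 0 ≤ σ * (θ' / 2 - θ / 2) := mul_nonneg hσ.le (by linarith)
    linarith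
  have : Fact (1 ≤ r') := ⟨by
    rw [← ENNReal.inv_le_one, hr']
    exact ENNReal.ofReal_le_one.2 hκ1⟩
  have hq0 : q ≠ 0 := by rintro rfl; simp at hq
  obtain ⟨W, δ, hW, hWδ, C', hC'⟩ := exists_isWindowSystem hα hlt hq
  obtain ⟨C, hC0, hC⟩ := BanachCouple.exists_windowBound hL hσ hθ hθ' hle hcond hκ hκ0 hW hWδ
  refine ⟨C * C', fun F₀ F hF₀ hF hFF => ?_, fun hdense => ?_⟩
  · exact BanachCouple.weakLpNorm_dualENorm_retarded_le hL hW hC0 hC hC' hκ0 hr' hF₀ hF.1 hFF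
  · refine BanachCouple.exists_retarded_extension hL hW hC0 hC hC' hq0 hκ0 hr' (E.dense_interp hθ fun h => ?_)
      (E.dense_interp hθ' hdense)
    exact hdense (le_antisymm hθ'.2 (h ▸ hle))
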